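/- Fix a field $\mathbf k$. "Hopf algebra" means here a graded vector space with an associative unital graded product and a coassociative counital graded coproduct such that the coproduct and the counit are algebra morphisms (connectedness and an antipode are not required). A Hopf subalgebra is a homogeneous subspace that contains the unit and is stable under product and coproduct. **Decorated permutations.** A decoration set is a graded set $\mathfrak X=\bigsqcup_n\mathfrak X_n$ with a concatenation $\mathfrak X_m\times\mathfrak X_n\to\mathfrak X_{m+n}$, $(X,Y)\mapsto XY$, and selections $X\mapsto X_R$ from $\mathfrak X_p$ to $\mathfrak X_{|R|}$ for $R\subseteq[p]$, such that $(XY)Z=X(YZ)$, $(X_R)_S=X_{\{r_s:\,s\in S\}}$ for $R=\{r_1<\dots<r_q\}$, and $X_RY_S=(XY)_{R\cup(S+m)}$. The space $\mathbf k\mathfrak P$ has basis $F_{(\sigma,X)}$, $\sigma\in\mathfrak S_n$, $X\in\mathfrak X_n$, $n\ge 0$, with $$F_{(\sigma,X)}\cdot F_{(\tau,Y)}=\sum_{\rho}F_{(\rho,XY)},\qquad \Delta F_{(\rho,Z)}=\sum_{k=0}^pF_{(\mathrm{std}(\rho_1\cdots\rho_k),\,Z_{\rho([k])})}\otimes F_{(\mathrm{std}(\rho_{k+1}\cdots\rho_p),\,Z_{\rho([p]\smallsetminus[k])})},$$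 where $\rho$ runs over the shifted shuffles of $\sigma$ and $\tau$; the counit sends $F_{(\sigma,X)}$ to $1$ in degree $0$ and to $0$ in positive degree. **Arcs.** An extended arc of size $n$ is $(a,b,n,S)$ with $0\le a<b\le n+1$ and $S\subseteq\,]a,b[$. It is initial if $a=0$, terminal if $b=n+1$, and strict, or simply an arc, if $1\le a<b\le n$. An (extended) arc ideal is a set of (extended) arcs of size $n$ that contains, with $(a,d,n,S)$, all $(b,c,n,S\cap\,]b,c[)$ with $a\le b<c\le d$. Let $\mathfrak I^\star_n$ be the set of extended arc ideals of size $n$. For $I\in\mathfrak I^\star_m$ and $J\in\mathfrak I^\star_n$, the concatenation $IJ$ consists of the non-terminal arcs of $I$ (now of size $m+n$), the non-initial arcs of $J$ shifted by $m$, and the arcs $(a,d+m,m+n,R\cup(S+m))$ for $(a,m+1,m,R)\in I$ and $(0,d,n,S)\in J$. For $K\in\mathfrak I^\star_p$, $X=\{x_1<\dots<x_q\}\subseteq[p]$, $x_0=0$ and $x_{q+1}=p+1$, the selection $K_X$ consists of the $(a,b,q,S)$ such that there are arcs $(y_0,y_1,p,S_1),\dots,(y_{r-1},y_r,p,S_r)$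 in $K$ with $r\ge 1$, $y_0=x_a$, $y_r=x_b$, $y_1,\dots,y_{r-1}\notin X$ and $S=\{\ell\in[q]: x_\ell\in\bigcup_i S_i\}$. The distinguished element of degree $0$, which decorates the unit, is $\{(0,1,0,\varnothing)\}$. **Diagrams.** For $\sigma\in\mathfrak S_n$ and an arc ideal $I$ let $\eta_I(\sigma)$ be the set of arcs $\alpha(i,j,\sigma)=(\sigma_j,\sigma_i,n,\{\sigma_k: k<i,\ \sigma_j<\sigma_k<\sigma_i\})$ for the pairs $i<j$ such that $\sigma_i>\sigma_j$, no $\sigma_k$ with $i<k<j$ lies in $]\sigma_j,\sigma_i[$, $\alpha(i,j,\sigma)\in I$, and there is no other such pair $(k,l)$ with $i\le k<l\le j$ and $\sigma_k\ge\sigma_i>\sigma_j\ge\sigma_l$. Two arcs cross if one passes strictly above the other at some point and strictly below it at another point; a noncrossing arc diagram is a set of pairwise noncrossing arcs of the same size with distinct left endpoints and distinct right endpoints. Let $\mathrm{arcs}(K)$ be the set of strict arcs of $K\in\mathfrak I^\star_n$, and let $\mathbf k\mathfrak D^\star\subseteq\mathbf k\mathfrak P$, for $\mathfrak X=\mathfrak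 I^\star$, be spanned by the elements $P_{(D,K)}=\sum_{\eta_{\mathrm{arcs}(K)}(\sigma)=D}F_{(\sigma,K)}$, where $K$ is an extended arc ideal and $D\subseteq\mathrm{arcs}(K)$ is a noncrossing arc diagram. **Permutrees.** Let $\delta=(\delta_1,\dots,\delta_n)$ with $\delta_v=(\mathrm{north}(v),\mathrm{south}(v))\in\{0,1\}^2$. A $\delta$-permutree is a directed tree on the vertex set $[n]$ such that a vertex $v$ with $\mathrm{north}(v)=0$ has at most one parent; a vertex $v$ with $\mathrm{north}(v)=1$ has at most one left and at most one right parent, where a parent $u$ is left (right) if all vertices of the component of $u$ in the tree without $v$ are smaller (larger) than $v$, and every parent is left or right; and the same holds for $\mathrm{south}$ and children. The permutree algebra is the span of the elements $\sum_\sigma F_{(\sigma,\delta)}$ ($\sigma$ ranging over the linear extensions of $T$, children before parents) for all $\delta$ and all $\delta$-permutrees $T$, in the algebra $\mathbf k\mathfrak P$ of permutations decorated by words on $\{0,1\}^2$ (with concatenation and subwords). **Proposition.** 1. $\mathfrak I^\star=\bigsqcup_n\mathfrak I_n^\star$ is a decoration set, and the function $\mathrm{arcs}$ is conservative: the strict arcs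 of $I$ (now of size $m+n$) and the strict arcs of $J$ shifted by $m$ belong to $\mathrm{arcs}(IJ)$ for $I\in\mathfrak I^\star_m$ and $J\in\mathfrak I^\star_n$, and if $(r_a,r_b,p,S)\in\mathrm{arcs}(K)$, with $R=\{r_1<\dots<r_q\}\subseteq[p]$ and $1\le a<b\le q$, then $(a,b,q,\{c\in[q]:r_c\in S\})\in\mathrm{arcs}(K_R)$. 2. For $\mathfrak X=\mathfrak I^\star$, $\mathbf k\mathfrak P$ is a Hopf algebra and $\mathbf k\mathfrak D^\star$ is a Hopf subalgebra of it. 3. $\mathbf k\mathfrak D^\star$ involves the classes of all lattice congruences of the weak order: for every lattice congruence $\equiv$ of the weak order on $\mathfrak S_n$ there is $K\in\mathfrak I^\star_n$ such that $\mathrm{arcs}(K)$ is the set of arcs of the join-irreducible permutations that are not contracted by $\equiv$, the classes of $\equiv$ are the nonempty fibers of $\eta_{\mathrm{arcs}(K)}$, and $\sum_{\sigma\in C}F_{(\sigma,K)}\in\mathbf k\mathfrak D^\star$ for every class $C$. Conversely, for every $K\in\mathfrak I^\star_n$ the nonempty fibers of $\eta_{\mathrm{arcs}(K)}$ are the classes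 of a lattice congruence. 4. The algebra of permutations decorated by words on $\{0,1\}^2$ is a Hopf algebra, and the permutree algebra is a Hopf subalgebra of it. Let $I_\delta$ be the set of extended arcs $(a,b,n,S)$ with $\mathrm{north}(c)=0$ for $c\in S$ and $\mathrm{south}(c)=0$ for $c\in\,]a,b[\,\smallsetminus S$. The linear map $F_{(\sigma,\delta)}\mapsto F_{(\sigma,I_\delta)}$ is an injective morphism of graded Hopf algebras; it sends the element of each $\delta$-permutree to some $P_{(D,I_\delta)}$, and it maps the permutree algebra onto a Hopf subalgebra of $\mathbf k\mathfrak D^\star$. -/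

import Mathlib

open scoped TensorProduct

namespace ArcHopf

/-! ### Graded bialgebras given by explicit operations -/

/-- A product, a unit, a coproduct, a counit and a grading on a `k`-vector space `V`. -/
structure HopfData (k : Type*) [Field k] (V : Type*) [AddCommGroup V] [Module k V] where
  mul : V →ₗ[k] V →ₗ[k] V
  one : V
  comul : V →ₗ[k] V ⊗[k] V
  counit : V →ₗ[k] k
  gr : ℕ → Submodule k V

/-- The operations form a graded Hopf algebra, in the sense that is used for combinatorial Hopf
algebras that need not be connected: a graded, associative, unital algebra and a graded,
coassociative, counital coalgebra such that the coproduct and the counit are morphisms of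
algebras. (`TensorProduct.map₂ mul mul` is the product `(a ⊗ b) (c ⊗ d) = ac ⊗ bd`.) -/
structure IsGradedHopf {k : Type*} [Field k] {V : Type*} [AddCommGroup V] [Module k V]
    (A : HopfData k V) : Prop where
  mul_assoc : ∀ x y z, A.mul (A.mul x y) z = A.mul x (A.mul y z)
  one_mul : ∀ x, A.mul A.one x = x
  mul_one : ∀ x, A.mul x A.one = x
  coassoc : ∀ x, TensorProduct.assoc k V V V (A.comul.rTensor V (A.comul x))
    = A.comul.lTensor V (A.comul x)
  counit_left : ∀ x, A.counit.rTensor V (A.comul x) = (1 : k) ⊗ₜ[k] x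
  counit_right : ∀ x, A.counit.lTensor V (A.comul x) = x ⊗ₜ[k] (1 : k)
  comul_mul : ∀ x y, A.comul (A.mul x y)
    = TensorProduct.map₂ A.mul A.mul (A.comul x) (A.comul y)
  comul_one : A.comul A.one = A.one ⊗ₜ[k] A.one
  counit_mul : ∀ x y, A.counit (A.mul x y) = A.counit x * A.counit y
  counit_one : A.counit A.one = 1
  gr_internal : DirectSum.IsInternal A.gr
  gr_one : A.one ∈ A.gr 0
  gr_mul : ∀ m n, ∀ x ∈ A.gr m, ∀ y ∈ A.gr n, A.mul x y ∈ A.gr (m + n)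
  gr_comul : ∀ p, ∀ x ∈ A.gr p, A.comul x ∈ ⨆ ij ∈ Finset.HasAntidiagonal.antidiagonal p,
    LinearMap.range (TensorProduct.map (A.gr ij.1).subtype (A.gr ij.2).subtype)
  gr_counit : ∀ p, p ≠ 0 → ∀ x ∈ A.gr p, A.counit x = 0

/-- `W` is a graded Hopf subalgebra: a homogeneous subspace that contains the unit and is stable
under the product and the coproduct (`Δ W ⊆ W ⊗ W`). -/
structure IsHopfSubalgebra {k : Type*} [Field k] {V : Type*} [AddCommGroup V] [Module k V]
    (A : HopfData k V) (W : Submodule k V) : Prop where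
  one_mem : A.one ∈ W
  mul_mem : ∀ x ∈ W, ∀ y ∈ W, A.mul x y ∈ W
  comul_mem : ∀ x ∈ W, A.comul x ∈ LinearMap.range (TensorProduct.map W.subtype W.subtype)
  homogeneous : W = ⨆ n, W ⊓ A.gr n

/-- A linear map that respects product, unit, coproduct, counit and grading. -/
structure IsHopfMorphism {k : Type*} [Field k] {V V' : Type*} [AddCommGroup V] [Module k V]
    [AddCommGroup V'] [Module k V'] (A : HopfData k V) (B : HopfData k V')
    (f : V →ₗ[k] V') : Prop where
  map_mul : ∀ x y, f (A.mul x y) = B.mul (f x) (f y)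
  map_one : f A.one = B.one
  map_comul : ∀ x, B.comul (f x) = TensorProduct.map f f (A.comul x)
  map_counit : ∀ x, B.counit (f x) = A.counit x
  map_gr : ∀ n, ∀ x ∈ A.gr n, f x ∈ B.gr n

/-! ### Decoration sets

The set `[n] = {1, …, n}` is modelled by `Fin n` (so `i : Fin n` stands for `i + 1`), and a
`q`-element subset `R = {r₁ < ⋯ < r_q}` of `[p]` by its increasing enumeration
`r : Fin q ↪o Fin p`. -/

/-- The operations of a decoration set: a graded set with concatenation, selection, and a
distinguished element of degree `0`, which gives the unit. -/
structure DecorationData where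
  X : ℕ → Type
  concat : ∀ {m n : ℕ}, X m → X n → X (m + n)
  select : ∀ {p q : ℕ}, X p → (Fin q ↪o Fin p) → X q
  empty : X 0

/-- The increasing enumeration of `R ∪ S^{→ m}` for `R ⊆ [m]` and `S ⊆ [n]`. -/
def blockEmb {q m s n : ℕ} (R : Fin q ↪o Fin m) (S : Fin s ↪o Fin n) :
    Fin (q + s) ↪o Fin (m + n) :=
  OrderEmbedding.ofStrictMono
    (Fin.append (fun i => Fin.castAdd n (R i)) (fun j => Fin.natAdd m (S j))) (by
      intro i j
      refine Fin.addCases (fun i => ?_) (fun i => ?_) i <;>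
        refine Fin.addCases (fun j => ?_) (fun j => ?_) j <;> intro h <;>
        simp only [Fin.append_left, Fin.append_right, Fin.lt_def, Fin.val_castAdd,
          Fin.val_natAdd] at h ⊢
      · exact Fin.lt_def.1 (R.strictMono (Fin.lt_def.2 h))
      · omega
      · omega
      · have := Fin.lt_def.1 (S.strictMono (Fin.lt_def.2 (show (i : ℕ) < j by omega)))
        omega)

/-- The three axioms of a decoration set. -/
structure IsDecorationSet (𝔛 : DecorationData) : Prop where
  concat_assoc : ∀ {m n p : ℕ} (x : 𝔛.X m) (y : 𝔛.X n) (z : 𝔛.X p),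
    (⟨_, 𝔛.concat (𝔛.concat x y) z⟩ : Σ n, 𝔛.X n) = ⟨_, 𝔛.concat x (𝔛.concat y z)⟩
  select_select : ∀ {p q s : ℕ} (x : 𝔛.X p) (R : Fin q ↪o Fin p) (S : Fin s ↪o Fin q),
    𝔛.select (𝔛.select x R) S = 𝔛.select x (S.trans R)
  concat_select : ∀ {m n q s : ℕ} (x : 𝔛.X m) (y : 𝔛.X n)
    (R : Fin q ↪o Fin m) (S : Fin s ↪o Fin n),
    𝔛.concat (𝔛.select x R) (𝔛.select y S) = 𝔛.select (𝔛.concat x y) (blockEmb R S)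

/-! ### Permutations: standardization, shifted shuffle, weak order -/

/-- The increasing enumeration of the values `ρ(R)` that `ρ` takes at the positions in `R`. -/
def valuesAt {p q : ℕ} (ρ : Equiv.Perm (Fin p)) (R : Fin q ↪o Fin p) : Fin q ↪o Fin p :=
  Finset.orderEmbOfFin (Finset.univ.map (R.toEmbedding.trans ρ.toEmbedding)) (by simp)

/-- Standardization of the word `ρ(r₁) … ρ(r_q)` (the entries of `ρ` at the positions in `R`):
`stdPos ρ R i` is the rank of `ρ(r_i)` among the values `ρ(R)`. -/
noncomputable def stdPos {p q : ℕ} (ρ : Equiv.Perm (Fin p)) (R : Fin q ↪o Fin p) :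
    Equiv.Perm (Fin q) :=
  (Equiv.ofBijective
    (fun i => (⟨ρ (R i), by simp⟩ :
      {x // x ∈ Finset.univ.map (R.toEmbedding.trans ρ.toEmbedding)}))
    ⟨fun i j h => by simpa using h, fun ⟨x, hx⟩ => by
      obtain ⟨i, -, hi⟩ := Finset.mem_map.1 hx
      exact ⟨i, Subtype.ext hi⟩⟩).trans
  (Finset.orderIsoOfFin (Finset.univ.map (R.toEmbedding.trans ρ.toEmbedding))
    (by simp)).symm.toEquiv

/-- Standardization of the word obtained from `ρ` by deleting the entries whose values are not
in `R`; exchanging positions and values is passing to the inverse. -/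
noncomputable def stdVal {p q : ℕ} (ρ : Equiv.Perm (Fin p)) (R : Fin q ↪o Fin p) :
    Equiv.Perm (Fin q) :=
  (stdPos ρ⁻¹ R)⁻¹

open Classical in
/-- The shifted shuffle of two permutations. -/
noncomputable def shiftedShuffle {m n : ℕ} (σ : Equiv.Perm (Fin m)) (τ : Equiv.Perm (Fin n)) :
    Finset (Equiv.Perm (Fin (m + n))) :=
  Finset.univ.filter fun ρ =>
    stdVal ρ (Fin.castAddOrderEmb n) = σ ∧ stdVal ρ (Fin.natAddOrderEmb m) = τ

/-- The enumeration of `[k] ⊆ [p]`. -/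
def firstEmb {p : ℕ} (k : Fin (p + 1)) : Fin (k : ℕ) ↪o Fin p :=
  OrderEmbedding.ofStrictMono (fun i => ⟨i, by omega⟩) fun _ _ h => h

/-- The enumeration of `[p] ∖ [k]`. -/
def lastEmb {p : ℕ} (k : Fin (p + 1)) : Fin (p - (k : ℕ)) ↪o Fin p :=
  OrderEmbedding.ofStrictMono (fun i => ⟨k + i, by omega⟩) fun i j h => by
    simp only [Fin.lt_def] at h ⊢
    omega

/-- `σ ≤ τ` in the weak order: every inversion of `σ`, that is, every pair of values `a < b` such
that `b` stands before `a`, is an inversion of `τ`. -/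
def WeakLE {n : ℕ} (σ τ : Equiv.Perm (Fin n)) : Prop :=
  ∀ a b : Fin n, a < b → σ⁻¹ b < σ⁻¹ a → τ⁻¹ b < τ⁻¹ a

/-- `z` is the join of `x` and `y` in the weak order. -/
def IsWeakJoin {n : ℕ} (x y z : Equiv.Perm (Fin n)) : Prop :=
  WeakLE x z ∧ WeakLE y z ∧ ∀ w, WeakLE x w → WeakLE y w → WeakLE z w

/-- `z` is the meet of `x` and `y` in the weak order. -/
def IsWeakMeet {n : ℕ} (x y z : Equiv.Perm (Fin n)) : Prop :=
  WeakLE z x ∧ WeakLE z y ∧ ∀ w, WeakLE w x → WeakLE w y → WeakLE w z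

/-- Lattice congruences of the weak order. -/
structure IsLatticeCongruence {n : ℕ} (r : Setoid (Equiv.Perm (Fin n))) : Prop where
  join : ∀ x x' y y' z z', r x x' → r y y' → IsWeakJoin x y z → IsWeakJoin x' y' z' → r z z'
  meet : ∀ x x' y y' z z', r x x' → r y y' → IsWeakMeet x y z → IsWeakMeet x' y' z' → r z z'

/-! ### The Hopf algebra of decorated permutations -/

/-- Permutations decorated by a decoration set. -/
abbrev DecPerm (𝔛 : DecorationData) : Type := Σ n : ℕ, Equiv.Perm (Fin n) × 𝔛.X n

/-- The basis vector of a decorated permutation. -/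
noncomputable def F (k : Type*) [Field k] {𝔛 : DecorationData} {n : ℕ} (σ : Equiv.Perm (Fin n))
    (x : 𝔛.X n) : DecPerm 𝔛 →₀ k :=
  Finsupp.single ⟨n, σ, x⟩ 1

/-- The basis vector of the standardization of `(ρ, z)` at a set `R` of positions: the
permutation is standardized, and the decoration is restricted to the values `ρ(R)`. -/
noncomputable def FStd (k : Type*) [Field k] {𝔛 : DecorationData} {p q : ℕ}
    (ρ : Equiv.Perm (Fin p)) (z : 𝔛.X p) (R : Fin q ↪o Fin p) : DecPerm 𝔛 →₀ k :=
  F k (stdPos ρ R) (𝔛.select z (valuesAt ρ R))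

/-- Product, coproduct, unit, counit and grading on the vector space with basis the decorated
permutations: the product is the shifted shuffle, the coproduct cuts the word of a permutation
into a prefix and a suffix and standardizes both. -/
noncomputable def decPermAlgebra (k : Type*) [Field k] (𝔛 : DecorationData) :
    HopfData k (DecPerm 𝔛 →₀ k) where
  mul := Finsupp.lsum k fun a => LinearMap.toSpanSingleton k _
    (Finsupp.lsum k fun b => LinearMap.toSpanSingleton k _
      (∑ ρ ∈ shiftedShuffle a.2.1 b.2.1, F k ρ (𝔛.concat a.2.2 b.2.2)))
  one := F k (1 : Equiv.Perm (Fin 0)) 𝔛.empty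
  comul := Finsupp.lsum k fun a => LinearMap.toSpanSingleton k _
    (∑ i : Fin (a.1 + 1),
      FStd k a.2.1 a.2.2 (firstEmb i) ⊗ₜ[k] FStd k a.2.1 a.2.2 (lastEmb i))
  counit := Finsupp.lsum k fun a => LinearMap.toSpanSingleton k _ (if a.1 = 0 then 1 else 0)
  gr n := Finsupp.supported k k {a | a.1 = n}

/-! ### Arcs and arc ideals -/

/-- The data `(a, b, S)` of a quadruple `(a, b, n, S)`; the size `n` is recorded by the ambient
set (`IsArc n` or `IsExtArc n`), so that the augmentation `(a, b, m, S) ↦ (a, b, m + n, S)` does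
not change the data. -/
@[ext] structure RawArc where
  left : ℕ
  right : ℕ
  above : Finset ℕ

/-- Arcs of size `n`: `1 ≤ a < b ≤ n` and `S ⊆ ]a, b[`. -/
def IsArc (n : ℕ) (α : RawArc) : Prop :=
  1 ≤ α.left ∧ α.left < α.right ∧ α.right ≤ n ∧ α.above ⊆ Finset.Ioo α.left α.right

/-- Extended arcs of size `n`: `0 ≤ a < b ≤ n + 1` and `S ⊆ ]a, b[`. -/
def IsExtArc (n : ℕ) (α : RawArc) : Prop :=
  α.left < α.right ∧ α.right ≤ n + 1 ∧ α.above ⊆ Finset.Ioo α.left α.right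

/-- The restriction of an arc to the interval `[b, c]`. -/
def RawArc.restrict (α : RawArc) (b c : ℕ) : RawArc :=
  ⟨b, c, α.above ∩ Finset.Ioo b c⟩

/-- The arc shifted by `m` to the right. -/
def RawArc.shift (α : RawArc) (m : ℕ) : RawArc :=
  ⟨α.left + m, α.right + m, α.above.image (· + m)⟩

/-- Upper ideals of the forcing order: sets that contain all restrictions of their arcs. -/
def ForcingClosed (C : Set RawArc) : Prop :=
  ∀ α ∈ C, ∀ b c, α.left ≤ b → b < c → c ≤ α.right → α.restrict b c ∈ C

/-- Arc ideals of size `n`. -/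
@[ext] structure ArcIdeal (n : ℕ) where
  carrier : Set RawArc
  isArc : ∀ α ∈ carrier, IsArc n α
  closed : ForcingClosed carrier

/-- Extended arc ideals of size `n`. -/
@[ext] structure ExtArcIdeal (n : ℕ) where
  carrier : Set RawArc
  isExtArc : ∀ α ∈ carrier, IsExtArc n α
  closed : ForcingClosed carrier

/-- The arc ideal of the strict arcs of an extended arc ideal. -/
def ExtArcIdeal.strict {n : ℕ} (I : ExtArcIdeal n) : ArcIdeal n where
  carrier := {α ∈ I.carrier | 1 ≤ α.left ∧ α.right ≤ n}
  isArc α h := ⟨h.2.1, (I.isExtArc α h.1).1, h.2.2, (I.isExtArc α h.1).2.2⟩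
  closed α h b c h1 h2 h3 := ⟨I.closed α h.1 b c h1 h2 h3,
    le_trans h.2.1 h1, le_trans h3 h.2.2⟩

/-- Conservative functions from a decoration set to arc ideals. -/
structure IsConservative (𝔛 : DecorationData) (arcs : ∀ {n : ℕ}, 𝔛.X n → ArcIdeal n) :
    Prop where
  concat_left : ∀ {m n : ℕ} (x : 𝔛.X m) (y : 𝔛.X n),
    (arcs x).carrier ⊆ (arcs (𝔛.concat x y)).carrier
  concat_right : ∀ {m n : ℕ} (x : 𝔛.X m) (y : 𝔛.X n),
    (fun α : RawArc => α.shift m) '' (arcs y).carrier ⊆ (arcs (𝔛.concat x y)).carrier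
  select : ∀ {p q : ℕ} (z : 𝔛.X p) (R : Fin q ↪o Fin p) (a b : Fin q) (S : Finset ℕ), a < b →
    S ⊆ Finset.Ioo ((R a : ℕ) + 1) ((R b : ℕ) + 1) →
    (⟨(R a : ℕ) + 1, (R b : ℕ) + 1, S⟩ : RawArc) ∈ (arcs z).carrier →
    (⟨(a : ℕ) + 1, (b : ℕ) + 1,
      (Finset.univ.filter fun c : Fin q => (R c : ℕ) + 1 ∈ S).image
        fun c : Fin q => (c : ℕ) + 1⟩ :
      RawArc) ∈ (arcs (𝔛.select z R)).carrier

/-! ### Concatenation and selection of extended arc ideals -/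

/-- Joining two arcs that overlap in an edge: `(a, c + 1, R)` and `(c, d, S)` give
`(a, d, R ∪ S)`. -/
def RawArc.juxt (α β : RawArc) : RawArc := ⟨α.left, β.right, α.above ∪ β.above⟩

/-- The concatenation of extended arc ideals: the non-terminal arcs of `I`, the shifted
non-initial arcs of `J`, and the arcs obtained by joining a terminal arc of `I` with a shifted
initial arc of `J`, the edge from `m` to `m + 1` of `I` being identified with the shifted edge
from `0` to `1` of `J`. -/
def ExtArcIdeal.concat {m n : ℕ} (I : ExtArcIdeal m) (J : ExtArcIdeal n) :
    ExtArcIdeal (m + n) where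
  carrier := {α | α ∈ I.carrier ∧ α.right ≤ m}
    ∪ {γ | ∃ β ∈ J.carrier, 1 ≤ β.left ∧ γ = β.shift m}
    ∪ {γ | ∃ α ∈ I.carrier, ∃ β ∈ J.carrier, α.right = m + 1 ∧ β.left = 0 ∧
        γ = α.juxt (β.shift m)}
  isExtArc := by
    rintro γ ((⟨h, hr⟩ | ⟨β, h, hl, rfl⟩) | ⟨α, hα, β, hβ, hr, hl, rfl⟩)
    · obtain ⟨h1, h2, h3⟩ := I.isExtArc _ h
      exact ⟨h1, by omega, h3⟩
    · obtain ⟨h1, h2, h3⟩ := J.isExtArc _ h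
      refine ⟨by simp only [RawArc.shift]; omega, by simp only [RawArc.shift]; omega, ?_⟩
      intro x hx
      simp only [RawArc.shift, Finset.mem_image] at hx
      obtain ⟨y, hy, rfl⟩ := hx
      have := Finset.mem_Ioo.1 (h3 hy)
      simp only [RawArc.shift, Finset.mem_Ioo]
      omega
    · obtain ⟨h1, h2, h3⟩ := I.isExtArc _ hα
      obtain ⟨k1, k2, k3⟩ := J.isExtArc _ hβ
      refine ⟨by simp only [RawArc.shift, RawArc.juxt]; omega,
        by simp only [RawArc.shift, RawArc.juxt]; omega, ?_⟩
      intro x hx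
      simp only [RawArc.shift, RawArc.juxt, Finset.mem_union, Finset.mem_image] at hx
      simp only [RawArc.shift, RawArc.juxt, Finset.mem_Ioo]
      rcases hx with hx | ⟨y, hy, rfl⟩
      · have := Finset.mem_Ioo.1 (h3 hx)
        omega
      · have := Finset.mem_Ioo.1 (k3 hy)
        omega
  closed := by
    rintro γ ((⟨h, hr⟩ | ⟨β, h, hl, rfl⟩) | ⟨α, hα, β, hβ, hr, hl, rfl⟩) b c hb hbc hc
    · exact Or.inl (Or.inl ⟨I.closed _ h b c hb hbc hc, le_trans hc hr⟩)
    · simp only [RawArc.shift] at hb hc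
      refine Or.inl (Or.inr ⟨β.restrict (b - m) (c - m),
        J.closed _ h _ _ (by omega) (by omega) (by omega), ?_, ?_⟩)
      · simp only [RawArc.restrict]
        omega
      · ext x
        · simp only [RawArc.restrict, RawArc.shift]
          omega
        · simp only [RawArc.restrict, RawArc.shift]
          omega
        · simp only [RawArc.restrict, RawArc.shift, Finset.mem_inter, Finset.mem_image,
            Finset.mem_Ioo]
          constructor
          · rintro ⟨⟨y, hy, rfl⟩, h1, h2⟩
            exact ⟨y, ⟨hy, by omega, by omega⟩, rfl⟩
          · rintro ⟨y, ⟨hy, h1, h2⟩, rfl⟩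
            exact ⟨⟨y, hy, rfl⟩, by omega, by omega⟩
    · obtain ⟨h1, h2, h3⟩ := I.isExtArc _ hα
      obtain ⟨k1, k2, k3⟩ := J.isExtArc _ hβ
      simp only [RawArc.shift, RawArc.juxt] at hb hc
      have hαm : ∀ x ∈ α.above, x ≤ m := fun x hx => by
        have := Finset.mem_Ioo.1 (h3 hx)
        omega
      by_cases hcm : c ≤ m
      · refine Or.inl (Or.inl ⟨?_, hcm⟩)
        have e : (α.juxt (β.shift m)).restrict b c = α.restrict b c := by
          ext x
          · rfl
          · rfl
          · simp only [RawArc.restrict, RawArc.shift, RawArc.juxt, Finset.mem_inter,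
              Finset.mem_union, Finset.mem_image, Finset.mem_Ioo]
            constructor
            · rintro ⟨hx | ⟨y, hy, rfl⟩, h⟩
              · exact ⟨hx, h⟩
              · omega
            · rintro ⟨hx, h⟩
              exact ⟨Or.inl hx, h⟩
        rw [e]
        exact I.closed _ hα b c hb hbc (by omega)
      by_cases hbm : m + 1 ≤ b
      · refine Or.inl (Or.inr ⟨β.restrict (b - m) (c - m),
          J.closed _ hβ _ _ (by omega) (by omega) (by omega), ?_, ?_⟩)
        · simp only [RawArc.restrict]
          omega
        · ext x
          · simp only [RawArc.restrict, RawArc.shift]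
            omega
          · simp only [RawArc.restrict, RawArc.shift]
            omega
          · simp only [RawArc.restrict, RawArc.shift, RawArc.juxt, Finset.mem_inter,
              Finset.mem_union, Finset.mem_image, Finset.mem_Ioo]
            constructor
            · rintro ⟨hx | ⟨y, hy, rfl⟩, h1, h2⟩
              · have := hαm x hx
                omega
              · exact ⟨y, ⟨hy, by omega, by omega⟩, rfl⟩
            · rintro ⟨y, ⟨hy, h1, h2⟩, rfl⟩
              exact ⟨Or.inr ⟨y, hy, rfl⟩, by omega, by omega⟩
      · refine Or.inr ⟨α.restrict b (m + 1), I.closed _ hα _ _ hb (by omega) (by omega),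
          β.restrict 0 (c - m), J.closed _ hβ _ _ (by omega) (by omega) (by omega), rfl, rfl, ?_⟩
        ext x
        · simp only [RawArc.restrict, RawArc.juxt]
        · simp only [RawArc.restrict, RawArc.shift, RawArc.juxt]
          omega
        · simp only [RawArc.restrict, RawArc.shift, RawArc.juxt, Finset.mem_inter,
            Finset.mem_union, Finset.mem_image, Finset.mem_Ioo]
          constructor
          · rintro ⟨hx | ⟨y, hy, rfl⟩, h1, h2⟩
            · have := hαm x hx
              exact Or.inl ⟨hx, h1, by omega⟩
            · have := Finset.mem_Ioo.1 (k3 hy)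
              exact Or.inr ⟨y, ⟨hy, by omega, by omega⟩, rfl⟩
          · rintro (⟨hx, h1, h2⟩ | ⟨y, ⟨hy, h1, h2⟩, rfl⟩)
            · exact ⟨Or.inl hx, by omega, by omega⟩
            · exact ⟨Or.inr ⟨y, hy, rfl⟩, by omega, by omega⟩

/-- Monotone paths of arcs of `C` all of whose interior vertices avoid `X`: `ArcPath C X a b T`
says that there are `a = y₀ < ⋯ < y_r = b` with `r ≥ 1` and `y₁, …, y_{r-1} ∉ X`, and arcs
`(y_{i-1}, y_i, S_i)` in `C`, with `T = ⋃ S_i`. -/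
inductive ArcPath (C : Set RawArc) (X : Set ℕ) : ℕ → ℕ → Finset ℕ → Prop
  | single (a b : ℕ) (S : Finset ℕ) : (⟨a, b, S⟩ : RawArc) ∈ C → ArcPath C X a b S
  | cons (a y b : ℕ) (S T : Finset ℕ) : (⟨a, y, S⟩ : RawArc) ∈ C → y ∉ X →
      ArcPath C X y b T → ArcPath C X a b (S ∪ T)

/-- The enumeration `x₀ = 0 < x₁ < ⋯ < x_q < x_{q+1} = p + 1` of `{0} ∪ X ∪ {p + 1}`. -/
def extEnum {p q : ℕ} (R : Fin q ↪o Fin p) (i : ℕ) : ℕ :=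
  if i = 0 then 0 else if h : i - 1 < q then (R ⟨i - 1, h⟩ : ℕ) + 1 else p + 1

/-- The subset `X = {x₁ < ⋯ < x_q}` of `{1, …, p}` that is enumerated by `R`. -/
def selSet {p q : ℕ} (R : Fin q ↪o Fin p) : Set ℕ := Set.range fun i => (R i : ℕ) + 1

theorem extEnum_strict {p q : ℕ} (R : Fin q ↪o Fin p) {i j : ℕ} (hij : i < j) (hj : j ≤ q + 1) :
    extEnum R i < extEnum R j := by
  unfold extEnum
  by_cases hi : i = 0
  · rw [if_pos hi, if_neg (by omega)]
    split_ifs <;> omega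
  · rw [if_neg hi, if_neg (by omega), dif_pos (show i - 1 < q by omega)]
    split_ifs with h
    · have : R ⟨i - 1, by omega⟩ < R ⟨j - 1, h⟩ := by
        rw [R.lt_iff_lt, Fin.lt_def]
        show i - 1 < j - 1
        omega
      rw [Fin.lt_def] at this
      omega
    · have := (R ⟨i - 1, by omega⟩).isLt
      omega

theorem extEnum_mem {p q : ℕ} (R : Fin q ↪o Fin p) {i : ℕ} (h0 : 1 ≤ i) (hi : i ≤ q) :
    extEnum R i ∈ selSet R := by
  unfold extEnum
  rw [if_neg (by omega), dif_pos (show i - 1 < q by omega)]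
  exact ⟨_, rfl⟩

theorem ArcPath.bounds {C : Set RawArc} {X : Set ℕ}
    (hC : ∀ α ∈ C, α.left < α.right ∧ α.above ⊆ Finset.Ioo α.left α.right)
    {a b : ℕ} {T : Finset ℕ} (h : ArcPath C X a b T) : a < b ∧ T ⊆ Finset.Ioo a b := by
  induction h with
  | single a b S h => exact hC _ h
  | cons a y b S T h hy hp ih =>
    obtain ⟨h1, h2⟩ := hC _ h
    refine ⟨lt_trans h1 ih.1, ?_⟩
    intro x hx
    rcases Finset.mem_union.1 hx with hx | hx
    · have := Finset.mem_Ioo.1 (h2 hx)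
      simp only at this h1
      exact Finset.mem_Ioo.2 ⟨this.1, lt_trans this.2 ih.1⟩
    · have := Finset.mem_Ioo.1 (ih.2 hx)
      exact Finset.mem_Ioo.2 ⟨lt_trans h1 this.1, this.2⟩

theorem ArcPath.restrict {C : Set RawArc} {X : Set ℕ}
    (hC : ∀ α ∈ C, α.left < α.right ∧ α.above ⊆ Finset.Ioo α.left α.right)
    (hF : ForcingClosed C) {a b : ℕ} {T : Finset ℕ} (h : ArcPath C X a b T) :
    ∀ u v : ℕ, a ≤ u → u < v → v ≤ b → (u = a ∨ u ∈ X) → (v = b ∨ v ∈ X) →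
      ∃ T', ArcPath C X u v T' ∧ ∀ x ∈ X, u < x → x < v → (x ∈ T' ↔ x ∈ T) := by
  induction h with
  | single a b S h =>
    intro u v hu huv hv _ _
    exact ⟨_, .single u v _ (hF _ h u v hu huv hv), fun x _ h1 h2 => by simp [h1, h2]⟩
  | cons a y b S T h hy hp ih =>
    intro u v hu huv hv hu' hv'
    obtain ⟨hay, hS⟩ := hC _ h
    obtain ⟨hyb, hT⟩ := hp.bounds hC
    simp only at hay hS
    rcases lt_trichotomy v y with hvy | rfl | hvy
    · refine ⟨_, .single u v _ (hF _ h u v hu huv hvy.le), fun x _ h1 h2 => ?_⟩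
      have : x ∉ T := fun hx => by
        have := Finset.mem_Ioo.1 (hT hx)
        omega
      simp [h1, h2, this]
    · rcases hv' with hv' | hv'
      · omega
      · exact absurd hv' hy
    rcases lt_trichotomy u y with huy | rfl | huy
    · obtain ⟨T', hp', hT'⟩ := ih y v le_rfl hvy hv (Or.inl rfl) hv'
      refine ⟨_, .cons u y v _ _ (hF _ h u y hu huy le_rfl) hy hp', fun x hxX h1 h2 => ?_⟩
      have hxy : x ≠ y := fun e => hy (e ▸ hxX)
      simp only [Finset.mem_union, Finset.mem_inter, Finset.mem_Ioo]
      rcases lt_or_gt_of_ne hxy with h3 | h3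
      · have n1 : x ∉ T := fun hx => by
          have := Finset.mem_Ioo.1 (hT hx)
          omega
        have n2 : x ∉ T' := fun hx => by
          have := Finset.mem_Ioo.1 ((hp'.bounds hC).2 hx)
          omega
        simp [n1, n2, h1, h3]
      · rw [hT' x hxX h3 h2]
        have n1 : x ∉ S := fun hx => by
          have := Finset.mem_Ioo.1 (hS hx)
          omega
        simp [n1]
    · rcases hu' with hu' | hu'
      · omega
      · exact absurd hu' hy
    · have huX : u ∈ X := by
        rcases hu' with hu' | hu'
        · omega
        · exact hu'
      obtain ⟨T', hp', hT'⟩ := ih u v huy.le huv hv (Or.inr huX) hv'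
      refine ⟨T', hp', fun x hxX h1 h2 => ?_⟩
      rw [hT' x hxX h1 h2]
      have n1 : x ∉ S := fun hx => by
        have := Finset.mem_Ioo.1 (hS hx)
        omega
      simp [n1]

/-- The selection of an extended arc ideal `K` at `X = {x₁ < ⋯ < x_q} ⊆ [p]`: all extended arcs
`(a, b, q, S)` such that there is a path of arcs of `K` from `x_a` to `x_b` whose interior
vertices are not in `X`, and `S` is the set of the `ℓ ∈ [q]` such that one of the arcs of the path
passes above `x_ℓ`. -/
def ExtArcIdeal.select {p q : ℕ} (K : ExtArcIdeal p) (R : Fin q ↪o Fin p) : ExtArcIdeal q where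
  carrier := {α | α.left < α.right ∧ α.right ≤ q + 1 ∧
    ∃ T, ArcPath K.carrier (selSet R) (extEnum R α.left) (extEnum R α.right) T ∧
      α.above = (Finset.Icc 1 q).filter fun l => extEnum R l ∈ T}
  isExtArc := by
    rintro ⟨a, b, S⟩ ⟨hab, hb, T, hp, rfl⟩
    simp only at hab hb hp
    refine ⟨hab, hb, fun l hl => ?_⟩
    obtain ⟨hl, hlT⟩ := Finset.mem_filter.1 hl
    have hlq := Finset.mem_Icc.1 hl
    have hbd : extEnum R a < extEnum R l ∧ extEnum R l < extEnum R b := Finset.mem_Ioo.1 ((hp.bounds fun α h =>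
      ⟨(K.isExtArc α h).1, (K.isExtArc α h).2.2⟩).2 hlT)
    refine Finset.mem_Ioo.2 ⟨show a < l from ?_, show l < b from ?_⟩
    · by_contra hc
      rcases (not_lt.1 hc).lt_or_eq with h | h
      · have := extEnum_strict R h (show a ≤ q + 1 by omega)
        omega
      · rw [h] at hbd
        omega
    · by_contra hc
      rcases (not_lt.1 hc).lt_or_eq with h | h
      · have := extEnum_strict R h (show l ≤ q + 1 by omega)
        omega
      · rw [h] at hbd
        omega
  closed := by
    rintro ⟨a, d, S⟩ ⟨had, hd, T, hp, rfl⟩ b c hab hbc hcd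
    simp only at had hd hp hab hcd
    have mono : ∀ {i j : ℕ}, i ≤ j → j ≤ q + 1 → extEnum R i ≤ extEnum R j := fun h h' => by
      rcases h.lt_or_eq with h | rfl
      · exact (extEnum_strict R h h').le
      · exact le_rfl
    obtain ⟨T', hp', hT'⟩ := hp.restrict
      (fun α h => ⟨(K.isExtArc α h).1, (K.isExtArc α h).2.2⟩) K.closed
      (extEnum R b) (extEnum R c) (mono hab (by omega)) (extEnum_strict R hbc (by omega))
      (mono hcd hd)
      (by
        rcases hab.lt_or_eq with h | rfl
        · exact Or.inr (extEnum_mem R (by omega) (by omega))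
        · exact Or.inl rfl)
      (by
        rcases hcd.lt_or_eq with h | rfl
        · exact Or.inr (extEnum_mem R (by omega) (by omega))
        · exact Or.inl rfl)
    refine ⟨hbc, by simp only [RawArc.restrict]; omega, T', hp', ?_⟩
    have hbd := (hp'.bounds fun α h => ⟨(K.isExtArc α h).1, (K.isExtArc α h).2.2⟩).2
    ext l
    simp only [RawArc.restrict, Finset.mem_inter, Finset.mem_filter, Finset.mem_Icc,
      Finset.mem_Ioo]
    constructor
    · rintro ⟨⟨hl, hlT⟩, h1, h2⟩
      exact ⟨hl, (hT' _ (extEnum_mem R hl.1 hl.2) (extEnum_strict R h1 (by omega))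
        (extEnum_strict R h2 (by omega))).2 hlT⟩
    · rintro ⟨hl, hlT⟩
      have h := Finset.mem_Ioo.1 (hbd hlT)
      have h1 : b < l := by
        by_contra hc
        have := mono (not_lt.1 hc) (show b ≤ q + 1 by omega)
        omega
      have h2 : l < c := by
        by_contra hc
        have := mono (not_lt.1 hc) (show l ≤ q + 1 by omega)
        omega
      exact ⟨⟨hl, (hT' _ (extEnum_mem R hl.1 hl.2) h.1 h.2).1 hlT⟩, h1, h2⟩

/-- The ideal of all extended arcs of size `0`, that is, `{(0, 1, 0, ∅)}`. -/
def ExtArcIdeal.unit : ExtArcIdeal 0 where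
  carrier := {α | IsExtArc 0 α}
  isExtArc _ h := h
  closed _ h _ _ _ h2 h3 := ⟨h2, le_trans h3 h.2.1, Finset.inter_subset_right⟩

/-- Extended arc ideals with concatenation and selection. -/
def extIdeals : DecorationData where
  X := ExtArcIdeal
  concat := ExtArcIdeal.concat
  select := ExtArcIdeal.select
  empty := ExtArcIdeal.unit

/-! ### Noncrossing arc diagrams and the surjection from permutations -/

/-- The arc `(σ_j, σ_i, {σ_k | k < i and σ_j < σ_k < σ_i})` of two positions `i < j` of `σ` with
`σ_i > σ_j`. -/
def permArc {n : ℕ} (σ : Equiv.Perm (Fin n)) (i j : Fin n) : RawArc :=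
  ⟨(σ j : ℕ) + 1, (σ i : ℕ) + 1,
    (Finset.univ.filter fun k => k < i ∧ σ j < σ k ∧ σ k < σ i).image fun k => (σ k : ℕ) + 1⟩

/-- The arcs of all descents of `σ`. -/
def descentArcs {n : ℕ} (σ : Equiv.Perm (Fin n)) : Set RawArc :=
  {α | ∃ i j : Fin n, (j : ℕ) = (i : ℕ) + 1 ∧ σ j < σ i ∧ α = permArc σ i j}

/-- The pairs of positions `i < j` with `σ_i > σ_j` such that no entry between them has a value
between `σ_j` and `σ_i`. -/
def IsBox {n : ℕ} (σ : Equiv.Perm (Fin n)) (i j : Fin n) : Prop :=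
  i < j ∧ σ j < σ i ∧ ∀ k, i < k → k < j → ¬ (σ j < σ k ∧ σ k < σ i)

/-- The diagram of `σ` with respect to an arc ideal `I`: the arcs of the pairs `(i, j)` as above
whose arc is in `I` and that are maximal with this property for the order
`(i, j) ≺ (k, l)` if `i ≤ k < l ≤ j` and `σ_k ≥ σ_i > σ_j ≥ σ_l`. -/
def eta {n : ℕ} (I : ArcIdeal n) (σ : Equiv.Perm (Fin n)) : Set RawArc :=
  {α | ∃ i j : Fin n, IsBox σ i j ∧ permArc σ i j ∈ I.carrier ∧
    (∀ k l : Fin n, IsBox σ k l → permArc σ k l ∈ I.carrier →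
      i ≤ k → l ≤ j → σ i ≤ σ k → σ l ≤ σ j → k = i ∧ l = j) ∧
    α = permArc σ i j}

/-- Two arcs cross: the first passes strictly above the second somewhere and strictly below it
somewhere else. -/
def Crosses (α β : RawArc) : Prop :=
  ∃ r s : ℕ,
    (r ∈ Finset.Icc α.left α.right ∧ r ∈ Finset.Icc β.left β.right ∧
      ¬ ((r = α.left ∨ r = α.right) ∧ (r = β.left ∨ r = β.right))) ∧
    (s ∈ Finset.Icc α.left α.right ∧ s ∈ Finset.Icc β.left β.right ∧
      ¬ ((s = α.left ∨ s = α.right) ∧ (s = β.left ∨ s = β.right))) ∧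
    ((r ∈ α.above ∨ r = α.left ∨ r = α.right) ∧ r ∉ β.above) ∧
    ((s ∈ β.above ∨ s = β.left ∨ s = β.right) ∧ s ∉ α.above)

/-- Noncrossing arc diagrams of size `n`. -/
structure IsNoncrossingDiagram (n : ℕ) (D : Set RawArc) : Prop where
  isArc : ∀ α ∈ D, IsArc n α
  pairwise : ∀ α ∈ D, ∀ β ∈ D, α ≠ β →
    ¬ Crosses α β ∧ α.left ≠ β.left ∧ α.right ≠ β.right

/-- The arcs of the join-irreducible permutations that are not contracted by `r`: a permutation
is join-irreducible if it has exactly one descent arc, and it is uncontracted if it is the minimum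
of its class. -/
def uncontractedArcs {n : ℕ} (r : Setoid (Equiv.Perm (Fin n))) : Set RawArc :=
  {α | ∃ σ, descentArcs σ = {α} ∧ ∀ τ, r σ τ → WeakLE σ τ}

open Classical in
/-- The sum of the basis vectors `F (σ, x)` over the permutations `σ` that satisfy `P`. -/
noncomputable def FSum (k : Type*) [Field k] {𝔛 : DecorationData} {n : ℕ} (x : 𝔛.X n)
    (P : Equiv.Perm (Fin n) → Prop) : DecPerm 𝔛 →₀ k :=
  ∑ σ ∈ Finset.univ.filter P, F k σ x

/-- The subspace spanned by the sums of the `F (σ, x)` over the permutations `σ` whose diagram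
with respect to `arcs x` is `D`, for all `x` and all noncrossing arc diagrams `D` in `arcs x`. -/
noncomputable def diagramAlgebra (k : Type*) [Field k] (𝔛 : DecorationData)
    (arcs : ∀ {n : ℕ}, 𝔛.X n → ArcIdeal n) : Submodule k (DecPerm 𝔛 →₀ k) :=
  Submodule.span k {v | ∃ (n : ℕ) (x : 𝔛.X n) (D : Set RawArc), IsNoncrossingDiagram n D ∧
    D ⊆ (arcs x).carrier ∧ v = FSum k x fun σ => eta (arcs x) σ = D}

/-- The subspace `k𝔇*` of the space of permutations decorated by extended arc ideals. -/
noncomputable def kDStar (k : Type*) [Field k] : Submodule k (DecPerm extIdeals →₀ k) :=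
  diagramAlgebra k extIdeals ExtArcIdeal.strict

/-! ### Permutrees -/

/-- Words on the alphabet of the four vertex decorations of permutrees. A letter is a pair
`(north, south)`: `north` says that the vertex has two (possibly empty) ancestor subtrees, `south`
that it has two (possibly empty) descendant subtrees. -/
def permutreeWords : DecorationData where
  X n := Fin n → Bool × Bool
  concat := Fin.append
  select δ R := δ ∘ R
  empty := Fin.elim0

/-- Permutrees with decoration `δ`: directed trees with vertices labeled by `[n]`, in which
* a vertex without (with) `north` decoration has one (two) ancestor subtrees;
* a vertex without (with) `south` decoration has one (two) descendant subtrees;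
* if there are two of them, then the labels in the left (right) ancestor or descendant subtree of
  `v` are all smaller (larger) than `v`.
Subtrees may be empty; leaves are not recorded. `edge u v` means that `v` is a parent of `u`. -/
structure Permutree {n : ℕ} (δ : Fin n → Bool × Bool) where
  edge : Fin n → Fin n → Prop
  asymm : ∀ u v, edge u v → ¬ edge v u
  connected : (SimpleGraph.fromRel edge).Preconnected
  acyclic : (SimpleGraph.fromRel edge).IsAcyclic
  parent_unique : ∀ v, (δ v).1 = false → ∀ u u', edge v u → edge v u' → u = u'
  child_unique : ∀ v, (δ v).2 = false → ∀ u u', edge u v → edge u' v → u = u'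
  parent_side : ∀ v, (δ v).1 = true → ∀ u, edge v u →
    (u < v ∧ ∀ (w : Fin n) (p : (SimpleGraph.fromRel edge).Walk u w), v ∉ p.support → w < v) ∨
    (v < u ∧ ∀ (w : Fin n) (p : (SimpleGraph.fromRel edge).Walk u w), v ∉ p.support → v < w)
  child_side : ∀ v, (δ v).2 = true → ∀ u, edge u v →
    (u < v ∧ ∀ (w : Fin n) (p : (SimpleGraph.fromRel edge).Walk u w), v ∉ p.support → w < v) ∨
    (v < u ∧ ∀ (w : Fin n) (p : (SimpleGraph.fromRel edge).Walk u w), v ∉ p.support → v < w)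
  parent_side_unique : ∀ v, (δ v).1 = true → ∀ u u', edge v u → edge v u' →
    (u < v ↔ u' < v) → u = u'
  child_side_unique : ∀ v, (δ v).2 = true → ∀ u u', edge u v → edge u' v →
    (u < v ↔ u' < v) → u = u'

/-- The linear extensions of a permutree: the permutations in which every vertex stands before its
parents. -/
def Permutree.IsLinearExtension {n : ℕ} {δ : Fin n → Bool × Bool} (T : Permutree δ)
    (σ : Equiv.Perm (Fin n)) : Prop :=
  ∀ u v, T.edge u v → σ⁻¹ u < σ⁻¹ v

/-- The basis element of a permutree: the sum of its linear extensions, decorated by the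
decorations of its vertices. -/
noncomputable def permutreeElement (k : Type*) [Field k] {n : ℕ} {δ : Fin n → Bool × Bool}
    (T : Permutree δ) : DecPerm permutreeWords →₀ k :=
  FSum k (𝔛 := permutreeWords) δ T.IsLinearExtension

/-- The permutree algebra: the span of the sums of linear extensions of all permutrees in the
algebra of permutations decorated by words on the four decorations. -/
noncomputable def permutreeAlgebra (k : Type*) [Field k] :
    Submodule k (DecPerm permutreeWords →₀ k) :=
  Submodule.span k {v | ∃ (n : ℕ) (δ : Fin n → Bool × Bool) (T : Permutree δ),
    v = permutreeElement k T}

/-- The extended arc ideal of a word of decorations: the extended arcs that cross no wall, where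
there is a wall above every `north` vertex and below every `south` vertex. -/
def wordIdeal {n : ℕ} (δ : Fin n → Bool × Bool) : ExtArcIdeal n where
  carrier := {α | IsExtArc n α ∧ ∀ c : Fin n, α.left < (c : ℕ) + 1 → (c : ℕ) + 1 < α.right →
    (((c : ℕ) + 1 ∈ α.above → (δ c).1 = false) ∧ ((c : ℕ) + 1 ∉ α.above → (δ c).2 = false))}
  isExtArc _ h := h.1
  closed := by
    rintro α ⟨⟨h1, h2, h3⟩, h⟩ b c hb hbc hc
    refine ⟨⟨hbc, le_trans hc h2, Finset.inter_subset_right⟩, fun x hx1 hx2 => ?_⟩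
    simp only [RawArc.restrict] at hx1 hx2
    have := h x (by omega) (by omega)
    simpa [RawArc.restrict, hx1, hx2] using this

/-- The linear map `F (σ, δ) ↦ F (σ, wordIdeal δ)`. -/
noncomputable def permutreeMap (k : Type*) [Field k] :
    (DecPerm permutreeWords →₀ k) →ₗ[k] (DecPerm extIdeals →₀ k) :=
  Finsupp.lmapDomain k k fun a => ⟨a.1, a.2.1, wordIdeal a.2.2⟩

end ArcHopf

open ArcHopf

/-! Permutations are handled through the order in which their values stand in the word (`Bef`), and
everything rests on one local move: `ArcStep C` exchanges two neighbors c a with a < c whose arc is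
not in C. If C is closed under restriction, the move leaves the boxes with arc in C unchanged,
because a box that appeared only after the exchange would have an arc that restricts to the arc of
the move (`eta_eq_of_arcStep`). Moving down as long as possible ends at a permutation whose descents
all have arcs in C. There `eta` is just the set of descent arcs, and descent arcs determine a
permutation. Hence the fibers of `eta` are the equivalence classes generated by the moves
(`eta_eq_iff`).

Lattice congruences: a permutation is the join of the join irreducibles of its descent arcs
(`weakLE_of_arcLE`), and lying above the join irreducible of an arc of C is invariant under moves.
So for a permutation σ with descents in C, whether σ ≤ w depends only on the class of w. This gives
compatibility with meets, and reading words backwards gives joins. Conversely, whether a congruence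
contracts a cover depends only on the arc of the cover, since covers with the same arc are
perspective to that of one join irreducible (`contracted_valArc`). Hexagons of the weak order pass
contraction from an arc to the arcs that restrict to it (`rel_hexagon`). So the uncontracted arcs
form an ideal, and the congruence is generated by the moves of this ideal (`rel_iff_arcSetoid`).

Hopf algebras: standardization at positions is rewritten as restriction to values. A product then
sums over the permutations with two prescribed restrictions, and a coproduct sums over the sets of
values that form a prefix. The axioms become bijections; compatibility of product and coproduct is
the gluing of two words (`comul_mul_F`). Conservativity says that moves restrict to the factors of a
product and lift from the factors of a coproduct, so the class sums span a Hopf subalgebra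
(`isHopfSubalgebra_diagramAlgebra`).

Extended arc ideals: an arc lies in a concatenation if and only if its two parts, which overlap in
the edge from m to m + 1, lie in the two ideals (`ExtArcIdeal.mem_concat`). Paths that define a
selection can be substituted into each other, cut at selected vertices, and truncated at the
overlapping edge, which yields the axioms.

Permutrees: two neighbors in a linear extension of a permutree are joined by an edge exactly if no
wall separates them. Therefore the linear extensions of one permutree form one class for the ideal
of its word (`Permutree.isLinearExtension_iff_eta`). Inserting the vertices in increasing order
shows that every permutation is a linear extension of some permutree (`Permutree.exists_of_perm`).
So the permutree algebra is again an algebra of class sums for a conservative function, and the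
passage from words to ideals respects concatenation and selection and is injective. -/

namespace ArcHopf

/-! ### Words of permutations -/

/-- The value `x` stands before the value `y` in the word of `σ`. -/
def Bef {n : ℕ} (σ : Equiv.Perm (Fin n)) (x y : Fin n) : Prop := σ⁻¹ x < σ⁻¹ y

/-- The value `y` stands immediately after the value `x` in the word of `σ`. -/
def Next {n : ℕ} (σ : Equiv.Perm (Fin n)) (x y : Fin n) : Prop :=
  Bef σ x y ∧ ∀ z, Bef σ x z → ¬ Bef σ z y

section Words

variable {n : ℕ} {σ τ : Equiv.Perm (Fin n)} {x y z : Fin n}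

instance : Decidable (Bef σ x y) := inferInstanceAs (Decidable (σ⁻¹ x < σ⁻¹ y))

theorem Bef.irrefl : ¬ Bef σ x x := lt_irrefl _

theorem Bef.ne (h : Bef σ x y) : x ≠ y := fun e => Bef.irrefl (e ▸ h)

theorem Bef.trans (h : Bef σ x y) (h' : Bef σ y z) : Bef σ x z := lt_trans h h'

theorem Bef.asymm (h : Bef σ x y) : ¬ Bef σ y x := lt_asymm h

theorem Bef.total (h : x ≠ y) : Bef σ x y ∨ Bef σ y x :=
  lt_or_gt_of_ne fun e => h (σ⁻¹.injective e)

theorem bef_of_not (hne : x ≠ y) (h : ¬ Bef σ y x) : Bef σ x y :=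
  (Bef.total hne).resolve_right h

theorem not_bef_iff (hne : x ≠ y) : ¬ Bef σ x y ↔ Bef σ y x :=
  ⟨bef_of_not hne.symm, fun h => h.asymm⟩

theorem bef_apply {i j : Fin n} : Bef σ (σ i) (σ j) ↔ i < j := by
  simp [Bef]

/-- One inclusion of the two orders suffices because both are total; then σ and τ differ by an order
automorphism of `Fin n`, which is the identity. -/
theorem perm_ext_bef (h : ∀ x y, Bef σ x y → Bef τ x y) : σ = τ := by
  have h' : ∀ x y, Bef σ x y ↔ Bef τ x y := fun x y =>
    ⟨h x y, fun hb => bef_of_not hb.ne fun hc => (h _ _ hc).asymm hb⟩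
  let e : Fin n ≃o Fin n :=
    { toEquiv := σ.trans τ⁻¹
      map_rel_iff' := by
        intro i j
        have := h' (σ j) (σ i)
        rw [bef_apply] at this
        exact (not_lt.symm.trans (not_congr this.symm)).trans not_lt }
  ext i
  have he : e i = i := Fin.ext (Fin.coe_orderIso_apply e i)
  have : τ⁻¹ (σ i) = i := he
  rw [Equiv.Perm.inv_eq_iff_eq] at this
  rw [this]

/-- The standard way to write down a word below: values are sorted by a numerical key, and the word
is the inverse of the rank function. -/
theorem exists_perm_of_key (f : Fin n → ℕ) (hf : Function.Injective f) :
    ∃ σ : Equiv.Perm (Fin n), ∀ x y, Bef σ x y ↔ f x < f y := by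
  have hc : (Finset.univ.image f).card = n := by
    rw [Finset.card_image_of_injective _ hf, Finset.card_univ, Fintype.card_fin]
  let g : Fin n → Fin n := fun x =>
    ((Finset.univ.image f).orderIsoOfFin hc).symm ⟨f x, Finset.mem_image_of_mem f (Finset.mem_univ x)⟩
  have hg : ∀ x y, g x < g y ↔ f x < f y := fun x y => by
    simp only [g, OrderIso.lt_iff_lt, Subtype.mk_lt_mk]
  have hgi : Function.Injective g := fun x y h => by
    simpa [g] using hf.eq_iff.1 (by simpa [g] using h)
  refine ⟨(Equiv.ofBijective g (Finite.injective_iff_bijective.1 hgi))⁻¹, fun x y => ?_⟩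
  rw [Bef, inv_inv]
  exact hg x y

/-- The number of predecessors of a value serves as its key. -/
theorem exists_perm_of_rel (r : Fin n → Fin n → Prop) (irrefl : ∀ x, ¬ r x x)
    (trans : ∀ x y z, r x y → r y z → r x z) (total : ∀ x y, x ≠ y → r x y ∨ r y x) :
    ∃ σ : Equiv.Perm (Fin n), ∀ x y, Bef σ x y ↔ r x y := by
  classical
  have key : ∀ x y, r x y →
      (Finset.univ.filter fun z => r z x).card < (Finset.univ.filter fun z => r z y).card := by
    intro x y h
    refine Finset.card_lt_card ((Finset.ssubset_iff_of_subset ?_).2 ⟨x, by simpa using h, by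
      simpa using irrefl x⟩)
    intro z hz
    simp only [Finset.mem_filter, Finset.mem_univ, true_and] at hz ⊢
    exact trans _ _ _ hz h
  obtain ⟨σ, hσ⟩ := exists_perm_of_key (fun x => (Finset.univ.filter fun z => r z x).card) (by
    intro x y h
    by_contra hne
    rcases total x y hne with h' | h'
    · exact (key _ _ h').ne h
    · exact (key _ _ h').ne h.symm)
  refine ⟨σ, fun x y => (hσ x y).trans ⟨fun h => ?_, key x y⟩⟩
  by_contra hr
  rcases eq_or_ne x y with rfl | hne
  · exact lt_irrefl _ h
  · exact lt_asymm h (key _ _ ((total x y hne).resolve_left hr))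

theorem next_apply {i j : Fin n} : Next σ (σ i) (σ j) ↔ (j : ℕ) = i + 1 := by
  unfold Next
  rw [bef_apply]
  constructor
  · rintro ⟨h1, h2⟩
    by_contra hne
    have hlt := Fin.lt_def.1 h1
    have hk : (i : ℕ) + 1 < n := by omega
    refine h2 (σ ⟨i + 1, hk⟩) (bef_apply.2 (Fin.lt_def.2 (by simp))) (bef_apply.2 ?_)
    rw [Fin.lt_def]
    simp only
    omega
  · intro h
    refine ⟨Fin.lt_def.2 (by omega), fun z h1 h2 => ?_⟩
    obtain ⟨l, rfl⟩ := σ.surjective z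
    rw [bef_apply, Fin.lt_def] at h1 h2
    omega

/-- The word of `σ` with the values `x` and `y` exchanged. -/
theorem bef_swap (h : Next σ x y) {u v : Fin n} :
    Bef (Equiv.swap x y * σ) u v ↔ (u = y ∧ v = x) ∨ (Bef σ u v ∧ ¬ (u = x ∧ v = y)) := by
  have hxy := h.1.ne
  -- No value stands between two neighbors, so any other value is on the same side of both and only
  -- the order of the pair itself changes.
  have side : ∀ z, z ≠ x → z ≠ y → ((Bef σ z x ↔ Bef σ z y) ∧ (Bef σ x z ↔ Bef σ y z)) := by
    intro z hzx hzy
    refine ⟨⟨fun h' => h'.trans h.1, fun h' => ?_⟩, ⟨fun h' => ?_, fun h' => h.1.trans h'⟩⟩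
    · exact bef_of_not hzx fun hc => h.2 z hc h'
    · exact bef_of_not hzy.symm (h.2 z h')
  have e : Bef (Equiv.swap x y * σ) u v ↔ Bef σ (Equiv.swap x y u) (Equiv.swap x y v) := by
    simp [Bef]
  rw [e]
  rcases eq_or_ne u x with rfl | hux
  · rw [Equiv.swap_apply_left]
    rcases eq_or_ne v u with rfl | hvu
    · simp [Bef.irrefl, hxy]
    rcases eq_or_ne v y with rfl | hvy
    · simp [h.1.asymm, hxy]
    · rw [Equiv.swap_apply_of_ne_of_ne hvu hvy]
      simp [hxy, hvy, (side v hvu hvy).2]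
  rcases eq_or_ne u y with rfl | huy
  · rw [Equiv.swap_apply_right]
    rcases eq_or_ne v x with rfl | hvx
    · simp [h.1]
    rcases eq_or_ne v u with rfl | hvy
    · simp [Bef.irrefl, hvx]
    · rw [Equiv.swap_apply_of_ne_of_ne hvx hvy]
      simp [hux, hvx, (side v hvx hvy).2]
  rw [Equiv.swap_apply_of_ne_of_ne hux huy]
  rcases eq_or_ne v x with rfl | hvx
  · rw [Equiv.swap_apply_left]
    simp [huy, hux, (side u hux huy).1]
  rcases eq_or_ne v y with rfl | hvy
  · rw [Equiv.swap_apply_right]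
    simp [hux, huy, (side u hux huy).1]
  · rw [Equiv.swap_apply_of_ne_of_ne hvx hvy]
    simp [hux, huy]

theorem bef_swap_of_ne (h : Next σ x y) {u v : Fin n} (h1 : ¬ (u = x ∧ v = y))
    (h2 : ¬ (u = y ∧ v = x)) : Bef (Equiv.swap x y * σ) u v ↔ Bef σ u v := by
  rw [bef_swap h]
  tauto

theorem Next.swap (h : Next σ x y) : Next (Equiv.swap x y * σ) y x := by
  have hxy := h.1.ne
  refine ⟨(bef_swap h).2 (Or.inl ⟨rfl, rfl⟩), fun z h1 h2 => ?_⟩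
  rcases (bef_swap h).1 h1 with ⟨-, rfl⟩ | ⟨h1, -⟩
  · exact h2.irrefl
  rcases (bef_swap h).1 h2 with ⟨rfl, -⟩ | ⟨h2, -⟩
  · exact h1.irrefl
  · exact (h1.trans h2).asymm h.1

theorem swap_swap_mul : Equiv.swap y x * (Equiv.swap x y * σ) = σ := by
  rw [← mul_assoc, Equiv.swap_comm y x, Equiv.swap_mul_self, one_mul]

/-- If τ kept the order of all neighbors of σ, it would keep the order of all pairs, by induction on
their distance. With `card_disagree_swap` this connects any two words by exchanges of neighbors on
whose order they disagree. -/
theorem exists_next_of_ne (h : σ ≠ τ) : ∃ x y, Next σ x y ∧ Bef τ y x := by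
  by_contra hc
  push Not at hc
  have key : ∀ d : ℕ, ∀ x y, (σ⁻¹ y : ℕ) = σ⁻¹ x + d → Bef σ x y → Bef τ x y := by
    intro d
    induction d using Nat.strong_induction_on with
    | _ d ih =>
      intro x y hd hxy
      by_cases hn : Next σ x y
      · exact bef_of_not hxy.ne (hc x y hn)
      · simp only [Next, not_and, not_forall, not_not] at hn
        obtain ⟨z, h1, h2⟩ := hn hxy
        have h1' := Fin.lt_def.1 h1
        have h2' := Fin.lt_def.1 h2
        exact (ih ((σ⁻¹ z : ℕ) - σ⁻¹ x) (by omega) x z (by omega) h1).trans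
          (ih ((σ⁻¹ y : ℕ) - σ⁻¹ z) (by omega) z y (by omega) h2)
  refine h (perm_ext_bef fun x y hxy => key ((σ⁻¹ y : ℕ) - σ⁻¹ x) x y ?_ hxy)
  have := Fin.lt_def.1 hxy
  omega

/-- The pairs of values on whose order two permutations disagree. -/
def disagree (σ τ : Equiv.Perm (Fin n)) : Finset (Fin n × Fin n) :=
  Finset.univ.filter fun p => Bef σ p.1 p.2 ∧ Bef τ p.2 p.1

theorem card_disagree_swap (h : Next σ x y) (h' : Bef τ y x) :
    (disagree (Equiv.swap x y * σ) τ).card < (disagree σ τ).card := by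
  refine Finset.card_lt_card ((Finset.ssubset_iff_of_subset ?_).2 ⟨(x, y), by
    simpa [disagree] using ⟨h.1, h'⟩, by
    simp [disagree, bef_swap h, h.1.ne]⟩)
  rintro ⟨u, v⟩ hp
  simp only [disagree, Finset.mem_filter, Finset.mem_univ, true_and, bef_swap h] at hp ⊢
  obtain ⟨⟨rfl, rfl⟩ | h1, h2⟩ := hp
  · exact absurd h2 h'.asymm
  · exact ⟨h1.1, h2⟩

theorem WeakLE.rfl' : WeakLE σ σ := fun _ _ _ h => h

theorem WeakLE.trans' {υ : Equiv.Perm (Fin n)} (h : WeakLE σ τ) (h' : WeakLE τ υ) :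
    WeakLE σ υ := fun a b hab hb => h' a b hab (h a b hab hb)

theorem WeakLE.antisymm' (h : WeakLE σ τ) (h' : WeakLE τ σ) : σ = τ := by
  refine perm_ext_bef fun x y hxy => ?_
  rcases lt_or_gt_of_ne hxy.ne with hlt | hlt
  · exact bef_of_not hxy.ne fun hc => (h' x y hlt hc).asymm hxy
  · exact h y x hlt hxy

theorem swap_weakLE {a c : Fin n} (hac : a < c) (h : Next σ c a) :
    WeakLE (Equiv.swap c a * σ) σ := by
  intro u v huv hb
  rcases (bef_swap h).1 hb with ⟨rfl, rfl⟩ | ⟨hb, -⟩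
  · exact absurd huv hac.asymm
  · exact hb

theorem weakLE_swap {a c : Fin n} (h : Next σ c a) (hle : WeakLE τ σ)
    (hn : ¬ Bef τ c a) : WeakLE τ (Equiv.swap c a * σ) := by
  intro u v huv hb
  refine (bef_swap h).2 (Or.inr ⟨hle u v huv hb, ?_⟩)
  rintro ⟨rfl, rfl⟩
  exact hn hb

/-- If `τ < σ`, then some descent of `σ` is not an inversion of `τ`. -/
theorem exists_descent_of_weakLE (hle : WeakLE τ σ) (hne : τ ≠ σ) :
    ∃ a c, a < c ∧ Next σ c a ∧ Bef τ a c := by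
  obtain ⟨x, y, hn, hb⟩ := exists_next_of_ne hne.symm
  rcases lt_or_gt_of_ne hn.1.ne with h | h
  · exact absurd (hle x y h hb) hn.1.asymm
  · exact ⟨y, x, h, hn, hb⟩

theorem stdPos_lt {p q : ℕ} {ρ : Equiv.Perm (Fin p)} {R : Fin q ↪o Fin p} {i j : Fin q} :
    stdPos ρ R i < stdPos ρ R j ↔ ρ (R i) < ρ (R j) := by
  simp only [stdPos, Equiv.trans_apply, RelIso.coe_fn_toEquiv, OrderIso.lt_iff_lt]
  exact Iff.rfl

theorem bef_stdVal {p q : ℕ} {ρ : Equiv.Perm (Fin p)} {R : Fin q ↪o Fin p} {i j : Fin q} :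
    Bef (stdVal ρ R) i j ↔ Bef ρ (R i) (R j) := by
  rw [Bef, stdVal, inv_inv, stdPos_lt]
  rfl

theorem stdVal_stdVal {p q s : ℕ} (ρ : Equiv.Perm (Fin p)) (R : Fin q ↪o Fin p)
    (S : Fin s ↪o Fin q) : stdVal (stdVal ρ R) S = stdVal ρ (S.trans R) :=
  perm_ext_bef fun x y h => by
    simpa only [bef_stdVal, RelEmbedding.coe_trans, Function.comp_apply] using h

theorem valuesAt_stdPos {p q : ℕ} (ρ : Equiv.Perm (Fin p)) (R : Fin q ↪o Fin p) (i : Fin q) :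
    valuesAt ρ R (stdPos ρ R i) = ρ (R i) := by
  simp only [valuesAt, stdPos, Equiv.trans_apply, RelIso.coe_fn_toEquiv]
  rw [← Finset.coe_orderIsoOfFin_apply, OrderIso.apply_symm_apply]
  rfl

/-- Both words list the entries at the positions in R in their given order. This turns every
restriction to positions into a restriction to values. -/
theorem stdPos_eq_stdVal {p q : ℕ} (ρ : Equiv.Perm (Fin p)) (R : Fin q ↪o Fin p) :
    stdPos ρ R = stdVal ρ (valuesAt ρ R) := by
  refine perm_ext_bef fun x y h => ?_
  obtain ⟨i, rfl⟩ := (stdPos ρ R).surjective x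
  obtain ⟨j, rfl⟩ := (stdPos ρ R).surjective y
  rw [bef_stdVal, valuesAt_stdPos, valuesAt_stdPos, bef_apply, R.lt_iff_lt]
  exact bef_apply.1 h

theorem mem_range_valuesAt {p q : ℕ} (ρ : Equiv.Perm (Fin p)) (R : Fin q ↪o Fin p) (x : Fin p) :
    x ∈ Set.range (valuesAt ρ R) ↔ ρ⁻¹ x ∈ Set.range R := by
  simp only [valuesAt, Finset.range_orderEmbOfFin, Finset.coe_map, Set.mem_image,
    Finset.coe_univ, Set.mem_univ, true_and, Set.mem_range]
  refine exists_congr fun i => ?_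
  exact (Equiv.eq_symm_apply ρ).symm

end Words

/-! ### The diagram of a permutation -/

/-- The arc of two values `a < c` of `σ`, such that `c` stands before `a`. -/
def valArc {n : ℕ} (σ : Equiv.Perm (Fin n)) (a c : Fin n) : RawArc :=
  ⟨(a : ℕ) + 1, (c : ℕ) + 1,
    (Finset.univ.filter fun z => Bef σ z c ∧ a < z ∧ z < c).image fun z : Fin n => (z : ℕ) + 1⟩

section Diagrams

variable {n : ℕ} {σ τ : Equiv.Perm (Fin n)} {a c : Fin n}

theorem mem_valArc_above {x : ℕ} : x ∈ (valArc σ a c).above ↔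
    ∃ z : Fin n, (Bef σ z c ∧ a < z ∧ z < c) ∧ (z : ℕ) + 1 = x := by
  simp [valArc]

theorem succ_mem_valArc_above {z : Fin n} :
    (z : ℕ) + 1 ∈ (valArc σ a c).above ↔ Bef σ z c ∧ a < z ∧ z < c := by
  rw [mem_valArc_above]
  constructor
  · rintro ⟨w, hw, h⟩
    obtain rfl : w = z := Fin.ext (by omega)
    exact hw
  · exact fun h => ⟨z, h, rfl⟩

theorem valArc_congr (h : ∀ z, a < z → z < c → (Bef σ z c ↔ Bef τ z c)) :
    valArc σ a c = valArc τ a c := by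
  ext x
  · rfl
  · rfl
  · rw [mem_valArc_above, mem_valArc_above]
    refine exists_congr fun z => and_congr_left fun _ => ?_
    constructor
    · rintro ⟨h1, h2, h3⟩
      exact ⟨(h z h2 h3).1 h1, h2, h3⟩
    · rintro ⟨h1, h2, h3⟩
      exact ⟨(h z h2 h3).2 h1, h2, h3⟩

theorem valArc_restrict {b d : Fin n} (hab : a ≤ b) (hdc : d ≤ c)
    (h : ∀ z, b < z → z < d → (Bef σ z c ↔ Bef τ z d)) :
    (valArc σ a c).restrict ((b : ℕ) + 1) ((d : ℕ) + 1) = valArc τ b d := by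
  ext x
  · rfl
  · rfl
  · rw [RawArc.restrict, Finset.mem_inter, mem_valArc_above, mem_valArc_above, Finset.mem_Ioo]
    constructor
    · rintro ⟨⟨z, ⟨h1, h2, h3⟩, rfl⟩, h4, h5⟩
      have hb : b < z := Fin.lt_def.2 (by omega)
      have hd : z < d := Fin.lt_def.2 (by omega)
      exact ⟨z, ⟨(h z hb hd).1 h1, hb, hd⟩, rfl⟩
    · rintro ⟨z, ⟨h1, h2, h3⟩, rfl⟩
      refine ⟨⟨z, ⟨(h z h2 h3).2 h1, hab.trans_lt h2, h3.trans_le hdc⟩, rfl⟩, ?_⟩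
      rw [Fin.lt_def] at h2 h3
      omega

theorem valArc_isArc (h : a < c) : IsArc n (valArc σ a c) := by
  refine ⟨by simp [valArc], by simpa [valArc] using h, c.isLt, fun x hx => ?_⟩
  obtain ⟨z, ⟨-, h1, h2⟩, rfl⟩ := mem_valArc_above.1 hx
  rw [Fin.lt_def] at h1 h2
  simp only [valArc, Finset.mem_Ioo]
  omega

theorem permArc_eq_valArc (i j : Fin n) : permArc σ i j = valArc σ (σ j) (σ i) := by
  ext x
  · rfl
  · rfl
  · rw [mem_valArc_above]
    simp only [permArc, Finset.mem_image, Finset.mem_filter, Finset.mem_univ, true_and]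
    constructor
    · rintro ⟨k, ⟨h1, h2, h3⟩, rfl⟩
      exact ⟨σ k, ⟨bef_apply.2 h1, h2, h3⟩, rfl⟩
    · rintro ⟨z, ⟨h1, h2, h3⟩, rfl⟩
      obtain ⟨k, rfl⟩ := σ.surjective z
      exact ⟨k, ⟨bef_apply.1 h1, h2, h3⟩, rfl⟩

/-- The pairs of values `a < c` such that `c` stands before `a` and no value between `a` and `c`
stands between them. -/
def ValBox (σ : Equiv.Perm (Fin n)) (a c : Fin n) : Prop :=
  a < c ∧ Bef σ c a ∧ ∀ z, Bef σ c z → Bef σ z a → ¬ (a < z ∧ z < c)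

theorem isBox_iff (i j : Fin n) : IsBox σ i j ↔ ValBox σ (σ j) (σ i) := by
  unfold IsBox ValBox
  rw [bef_apply]
  constructor
  · rintro ⟨h1, h2, h3⟩
    refine ⟨h2, h1, fun z hz hz' => ?_⟩
    obtain ⟨k, rfl⟩ := σ.surjective z
    exact h3 k (bef_apply.1 hz) (bef_apply.1 hz')
  · rintro ⟨h1, h2, h3⟩
    exact ⟨h2, h1, fun k hk hk' => h3 _ (bef_apply.2 hk) (bef_apply.2 hk')⟩

/-- The pairs of `ValBox` whose arc is in `C`. -/
def ValBoxIn (C : Set RawArc) (σ : Equiv.Perm (Fin n)) (a c : Fin n) : Prop :=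
  ValBox σ a c ∧ valArc σ a c ∈ C

/-- Positions are replaced by values. The weak inequalities between positions become negated `Bef`
statements, since `Bef` is strict. -/
theorem mem_eta {I : ArcIdeal n} {α : RawArc} : α ∈ eta I σ ↔
    ∃ a c, ValBoxIn I.carrier σ a c ∧
      (∀ u v, ValBoxIn I.carrier σ u v → ¬ Bef σ v c → ¬ Bef σ a u → c ≤ v → u ≤ a →
        v = c ∧ u = a) ∧ α = valArc σ a c := by
  simp only [eta, Set.mem_ofPred_eq, isBox_iff, permArc_eq_valArc, ValBoxIn]
  constructor
  · rintro ⟨i, j, h1, h2, h3, rfl⟩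
    refine ⟨σ j, σ i, ⟨h1, h2⟩, fun u v huv hv hu hcv hua => ?_, rfl⟩
    obtain ⟨k, rfl⟩ := σ.surjective v
    obtain ⟨l, rfl⟩ := σ.surjective u
    obtain ⟨rfl, rfl⟩ := h3 k l huv.1 huv.2 (not_lt.1 (mt bef_apply.2 hv))
      (not_lt.1 (mt bef_apply.2 hu)) hcv hua
    exact ⟨rfl, rfl⟩
  · rintro ⟨a, c, ⟨h1, h2⟩, h3, rfl⟩
    obtain ⟨i, rfl⟩ := σ.surjective c
    obtain ⟨j, rfl⟩ := σ.surjective a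
    refine ⟨i, j, h1, h2, fun k l hb hI hik hlj hv hu => ?_, rfl⟩
    obtain ⟨e1, e2⟩ := h3 _ _ ⟨hb, hI⟩ (mt bef_apply.1 (not_lt.2 hik))
      (mt bef_apply.1 (not_lt.2 hlj)) hv hu
    exact ⟨σ.injective e1, σ.injective e2⟩

theorem mem_descentArcs {α : RawArc} :
    α ∈ descentArcs σ ↔ ∃ a c, a < c ∧ Next σ c a ∧ α = valArc σ a c := by
  simp only [descentArcs, Set.mem_ofPred_eq, permArc_eq_valArc, ← next_apply (σ := σ)]
  constructor
  · rintro ⟨i, j, h1, h2, rfl⟩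
    exact ⟨σ j, σ i, h2, h1, rfl⟩
  · rintro ⟨a, c, h1, h2, rfl⟩
    refine ⟨σ⁻¹ c, σ⁻¹ a, ?_⟩
    simp [h1, h2]

/-! ### Exchanges of neighbors do not change the diagram -/

/-- Exchanging two neighbors `c a` with `a < c`, whose arc is not in `C`. -/
def ArcStep (C : Set RawArc) (σ τ : Equiv.Perm (Fin n)) : Prop :=
  ∃ a c, a < c ∧ Next σ c a ∧ valArc σ a c ∉ C ∧ τ = Equiv.swap c a * σ

/-- A box that shares one end with the neighbors c a cannot reach beyond the other one, because that
value would stand inside the box. -/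
theorem ValBox.not_of_next {b d : Fin n} (hac : a < c) (hn : Next σ c a) (h : ValBox σ b d) :
    (d = c → ¬ b < a) ∧ (b = a → ¬ c < d) := by
  constructor
  · rintro rfl hb
    refine h.2.2 a hn.1 ?_ ⟨hb, hac⟩
    exact bef_of_not hb.ne' fun hc => hn.2 b h.2.1 hc
  · rintro rfl hd
    refine h.2.2 c ?_ hn.1 ⟨hac, hd⟩
    exact bef_of_not hd.ne' fun hc => hn.2 d hc h.2.1

/-- The exchange loses only the inversion of c and a, which is not a box of C, and the new
precedence of a over c brings no value into a box. -/
theorem valBoxIn_swap {C : Set RawArc} (hac : a < c) (hn : Next σ c a)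
    (hα : valArc σ a c ∉ C) (b d : Fin n) :
    ValBoxIn C σ b d → ValBoxIn C (Equiv.swap c a * σ) b d ∧
      valArc (Equiv.swap c a * σ) b d = valArc σ b d := by
  rintro ⟨hb, hd⟩
  have hne : ¬ (d = c ∧ b = a) := by
    rintro ⟨rfl, rfl⟩
    exact hα hd
  have harc : valArc (Equiv.swap c a * σ) b d = valArc σ b d := by
    refine valArc_congr fun z h1 h2 => bef_swap_of_ne hn ?_ ?_
    · rintro ⟨rfl, rfl⟩
      exact h2.asymm hac
    · rintro ⟨rfl, rfl⟩
      exact (hb.not_of_next hac hn).1 rfl h1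
  refine ⟨⟨⟨hb.1, (bef_swap hn).2 (Or.inr ⟨hb.2.1, hne⟩), fun z h1 h2 h3 => ?_⟩,
    harc ▸ hd⟩, harc⟩
  rcases (bef_swap hn).1 h1 with ⟨rfl, rfl⟩ | ⟨h1, -⟩
  · exact h3.2.asymm hac
  rcases (bef_swap hn).1 h2 with ⟨rfl, rfl⟩ | ⟨h2, -⟩
  · exact h3.1.asymm hac
  exact hb.2.2 z h1 h2 h3

/-- A pair that becomes a box only through the exchange has c as its upper end and loses a from its
interior, or has a as its lower end and loses c. In both cases the arc of the exchange is a
restriction of the arc of the pair, so closure under restriction would put it into C. -/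
theorem valBoxIn_of_swap {C : Set RawArc} (hC : ForcingClosed C) (hac : a < c) (hn : Next σ c a)
    (hα : valArc σ a c ∉ C) (b d : Fin n) :
    ValBoxIn C (Equiv.swap c a * σ) b d → ValBoxIn C σ b d := by
  rintro ⟨hb, hd⟩
  have hbd : Bef σ d b := by
    rcases (bef_swap hn).1 hb.2.1 with ⟨rfl, rfl⟩ | ⟨h, -⟩
    · exact absurd hb.1 hac.asymm
    · exact h
  have harc : ∀ α, α ∈ C → α.left ≤ (a : ℕ) + 1 → (c : ℕ) + 1 ≤ α.right →
      α.restrict ((a : ℕ) + 1) ((c : ℕ) + 1) ≠ valArc σ a c := fun α h h1 h2 e =>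
    hα (e ▸ hC α h _ _ h1 (by simpa using hac) h2)
  have hbox : ValBox σ b d := by
    refine ⟨hb.1, hbd, fun z h1 h2 h3 => ?_⟩
    by_cases e1 : d = c ∧ z = a
    · obtain ⟨rfl, rfl⟩ := e1
      refine harc _ hd (by simpa [valArc] using h3.1.le) le_rfl
        (valArc_restrict h3.1.le le_rfl fun w hw hw' => bef_swap_of_ne hn ?_ ?_)
      · rintro ⟨rfl, h⟩
        exact hw'.ne rfl
      · rintro ⟨rfl, -⟩
        exact hw.ne rfl
    by_cases e2 : z = c ∧ b = a
    · obtain ⟨rfl, rfl⟩ := e2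
      refine harc _ hd le_rfl (by simpa [valArc] using h3.2.le)
        (valArc_restrict le_rfl h3.2.le fun w hw hw' => ?_)
      have e : ∀ u, u ≠ w → (Bef (Equiv.swap z b * σ) w u ↔ Bef σ w u) := fun u _ =>
        bef_swap_of_ne hn (fun h => hw'.ne h.1) (fun h => hw.ne' h.1)
      rw [e d (hw'.trans h3.2).ne']
      refine ⟨fun h => h.trans h1, fun h => ?_⟩
      -- Otherwise w would stand between d and the lower end, inside the box.
      by_contra hc
      have hdw := bef_of_not (hw'.trans h3.2).ne' hc
      refine hb.2.2 w ?_ ((e b hw.ne).2 (h.trans hn.1)) ⟨hw, hw'.trans h3.2⟩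
      exact (bef_swap_of_ne hn (fun h => hw.ne' h.2) (fun h => hw'.ne h.2)).2 hdw
    exact hb.2.2 z ((bef_swap hn).2 (Or.inr ⟨h1, e1⟩)) ((bef_swap hn).2 (Or.inr ⟨h2, e2⟩)) h3
  refine ⟨hbox, ?_⟩
  have harc : valArc (Equiv.swap c a * σ) b d = valArc σ b d := by
    refine valArc_congr fun z h1 h2 => bef_swap_of_ne hn ?_ ?_
    · rintro ⟨rfl, rfl⟩
      exact h2.asymm hac
    · rintro ⟨rfl, rfl⟩
      exact (hbox.not_of_next hac hn).1 rfl h1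
  exact harc ▸ hd

/-- Boxes with arc in I and their arcs agree before and after the step. The nesting order could
change only where the positions of c and a are compared with each other, and `ValBox.not_of_next`
excludes this for nested boxes. -/
theorem eta_eq_of_arcStep {I : ArcIdeal n} (h : ArcStep I.carrier σ τ) : eta I σ = eta I τ := by
  obtain ⟨a, c, hac, hn, hα, rfl⟩ := h
  have hiff : ∀ b d, ValBoxIn I.carrier (Equiv.swap c a * σ) b d ↔ ValBoxIn I.carrier σ b d :=
    fun b d => ⟨valBoxIn_of_swap I.closed hac hn hα b d,
      fun h => (valBoxIn_swap hac hn hα b d h).1⟩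
  ext α
  rw [mem_eta, mem_eta]
  refine exists_congr fun b => exists_congr fun d => ?_
  rw [hiff]
  refine and_congr_right fun hbd => ?_
  rw [(valBoxIn_swap hac hn hα b d hbd).2]
  refine and_congr_left fun _ => forall_congr' fun u => forall_congr' fun v => ?_
  rw [hiff]
  refine imp_congr_right fun huv => ?_
  have e1 : d ≤ v → (Bef (Equiv.swap c a * σ) v d ↔ Bef σ v d) ∨ (v = c ∧ d = a) := by
    intro hdv
    by_cases h : v = c ∧ d = a
    · exact Or.inr h
    · refine Or.inl (bef_swap_of_ne hn h ?_)
      rintro ⟨rfl, rfl⟩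
      exact absurd hac (not_lt.2 hdv)
  have e2 : u ≤ b → (Bef (Equiv.swap c a * σ) b u ↔ Bef σ b u) ∨ (b = c ∧ u = a) := by
    intro hub
    by_cases h : b = c ∧ u = a
    · exact Or.inr h
    · refine Or.inl (bef_swap_of_ne hn h ?_)
      rintro ⟨rfl, rfl⟩
      exact absurd hac (not_lt.2 hub)
  constructor
  · intro H h1 h2 h3 h4
    rcases e1 h3 with e1 | ⟨rfl, rfl⟩
    · rcases e2 h4 with e2 | ⟨rfl, rfl⟩
      · exact H (mt e1.2 h1) (mt e2.2 h2) h3 h4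
      · exact absurd (hbd.1.1.trans_le h3) ((huv.1.not_of_next hac hn).2 rfl)
    · exact absurd (h4.trans_lt hbd.1.1) ((huv.1.not_of_next hac hn).1 rfl)
  · intro H h1 h2 h3 h4
    rcases e1 h3 with e1 | ⟨rfl, rfl⟩
    · rcases e2 h4 with e2 | ⟨rfl, rfl⟩
      · exact H (mt e1.1 h1) (mt e2.1 h2) h3 h4
      · exact absurd (hbd.1.1.trans_le h3) ((huv.1.not_of_next hac hn).2 rfl)
    · exact absurd (h4.trans_lt hbd.1.1) ((huv.1.not_of_next hac hn).1 rfl)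

/-! ### Descents determine a permutation -/

/-- All descent arcs of `σ` are in `C`. -/
def DescentsIn (C : Set RawArc) (σ : Equiv.Perm (Fin n)) : Prop :=
  ∀ a c, a < c → Next σ c a → valArc σ a c ∈ C

theorem exists_next_of_bef {x u : Fin n} (h : Bef σ x u) : ∃ y, Next σ x y ∧ ¬ Bef σ u y := by
  have hlt := Fin.lt_def.1 h
  have hk : (σ⁻¹ x : ℕ) + 1 < n := by omega
  refine ⟨σ ⟨σ⁻¹ x + 1, hk⟩, ?_, ?_⟩
  · have := (next_apply (σ := σ) (i := σ⁻¹ x) (j := ⟨σ⁻¹ x + 1, hk⟩)).2 rfl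
    rwa [show σ (σ⁻¹ x) = x by simp] at this
  · rw [← show σ (σ⁻¹ u) = u by simp, bef_apply, Fin.lt_def]
    simp only
    omega

/-- The upper end of the descent is the last value ≥ d in the stretch that starts at d and stops
before b. Its successor is no such value, hence at most b because the box is empty. -/
theorem exists_descent_of_valBox {b d : Fin n} (h : ValBox σ b d) :
    ∃ a c, Next σ c a ∧ a ≤ b ∧ d ≤ c ∧ ¬ Bef σ c d ∧ ¬ Bef σ b a := by
  obtain ⟨x, hx, hmax⟩ := Finset.exists_max_image
    (Finset.univ.filter fun z => ¬ Bef σ z d ∧ Bef σ z b ∧ d ≤ z) (fun z => σ⁻¹ z)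
    ⟨d, by simpa using ⟨Bef.irrefl, h.2.1⟩⟩
  simp only [Finset.mem_filter, Finset.mem_univ, true_and] at hx hmax
  obtain ⟨y, hxy, hy⟩ := exists_next_of_bef hx.2.1
  refine ⟨y, x, hxy, ?_, hx.2.2, hx.1, hy⟩
  by_contra hlt
  have hby : b < y := not_le.1 hlt
  have hyb : Bef σ y b := bef_of_not hby.ne' hy
  have hdy : Bef σ d y := by
    rcases eq_or_ne d x with rfl | hne
    · exact hxy.1
    · exact (bef_of_not hne hx.1).trans hxy.1
  have hyd : d ≤ y := not_lt.1 fun hc => h.2.2 y hdy hyb ⟨hby, hc⟩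
  exact absurd hxy.1 (not_lt.2 (hmax y ⟨hdy.asymm, hyb, hyd⟩))

/-- Every box is dominated by a descent, whose arc is in I by assumption. A descent is dominated by
no other pair because its positions are adjacent. -/
theorem eta_eq_descentArcs {I : ArcIdeal n} (h : DescentsIn I.carrier σ) :
    eta I σ = descentArcs σ := by
  have box : ∀ a c, a < c → Next σ c a → ValBoxIn I.carrier σ a c := fun a c hac hn =>
    ⟨⟨hac, hn.1, fun z h1 h2 => absurd h2 (hn.2 z h1)⟩, h a c hac hn⟩
  ext α
  rw [mem_eta, mem_descentArcs]
  constructor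
  · rintro ⟨b, d, hbd, hmax, rfl⟩
    obtain ⟨a, c, hn, h1, h2, h3, h4⟩ := exists_descent_of_valBox hbd.1
    have hac : a < c := (h1.trans_lt hbd.1.1).trans_le h2
    obtain ⟨rfl, rfl⟩ := hmax a c (box a c hac hn) h3 h4 h2 h1
    exact ⟨_, _, hac, hn, rfl⟩
  · rintro ⟨a, c, hac, hn, rfl⟩
    refine ⟨a, c, box a c hac hn, fun u v huv hv hu _ _ => ?_, rfl⟩
    obtain rfl : v = c := by
      by_contra hne
      have hcv := bef_of_not (Ne.symm hne) hv
      have hau : a ≠ u := by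
        rintro rfl
        exact hn.2 v hcv huv.1.2.1
      have hua := bef_of_not hau.symm hu
      exact hn.2 v hcv (huv.1.2.1.trans hua)
    refine ⟨rfl, ?_⟩
    by_contra hne
    exact hn.2 u huv.1.2.1 (bef_of_not hne hu)

/-- The inversions of the join irreducible permutation of the arc `α` are inversions of `τ`. -/
def ArcLE (α : RawArc) (τ : Equiv.Perm (Fin n)) : Prop :=
  ∀ x y : Fin n, y < x → ((x : ℕ) + 1 = α.right ∨ (x : ℕ) + 1 ∈ α.above) →
    ((y : ℕ) + 1 = α.left ∨
      (α.left < (y : ℕ) + 1 ∧ (y : ℕ) + 1 < α.right ∧ (y : ℕ) + 1 ∉ α.above)) → Bef τ x y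

theorem ArcLE.mono {α : RawArc} (h : ArcLE α σ) (hle : WeakLE σ τ) : ArcLE α τ :=
  fun x y hyx hx hy => hle y x hyx (h x y hyx hx hy)

theorem arcLE_valArc_iff : ArcLE (valArc σ a c) τ ↔
    ∀ x y, y < x → (x = c ∨ (Bef σ x c ∧ a < x ∧ x < c)) →
      (y = a ∨ (a < y ∧ y < c ∧ ¬ Bef σ y c)) → Bef τ x y := by
  have e1 : ∀ x : Fin n, (x : ℕ) + 1 = (valArc σ a c).right ↔ x = c := fun x => by
    simp [valArc, Fin.ext_iff]
  have e2 : ∀ x : Fin n, (x : ℕ) + 1 = (valArc σ a c).left ↔ x = a := fun x => by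
    simp [valArc, Fin.ext_iff]
  have e3 : ∀ y : Fin n, (valArc σ a c).left < (y : ℕ) + 1 ↔ a < y := fun x => by
    simp [valArc]
  have e4 : ∀ y : Fin n, (y : ℕ) + 1 < (valArc σ a c).right ↔ y < c := fun x => by
    simp [valArc]
  simp only [ArcLE, e1, e2, e3, e4, succ_mem_valArc_above]
  refine forall_congr' fun x => forall_congr' fun y => imp_congr_right fun _ =>
    imp_congr_right fun _ => ?_
  tauto

/-- Values in the set of the arc stand before c; the other values between a and c stand after c, and
therefore after its successor a. -/
theorem arcLE_of_next (hn : Next σ c a) : ArcLE (valArc σ a c) σ := by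
  rw [arcLE_valArc_iff]
  rintro x y hyx hx hy
  have hxa : Bef σ x c ∨ x = c := by tauto
  have hya : Bef σ a y ∨ y = a := by
    rcases hy with rfl | ⟨h1, h2, h3⟩
    · exact Or.inr rfl
    · exact Or.inl (bef_of_not h1.ne fun hc => hn.2 y (bef_of_not h2.ne' h3) hc)
  rcases hxa with hxa | rfl <;> rcases hya with hya | rfl
  · exact (hxa.trans hn.1).trans hya
  · exact hxa.trans hn.1
  · exact hn.1.trans hya
  · exact hn.1

/-- This says that σ is the join of the join irreducibles of its descents. For an inversion x … y
let c be the last value ≥ x from x on and before y, and let a < x be its successor. If a ≤ y, the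
inversion is one of those of the arc of c a. Otherwise it follows by transitivity from the shorter
inversions x … a and a … y. -/
theorem weakLE_of_arcLE (h : ∀ α ∈ descentArcs σ, ArcLE α τ) : WeakLE σ τ := by
  have key : ∀ m : ℕ, ∀ x y, y < x → (σ⁻¹ y : ℕ) = σ⁻¹ x + m → Bef σ x y → Bef τ x y := by
    intro m
    induction m using Nat.strong_induction_on with
    | _ m ih =>
      intro x y hyx hm hb
      obtain ⟨c, hc, hmax⟩ := Finset.exists_max_image
        (Finset.univ.filter fun z => ¬ Bef σ z x ∧ Bef σ z y ∧ x ≤ z) (fun z => σ⁻¹ z)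
        ⟨x, by simpa using ⟨Bef.irrefl, hb⟩⟩
      simp only [Finset.mem_filter, Finset.mem_univ, true_and] at hc hmax
      obtain ⟨a, hn, ha⟩ := exists_next_of_bef hc.2.1
      have hxa : Bef σ x a := by
        rcases eq_or_ne x c with rfl | hne
        · exact hn.1
        · exact (bef_of_not hne hc.1).trans hn.1
      have hax : a < x := by
        rcases eq_or_ne a y with rfl | hne
        · exact hyx
        · by_contra hge
          exact absurd hn.1 (not_lt.2 (hmax a ⟨hxa.asymm, bef_of_not hne ha, not_lt.1 hge⟩))
      have hac : a < c := hax.trans_le hc.2.2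
      rcases le_or_gt a y with hay | hay
      · have hα := h _ (mem_descentArcs.2 ⟨a, c, hac, hn, rfl⟩)
        rw [arcLE_valArc_iff] at hα
        refine hα x y hyx ?_ ?_
        · rcases eq_or_ne x c with rfl | hne
          · exact Or.inl rfl
          · exact Or.inr ⟨bef_of_not hne hc.1, hax, lt_of_le_of_ne hc.2.2 hne⟩
        · rcases eq_or_ne y a with rfl | hne
          · exact Or.inl rfl
          · exact Or.inr ⟨lt_of_le_of_ne hay hne.symm, hyx.trans_le hc.2.2, hc.2.1.asymm⟩
      · have hayb : Bef σ a y := bef_of_not hay.ne' ha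
        have h1 := Fin.lt_def.1 hxa
        have h2 := Fin.lt_def.1 hayb
        exact (ih ((σ⁻¹ a : ℕ) - σ⁻¹ x) (by omega) x a hax (by omega) hxa).trans
          (ih ((σ⁻¹ y : ℕ) - σ⁻¹ a) (by omega) a y hay (by omega) hayb)
  intro y x hyx hb
  refine key ((σ⁻¹ y : ℕ) - σ⁻¹ x) x y hyx ?_ hb
  have := Fin.lt_def.1 hb
  omega

theorem arcLE_of_mem_descentArcs {α : RawArc} (h : α ∈ descentArcs σ) : ArcLE α σ := by
  obtain ⟨a, c, -, hn, rfl⟩ := mem_descentArcs.1 h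
  exact arcLE_of_next hn

theorem descentArcs_injective (h : descentArcs σ = descentArcs τ) : σ = τ :=
  (weakLE_of_arcLE fun _ hα => arcLE_of_mem_descentArcs (h ▸ hα)).antisymm'
    (weakLE_of_arcLE fun _ hα => arcLE_of_mem_descentArcs (h ▸ hα))

theorem ArcStep.weakLE {C : Set RawArc} (h : ArcStep C σ τ) : WeakLE τ σ := by
  obtain ⟨a, c, hac, hn, -, rfl⟩ := h
  exact swap_weakLE hac hn

/-- Only the inversion of c and a is lost. If α required it, the inversions of α would prescribe for
every value of ]a, c[ whether it stands before or after the neighbors; then the arc of the step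
would be a restriction of α and lie in C. -/
theorem ArcStep.arcLE {C : Set RawArc} (hC : ForcingClosed C) (h : ArcStep C σ τ) {α : RawArc}
    (hα : α ∈ C) (hs : α.above ⊆ Finset.Ioo α.left α.right) (hle : ArcLE α σ) : ArcLE α τ := by
  obtain ⟨a, c, hac, hn, hβ, rfl⟩ := h
  intro x y hyx hx hy
  refine (bef_swap hn).2 (Or.inr ⟨hle x y hyx hx hy, ?_⟩)
  rintro ⟨rfl, rfl⟩
  have hright : (x : ℕ) + 1 ≤ α.right := by
    rcases hx with hx | hx
    · exact hx.le
    · exact (Finset.mem_Ioo.1 (hs hx)).2.le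
  have hleft : α.left ≤ (y : ℕ) + 1 := by
    rcases hy with hy | hy
    · exact hy.ge
    · exact hy.1.le
  refine hβ ?_
  have := hC α hα ((y : ℕ) + 1) ((x : ℕ) + 1) hleft (by simpa using hyx) hright
  convert this using 1
  ext z
  · rfl
  · rfl
  · rw [mem_valArc_above, RawArc.restrict, Finset.mem_inter, Finset.mem_Ioo]
    constructor
    · rintro ⟨z, ⟨h1, h2, h3⟩, rfl⟩
      rw [Fin.lt_def] at h2 h3
      refine ⟨?_, by omega⟩
      by_contra hz
      exact h1.asymm (hle x z (Fin.lt_def.2 h3) hx (Or.inr ⟨by omega, by omega, hz⟩))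
    · rintro ⟨h1, h2, h3⟩
      obtain ⟨w, rfl⟩ : ∃ w : Fin n, (w : ℕ) + 1 = z := ⟨⟨z - 1, by omega⟩, by simp only; omega⟩
      have hw : w < x := Fin.lt_def.2 (by omega)
      have hw' : y < w := Fin.lt_def.2 (by omega)
      have hb := hle w y hw' (Or.inr h1) hy
      exact ⟨w, ⟨bef_of_not hw.ne fun hc => hn.2 _ hc hb, hw', hw⟩, rfl⟩

theorem descentArcs_isNoncrossing (σ : Equiv.Perm (Fin n)) :
    IsNoncrossingDiagram n (descentArcs σ) := by
  -- Where the arcs of two descents overlap, apart from common ends, the arc of the later descent d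
  -- b is the upper one: a value that is at most as high as the arc of c a stands before c or is c
  -- or a, and so it stands before d.
  have key : ∀ a c b d : Fin n, a < c → b < d → Next σ c a → Next σ d b → Bef σ c d → ∀ r : ℕ,
      r ∈ Finset.Icc (valArc σ b d).left (valArc σ b d).right →
      ¬ ((r = (valArc σ a c).left ∨ r = (valArc σ a c).right) ∧
        (r = (valArc σ b d).left ∨ r = (valArc σ b d).right)) →
      (r ∈ (valArc σ a c).above ∨ r = (valArc σ a c).left ∨ r = (valArc σ a c).right) →
      r ∈ (valArc σ b d).above := by
    intro a c b d hac hbd hca hdb hcd r hr hne hr'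
    obtain ⟨z, rfl, hz⟩ : ∃ z : Fin n, (z : ℕ) + 1 = r ∧ (z = a ∨ z = c ∨ Bef σ z c) := by
      rcases hr' with h | h | h
      · obtain ⟨z, h1, h2⟩ := mem_valArc_above.1 h
        exact ⟨z, h2, by tauto⟩
      · exact ⟨a, h.symm, by tauto⟩
      · exact ⟨c, h.symm, by tauto⟩
    have hzd : z = a ∨ z = c ∨ Bef σ z d := by
      rcases hz with h | h | h
      · exact Or.inl h
      · exact Or.inr (Or.inl h)
      · exact Or.inr (Or.inr (h.trans hcd))
    have had : a = d ∨ Bef σ a d := by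
      rcases eq_or_ne a d with h | h
      · exact Or.inl h
      · exact Or.inr (bef_of_not h (hca.2 d hcd))
    have hb : Bef σ z d ∨ (z = a ∧ a = d) := by
      rcases hzd with rfl | rfl | h
      · rcases had with rfl | h
        · exact Or.inr ⟨rfl, rfl⟩
        · exact Or.inl h
      · exact Or.inl hcd
      · exact Or.inl h
    rcases hb with hb | ⟨rfl, rfl⟩
    · have hr2 : b ≤ z ∧ z ≤ d := by
        simpa [valArc] using hr
      refine succ_mem_valArc_above.2 ⟨hb, lt_of_le_of_ne hr2.1 ?_, lt_of_le_of_ne hr2.2 hb.ne⟩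
      rintro rfl
      exact hdb.1.asymm hb
    · exact absurd ⟨Or.inl rfl, Or.inr rfl⟩ hne
  refine ⟨?_, ?_⟩
  · intro α hα
    obtain ⟨a, c, hac, -, rfl⟩ := mem_descentArcs.1 hα
    exact valArc_isArc hac
  · intro α hα β hβ hne
    obtain ⟨a, c, hac, hca, rfl⟩ := mem_descentArcs.1 hα
    obtain ⟨b, d, hbd, hdb, rfl⟩ := mem_descentArcs.1 hβ
    have hcd : c ≠ d := by
      rintro rfl
      have : a = b := by
        by_contra hab
        rcases Bef.total (σ := σ) hab with h | h
        · exact hdb.2 a hca.1 h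
        · exact hca.2 b hdb.1 h
      exact hne (by rw [this])
    have hab : a ≠ b := by
      rintro rfl
      rcases Bef.total (σ := σ) hcd with h | h
      · exact hca.2 d h hdb.1
      · exact hdb.2 c h hca.1
    refine ⟨?_, by simpa [valArc, Fin.ext_iff] using hab, by simpa [valArc, Fin.ext_iff] using hcd⟩
    rintro ⟨r, s, ⟨hr1, hr2, hr3⟩, ⟨hs1, hs2, hs3⟩, ⟨hr4, hr5⟩, ⟨hs4, hs5⟩⟩
    rcases Bef.total (σ := σ) hcd with h | h
    · exact hr5 (key a c b d hac hbd hca hdb h r hr2 hr3 hr4)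
    · exact hs5 (key b d a c hbd hac hdb hca h s hs1 (fun h => hs3 ⟨h.2, h.1⟩) hs4)

/-! ### The fibers of the diagram map -/

/-- The equivalence relation generated by `ArcStep`. -/
def arcSetoid (C : Set RawArc) : Setoid (Equiv.Perm (Fin n)) := Relation.EqvGen.setoid (ArcStep C)

theorem arcSetoid_of_step {C : Set RawArc} (h : ArcStep C σ τ) : arcSetoid C σ τ :=
  Relation.EqvGen.rel _ _ h

theorem arcSetoid_induction {C : Set RawArc} {β : Type*} (f : Equiv.Perm (Fin n) → β)
    (hf : ∀ σ τ, ArcStep C σ τ → f σ = f τ) (h : arcSetoid C σ τ) : f σ = f τ := by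
  induction h with
  | rel _ _ h => exact hf _ _ h
  | refl _ => rfl
  | symm _ _ _ ih => exact ih.symm
  | trans _ _ _ _ _ ih ih' => exact ih.trans ih'

/-- Each step removes an inversion, so the number of disagreements with the identity decreases. -/
theorem exists_descentsIn (C : Set RawArc) (σ : Equiv.Perm (Fin n)) :
    ∃ τ, arcSetoid C σ τ ∧ WeakLE τ σ ∧ DescentsIn C τ := by
  induction hm : (disagree σ 1).card using Nat.strong_induction_on generalizing σ with
  | _ m ih =>
    by_cases hσ : DescentsIn C σ
    · exact ⟨σ, Setoid.refl' _ σ, WeakLE.rfl', hσ⟩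
    · simp only [DescentsIn, not_forall] at hσ
      obtain ⟨a, c, hac, hn, hα⟩ := hσ
      have hstep : ArcStep C σ (Equiv.swap c a * σ) := ⟨a, c, hac, hn, hα, rfl⟩
      obtain ⟨τ, h1, h2, h3⟩ := ih _ (hm ▸ card_disagree_swap hn (by simpa [Bef] using hac)) _ rfl
      exact ⟨τ, Setoid.trans' _ (arcSetoid_of_step hstep) h1, h2.trans' hstep.weakLE, h3⟩

/-- Both permutations are connected by steps with permutations whose descents are all in I. There
the diagram is the set of descent arcs, which determines the permutation. -/
theorem eta_eq_iff {I : ArcIdeal n} : eta I σ = eta I τ ↔ arcSetoid I.carrier σ τ := by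
  refine ⟨fun h => ?_, arcSetoid_induction (eta I) fun _ _ => eta_eq_of_arcStep⟩
  obtain ⟨σ', h1, -, h2⟩ := exists_descentsIn I.carrier σ
  obtain ⟨τ', h3, -, h4⟩ := exists_descentsIn I.carrier τ
  have e : σ' = τ' := by
    refine descentArcs_injective ?_
    rw [← eta_eq_descentArcs h2, ← eta_eq_descentArcs h4,
      ← arcSetoid_induction (eta I) (fun _ _ => eta_eq_of_arcStep) h1,
      ← arcSetoid_induction (eta I) (fun _ _ => eta_eq_of_arcStep) h3, h]
  subst e
  exact Setoid.trans' _ h1 (Setoid.symm' _ h3)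

theorem eta_isNoncrossing (I : ArcIdeal n) (σ : Equiv.Perm (Fin n)) :
    IsNoncrossingDiagram n (eta I σ) := by
  obtain ⟨τ, h1, -, h2⟩ := exists_descentsIn I.carrier σ
  rw [eta_eq_iff.2 h1, eta_eq_descentArcs h2]
  exact descentArcs_isNoncrossing τ

theorem eta_subset (I : ArcIdeal n) (σ : Equiv.Perm (Fin n)) : eta I σ ⊆ I.carrier := by
  intro α hα
  obtain ⟨a, c, h, -, rfl⟩ := mem_eta.1 hα
  exact h.2

end Diagrams

/-! ### Reversing words -/

section Reversal

variable {n : ℕ} {σ τ : Equiv.Perm (Fin n)} {a c : Fin n}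

/-- The word of `σ` read backwards. -/
def revWord (σ : Equiv.Perm (Fin n)) : Equiv.Perm (Fin n) := σ * Fin.revPerm

theorem bef_revWord {x y : Fin n} : Bef (revWord σ) x y ↔ Bef σ y x := by
  have h : ∀ x, (revWord σ)⁻¹ x = Fin.rev (σ⁻¹ x) := fun x => by
    simp [revWord]
  rw [Bef, h, h, Fin.rev_lt_rev]
  rfl

theorem revWord_revWord : revWord (revWord σ) = σ :=
  perm_ext_bef fun x y h => by rwa [bef_revWord, bef_revWord] at h

theorem weakLE_revWord : WeakLE (revWord σ) (revWord τ) ↔ WeakLE τ σ := by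
  constructor
  · intro h a b hab hb
    exact bef_of_not hab.ne' fun hc => (bef_revWord.1 (h a b hab (bef_revWord.2 hc))).asymm hb
  · intro h a b hab hb
    refine bef_revWord.2 (bef_of_not hab.ne fun hc => ?_)
    exact (bef_revWord.1 hb).asymm (h a b hab hc)

theorem isWeakMeet_revWord {x y z : Equiv.Perm (Fin n)} :
    IsWeakMeet (revWord x) (revWord y) (revWord z) ↔ IsWeakJoin x y z := by
  simp only [IsWeakMeet, IsWeakJoin, weakLE_revWord]
  refine and_congr_right fun _ => and_congr_right fun _ => ⟨fun h w h1 h2 => ?_, fun h w h1 h2 => ?_⟩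
  · exact weakLE_revWord.1 (h _ (weakLE_revWord.2 h1) (weakLE_revWord.2 h2))
  · rw [← revWord_revWord (σ := w)] at h1 h2 ⊢
    exact weakLE_revWord.2 (h _ (weakLE_revWord.1 h1) (weakLE_revWord.1 h2))

/-- The reflection of an arc at the horizontal axis. -/
def RawArc.flip (α : RawArc) : RawArc :=
  ⟨α.left, α.right, Finset.Ioo α.left α.right \ α.above⟩

theorem RawArc.flip_flip {α : RawArc} (h : α.above ⊆ Finset.Ioo α.left α.right) :
    α.flip.flip = α := by
  ext x
  · rfl
  · rfl
  · simp only [RawArc.flip, Finset.mem_sdiff]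
    have := @h x
    tauto

theorem RawArc.flip_restrict {α : RawArc} {b c : ℕ} (hb : α.left ≤ b) (hc : c ≤ α.right) :
    (α.restrict b c).flip = α.flip.restrict b c := by
  ext x
  · rfl
  · rfl
  · simp only [RawArc.flip, RawArc.restrict, Finset.mem_sdiff, Finset.mem_inter, Finset.mem_Ioo]
    constructor
    · rintro ⟨h1, h2⟩
      exact ⟨⟨⟨by omega, by omega⟩, fun h => h2 ⟨h, h1⟩⟩, h1⟩
    · rintro ⟨⟨h1, h2⟩, h3⟩
      exact ⟨h3, fun h => h2 h.1⟩

/-- The reflection of an arc ideal at the horizontal axis. -/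
def ArcIdeal.flip (I : ArcIdeal n) : ArcIdeal n where
  carrier := {α | IsArc n α ∧ α.flip ∈ I.carrier}
  isArc _ h := h.1
  closed α h b c hb hbc hc := by
    have h1 := h.1.1
    have h2 := h.1.2.2.1
    refine ⟨⟨by simp only [RawArc.restrict]; omega, hbc, by simp only [RawArc.restrict]; omega,
      Finset.inter_subset_right⟩, ?_⟩
    rw [RawArc.flip_restrict hb hc]
    exact I.closed _ h.2 _ _ hb hbc hc

theorem ArcIdeal.flip_flip (I : ArcIdeal n) : I.flip.flip = I := by
  ext α
  constructor
  · rintro ⟨h1, h2⟩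
    have := h2.2
    rwa [RawArc.flip_flip h1.2.2.2] at this
  · intro h
    have h1 := I.isArc α h
    refine ⟨h1, ⟨h1.1, h1.2.1, h1.2.2.1, Finset.sdiff_subset⟩, ?_⟩
    rwa [RawArc.flip_flip h1.2.2.2]

/-- After the step a stands before c, so c a is a descent of the word read backwards. A value
between them in size has changed its side, which reflects the arc. This reduces joins to meets. -/
theorem ArcStep.revWord {I : ArcIdeal n} (h : ArcStep I.carrier σ τ) :
    ArcStep I.flip.carrier (revWord τ) (revWord σ) := by
  obtain ⟨a, c, hac, hn, hα, rfl⟩ := h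
  have hn' : Next (ArcHopf.revWord (Equiv.swap c a * σ)) c a := by
    refine ⟨bef_revWord.2 hn.swap.1, fun z h1 h2 => ?_⟩
    exact hn.swap.2 z (bef_revWord.1 h2) (bef_revWord.1 h1)
  refine ⟨a, c, hac, hn', fun h => hα ?_, ?_⟩
  · have h2 := h.2
    convert h2 using 1
    ext x
    · rfl
    · rfl
    · simp only [RawArc.flip, Finset.mem_sdiff, Finset.mem_Ioo]
      constructor
      · intro hx
        obtain ⟨z, ⟨h1, h2, h3⟩, rfl⟩ := mem_valArc_above.1 hx
        refine ⟨by simpa [valArc] using ⟨h2, h3⟩, fun hz => ?_⟩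
        rw [succ_mem_valArc_above, bef_revWord,
          bef_swap_of_ne hn (fun h => h2.ne' h.2) (fun h => h3.ne h.2)] at hz
        exact hz.1.asymm h1
      · rintro ⟨⟨h1, h2⟩, h3⟩
        obtain ⟨w, rfl⟩ : ∃ w : Fin n, (w : ℕ) + 1 = x := by
          have := c.isLt
          simp only [valArc] at h1 h2
          exact ⟨⟨x - 1, by omega⟩, by simp only; omega⟩
        have h1' : a < w := by simpa [valArc] using h1
        have h2' : w < c := by simpa [valArc] using h2
        rw [succ_mem_valArc_above, bef_revWord,
          bef_swap_of_ne hn (fun h => h1'.ne' h.2) (fun h => h2'.ne h.2)] at h3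
        refine succ_mem_valArc_above.2 ⟨bef_of_not h2'.ne fun hb => h3 ⟨hb, h1', h2'⟩, h1', h2'⟩
  · rw [ArcHopf.revWord, ArcHopf.revWord, ← mul_assoc, ← mul_assoc, Equiv.swap_mul_self, one_mul]

theorem arcSetoid_revWord {I : ArcIdeal n} (h : arcSetoid I.carrier σ τ) :
    arcSetoid I.flip.carrier (revWord σ) (revWord τ) := by
  induction h with
  | rel _ _ h => exact Setoid.symm' _ (arcSetoid_of_step h.revWord)
  | refl _ => exact Setoid.refl' _ _
  | symm _ _ _ ih => exact Setoid.symm' _ ih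
  | trans _ _ _ _ _ ih ih' => exact Setoid.trans' _ ih ih'

end Reversal

/-! ### Arc ideals give lattice congruences -/

section FromIdeals

variable {n : ℕ} {σ τ : Equiv.Perm (Fin n)}

/-- One step at a time: σ ≤ u means that u has the inversions of all descent arcs of σ, and since
these arcs are in I, a step down preserves this by `ArcStep.arcLE`. The other direction is
transitivity. -/
theorem weakLE_iff_of_arcSetoid (I : ArcIdeal n) {w w' : Equiv.Perm (Fin n)}
    (hσ : DescentsIn I.carrier σ) (h : arcSetoid I.carrier w w') :
    WeakLE σ w ↔ WeakLE σ w' := by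
  refine iff_of_eq (arcSetoid_induction (fun w => WeakLE σ w) (fun u v huv => propext ?_) h)
  refine ⟨fun hu => weakLE_of_arcLE fun α hα => ?_, fun hv => hv.trans' huv.weakLE⟩
  have hα' : ArcLE α u := (arcLE_of_mem_descentArcs hα).mono hu
  obtain ⟨a, c, hac, hn, rfl⟩ := mem_descentArcs.1 hα
  exact huv.arcLE I.closed (hσ a c hac hn) (valArc_isArc hac).2.2.2 hα'

/-- The permutation u reached from z by descending is below x and y, hence below x' and y' and their
meet z', hence below the permutation u' reached from z'. By symmetry u = u'. -/
theorem arcSetoid_meet (I : ArcIdeal n) {x x' y y' z z' : Equiv.Perm (Fin n)}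
    (hx : arcSetoid I.carrier x x') (hy : arcSetoid I.carrier y y') (hz : IsWeakMeet x y z)
    (hz' : IsWeakMeet x' y' z') : arcSetoid I.carrier z z' := by
  have key : ∀ {x x' y y' z z' u u' : Equiv.Perm (Fin n)}, arcSetoid I.carrier x x' →
      arcSetoid I.carrier y y' → IsWeakMeet x y z → IsWeakMeet x' y' z' →
      WeakLE u z → DescentsIn I.carrier u → arcSetoid I.carrier z' u' → WeakLE u u' := by
    intro x x' y y' z z' u u' hx hy hz hz' huz hu hu'
    refine (weakLE_iff_of_arcSetoid I hu hu').1 (hz'.2.2 u ?_ ?_)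
    · exact (weakLE_iff_of_arcSetoid I hu hx).1 (huz.trans' hz.1)
    · exact (weakLE_iff_of_arcSetoid I hu hy).1 (huz.trans' hz.2.1)
  obtain ⟨u, h1, h2, h3⟩ := exists_descentsIn I.carrier z
  obtain ⟨u', h1', h2', h3'⟩ := exists_descentsIn I.carrier z'
  obtain rfl : u = u' := (key hx hy hz hz' h2 h3 h1').antisymm'
    (key (Setoid.symm' _ hx) (Setoid.symm' _ hy) hz' hz h2' h3' h1)
  exact Setoid.trans' _ h1 (Setoid.symm' _ h1')

theorem isLatticeCongruence_eta (I : ArcIdeal n) :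
    IsLatticeCongruence (Setoid.ker (eta I)) := by
  refine ⟨?_, ?_⟩
  · intro x x' y y' z z' hx hy hz hz'
    have := arcSetoid_revWord (arcSetoid_meet I.flip (arcSetoid_revWord (eta_eq_iff.1 hx))
      (arcSetoid_revWord (eta_eq_iff.1 hy)) (isWeakMeet_revWord.2 hz) (isWeakMeet_revWord.2 hz'))
    rw [ArcIdeal.flip_flip, revWord_revWord, revWord_revWord] at this
    exact eta_eq_iff.2 this
  · intro x x' y y' z z' hx hy hz hz'
    exact eta_eq_iff.2 (arcSetoid_meet I (eta_eq_iff.1 hx) (eta_eq_iff.1 hy) hz hz')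

end FromIdeals

/-! ### The weak order is a lattice -/

section WeakLattice

variable {n : ℕ}

/-- The word order consists of the inversions and of the increasing pairs that are not inversions.
The mixed cases of its transitivity use that the complement of T is transitive as well, which is
`cotrans`. -/
theorem exists_perm_of_inversions (T : Fin n → Fin n → Prop) (hlt : ∀ u v, T u v → v < u)
    (trans : ∀ u v w, T u v → T v w → T u w)
    (cotrans : ∀ a b c, a < b → b < c → T c a → T c b ∨ T b a) :
    ∃ σ : Equiv.Perm (Fin n), ∀ u v, v < u → (Bef σ u v ↔ T u v) := by
  obtain ⟨σ, hσ⟩ := exists_perm_of_rel (fun u v => T u v ∨ (u < v ∧ ¬ T v u))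
    (fun x h => by
      rcases h with h | h
      · exact (hlt _ _ h).ne rfl
      · exact h.1.ne rfl)
    (by
      rintro u v w (h1 | ⟨h1, h1'⟩) (h2 | ⟨h2, h2'⟩)
      · exact Or.inl (trans _ _ _ h1 h2)
      · rcases lt_trichotomy u w with h | rfl | h
        · exact Or.inr ⟨h, fun hc => h2' (trans _ _ _ hc h1)⟩
        · exact absurd h1 h2'
        · exact Or.inl ((cotrans _ _ _ h2 h h1).resolve_right h2')
      · rcases lt_trichotomy u w with h | rfl | h
        · exact Or.inr ⟨h, fun hc => h1' (trans _ _ _ h2 hc)⟩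
        · exact absurd h2 h1'
        · exact Or.inl ((cotrans _ _ _ h h1 h2).resolve_left h1')
      · exact Or.inr ⟨h1.trans h2, fun hc => (cotrans _ _ _ h1 h2 hc).elim h2' h1'⟩)
    (by
      intro x y hne
      rcases lt_or_gt_of_ne hne with h | h
      · by_cases hT : T y x
        · exact Or.inr (Or.inl hT)
        · exact Or.inl (Or.inr ⟨h, hT⟩)
      · by_cases hT : T x y
        · exact Or.inl (Or.inl hT)
        · exact Or.inr (Or.inr ⟨h, hT⟩))
  refine ⟨σ, fun u v huv => (hσ u v).trans ⟨fun h => ?_, Or.inl⟩⟩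
  exact h.resolve_right fun h' => h'.1.asymm huv

/-- The inversions of the join are the transitive closure of the union of the two inversion sets. -/
theorem exists_isWeakJoin (x y : Equiv.Perm (Fin n)) : ∃ z, IsWeakJoin x y z := by
  let R : Fin n → Fin n → Prop := fun b a => a < b ∧ (Bef x b a ∨ Bef y b a)
  have hlt : ∀ u v, Relation.TransGen R u v → v < u := fun u v h => by
    induction h with
    | single h => exact h.1
    | tail _ h ih => exact h.1.trans ih
  have hR : ∀ a b c, a < b → b < c → R c a → R c b ∨ R b a := by
    rintro a b c hab hbc ⟨hac, h | h⟩
    · rcases Bef.total (σ := x) hbc.ne with h' | h'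
      · exact Or.inr ⟨hab, Or.inl (h'.trans h)⟩
      · exact Or.inl ⟨hbc, Or.inl h'⟩
    · rcases Bef.total (σ := y) hbc.ne with h' | h'
      · exact Or.inr ⟨hab, Or.inr (h'.trans h)⟩
      · exact Or.inl ⟨hbc, Or.inr h'⟩
  obtain ⟨z, hz⟩ := exists_perm_of_inversions (Relation.TransGen R) hlt
    (fun _ _ _ => Relation.TransGen.trans) (by
      intro a b c hab hbc h
      induction h with
      | single h => exact (hR _ _ _ hab hbc h).imp .single .single
      -- If the last link from d to a jumps over b, this link is split; otherwise b equals d or lies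
      -- in the range of the earlier part of the chain.
      | @tail d a h h' ih =>
        rcases lt_trichotomy b d with hbd | rfl | hbd
        · rcases hR _ _ _ hab hbd h' with h' | h'
          · exact Or.inl (h.tail h')
          · exact Or.inr (.single h')
        · exact Or.inl h
        · exact (ih hbd).imp id fun h => h.tail h')
  refine ⟨z, fun a b hab h => (hz b a hab).2 (.single ⟨hab, Or.inl h⟩),
    fun a b hab h => (hz b a hab).2 (.single ⟨hab, Or.inr h⟩), fun w hx hy a b hab h => ?_⟩
  have hT := (hz b a hab).1 h
  have hw : ∀ u v, R u v → Bef w u v := fun u v h => h.2.elim (hx v u h.1) (hy v u h.1)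
  change Bef w b a
  clear hab h
  induction hT with
  | single h => exact hw _ _ h
  | tail _ h ih => exact ih.trans (hw _ _ h)

theorem exists_isWeakMeet (x y : Equiv.Perm (Fin n)) : ∃ z, IsWeakMeet x y z := by
  obtain ⟨z, hz⟩ := exists_isWeakJoin (revWord x) (revWord y)
  refine ⟨revWord z, ?_⟩
  have := isWeakMeet_revWord.2 hz
  rwa [revWord_revWord, revWord_revWord] at this

end WeakLattice

/-! ### Lattice congruences are given by arc ideals -/

section FromCongruences

variable {n : ℕ} {σ τ : Equiv.Perm (Fin n)} {a c : Fin n}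

/-- The join irreducible permutation of an arc. -/
theorem exists_joinIrred (σ : Equiv.Perm (Fin n)) (hac : a < c) :
    ∃ j : Equiv.Perm (Fin n), (∀ τ, WeakLE j τ ↔ ArcLE (valArc σ a c) τ) ∧ Next j c a ∧
      valArc j a c = valArc σ a c ∧ ∀ b d, b < d → Next j d b → b = a ∧ d = c := by
  -- P collects the right end of the arc and the values of its set, Q the left end and the remaining
  -- values in between. They partition [a, c], and the inversions of j are the pairs x > y with x in
  -- P and y in Q.
  let P : Fin n → Prop := fun x => x = c ∨ (Bef σ x c ∧ a < x ∧ x < c)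
  let Q : Fin n → Prop := fun y => y = a ∨ (a < y ∧ y < c ∧ ¬ Bef σ y c)
  have hPQ : ∀ x, P x → ¬ Q x := by
    rintro x (rfl | ⟨h1, h2, h3⟩) (rfl | ⟨h4, h5, h6⟩)
    · exact hac.ne rfl
    · exact h5.ne rfl
    · exact h2.ne rfl
    · exact h6 h1
  have hcover : ∀ x, a < x → x < c → P x ∨ Q x := by
    intro x h1 h2
    by_cases h : Bef σ x c
    · exact Or.inl (Or.inr ⟨h, h1, h2⟩)
    · exact Or.inr (Or.inr ⟨h1, h2, h⟩)
  have hPc : ∀ x, P x → x ≤ c := by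
    rintro x (rfl | ⟨-, -, h⟩)
    · exact le_rfl
    · exact h.le
  have hQa : ∀ x, Q x → a ≤ x := by
    rintro x (rfl | ⟨h, -⟩)
    · exact le_rfl
    · exact h.le
  obtain ⟨j, hj⟩ := exists_perm_of_inversions (fun x y => y < x ∧ P x ∧ Q y) (fun _ _ h => h.1)
    (fun u v w h1 h2 => absurd h1.2.2 (hPQ v h2.2.1)) (by
      rintro u v w huv hvw ⟨-, h1, h2⟩
      rcases hcover v ((hQa u h2).trans_lt huv) (hvw.trans_le (hPc w h1)) with h | h
      · exact Or.inr ⟨huv, h, h2⟩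
      · exact Or.inl ⟨hvw, h1, h⟩)
  have hca : Bef j c a := (hj c a hac).2 ⟨hac, Or.inl rfl, Or.inl rfl⟩
  refine ⟨j, fun τ => ?_, ⟨hca, fun z h1 h2 => ?_⟩, valArc_congr fun z h1 h2 => ?_,
    fun b d hbd hn => ?_⟩
  · rw [arcLE_valArc_iff]
    constructor
    · intro h x y hyx hx hy
      exact h y x hyx ((hj x y hyx).2 ⟨hyx, hx, hy⟩)
    · intro h y x hyx hb
      obtain ⟨-, hx, hy⟩ := (hj x y hyx).1 hb
      exact h x y hyx hx hy
  · have hzc : z < c := by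
      by_contra hge
      have hcz : c < z := lt_of_le_of_ne (not_lt.1 hge) h1.ne
      exact absurd (hPc z ((hj z a (hac.trans hcz)).1 h2).2.1) (not_le.2 hcz)
    have hQz := ((hj c z hzc).1 h1).2.2
    have haz : a < z := lt_of_le_of_ne (hQa z hQz) (Bef.ne h2).symm
    exact hPQ z ((hj z a haz).1 h2).2.1 hQz
  · rw [← not_bef_iff h2.ne', hj c z h2]
    constructor
    · intro h
      by_contra hb
      exact h ⟨h2, Or.inl rfl, Or.inr ⟨h1, h2, hb⟩⟩
    · rintro hb ⟨-, -, h⟩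
      exact hPQ z (Or.inr ⟨hb, h1, h2⟩) h
  · obtain ⟨-, hd, hb⟩ := (hj d b hbd).1 hn.1
    have hbc : b < c := hbd.trans_le (hPc d hd)
    have had : a < d := (hQa b hb).trans_lt hbd
    constructor
    · by_contra hne
      have hab : a < b := lt_of_le_of_ne (hQa b hb) (Ne.symm hne)
      refine hn.2 a ((hj d a had).2 ⟨had, hd, Or.inl rfl⟩) (bef_of_not hab.ne fun h => ?_)
      exact hPQ b ((hj b a hab).1 h).2.1 hb
    · by_contra hne
      have hdc : d < c := lt_of_le_of_ne (hPc d hd) hne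
      refine hn.2 c (bef_of_not hdc.ne fun h => ?_) ((hj c b hbc).2 ⟨hbc, Or.inl rfl, hb⟩)
      exact hPQ d hd ((hj c d hdc).1 h).2.2

theorem not_bef_swap (hn : Next σ c a) : ¬ Bef (Equiv.swap c a * σ) c a :=
  hn.swap.1.asymm

theorem isWeakJoin_of_le (h : WeakLE σ τ) : IsWeakJoin σ τ τ :=
  ⟨h, WeakLE.rfl', fun _ _ h => h⟩

theorem isWeakJoin_of_ge (h : WeakLE τ σ) : IsWeakJoin σ τ σ :=
  ⟨WeakLE.rfl', h, fun _ h _ => h⟩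

theorem isWeakMeet_of_le (h : WeakLE σ τ) : IsWeakMeet σ τ σ :=
  ⟨WeakLE.rfl', h, fun _ h _ => h⟩

theorem isWeakMeet_of_ge (h : WeakLE τ σ) : IsWeakMeet σ τ τ :=
  ⟨h, WeakLE.rfl', fun _ _ h => h⟩

variable {r : Setoid (Equiv.Perm (Fin n))}

/-- The two covers are perspective: j and the lower element of the cover at σ have as meet the lower
element of the cover at j, and as join σ itself. -/
theorem rel_swap_iff_of_joinIrred (hr : IsLatticeCongruence r) (hac : a < c)
    {j : Equiv.Perm (Fin n)} (hle : WeakLE j σ) (hj : Next j c a) (hn : Next σ c a) :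
    r σ (Equiv.swap c a * σ) ↔ r j (Equiv.swap c a * j) := by
  have h1 := swap_weakLE hac hn
  have h2 := swap_weakLE hac hj
  constructor
  · intro h
    refine hr.meet σ _ j j _ _ h (r.refl' _) (isWeakMeet_of_ge hle)
      ⟨weakLE_swap hn (h2.trans' hle) (not_bef_swap hj), h2, fun w hw hw' => ?_⟩
    exact weakLE_swap hj hw' fun hb => not_bef_swap hn (hw a c hac hb)
  · intro h
    refine hr.join j _ (Equiv.swap c a * σ) _ _ _ h (r.refl' _) ⟨hle, h1, fun w hw hw' => ?_⟩
      (isWeakJoin_of_le (weakLE_swap hn (h2.trans' hle) (not_bef_swap hj)))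
    intro u v huv hb
    by_cases he : v = c ∧ u = a
    · obtain ⟨rfl, rfl⟩ := he
      exact hw u v hac hj.1
    · exact hw' u v huv ((bef_swap hn).2 (Or.inr ⟨hb, he⟩))

/-! ### Contraction of covers in terms of arcs -/

/-- The arcs of the cover relations that are contracted by `r`. -/
def Contracted (r : Setoid (Equiv.Perm (Fin n))) (α : RawArc) : Prop :=
  ∃ σ a c, a < c ∧ Next σ c a ∧ α = valArc σ a c ∧ r σ (Equiv.swap c a * σ)

/-- Covers with the same arc lie above the same join irreducible, so they are contracted together.
-/
theorem contracted_valArc (hr : IsLatticeCongruence r) (hac : a < c) (hn : Next σ c a) :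
    Contracted r (valArc σ a c) ↔ r σ (Equiv.swap c a * σ) := by
  refine ⟨?_, fun h => ⟨σ, a, c, hac, hn, rfl, h⟩⟩
  rintro ⟨τ, b, d, hbd, hn', he, h⟩
  obtain rfl : a = b := Fin.ext (by simpa [valArc] using congrArg RawArc.left he)
  obtain rfl : c = d := Fin.ext (by simpa [valArc] using congrArg RawArc.right he)
  obtain ⟨j, h1, h2, -⟩ := exists_joinIrred σ hac
  rw [rel_swap_iff_of_joinIrred hr hac ((h1 _).2 (he ▸ arcLE_of_next hn')) h2 hn'] at h
  exact (rel_swap_iff_of_joinIrred hr hac ((h1 _).2 (arcLE_of_next hn)) h2 hn).2 h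

/-- If j is not below some equivalent τ, then the meet of both is equivalent to j and strictly below
it. It is then below the only lower cover of j, which is therefore equivalent to j too, so the arc
is contracted. -/
theorem mem_uncontractedArcs (hr : IsLatticeCongruence r) (hac : a < c) (hn : Next σ c a) :
    valArc σ a c ∈ uncontractedArcs r ↔ ¬ Contracted r (valArc σ a c) := by
  constructor
  · rintro ⟨τ, hτ, hmin⟩ hc
    have hmem : valArc σ a c ∈ descentArcs τ := by simp [hτ]
    obtain ⟨b, d, hbd, hn', he⟩ := mem_descentArcs.1 hmem
    rw [he, contracted_valArc hr hbd hn'] at hc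
    exact not_bef_swap hn' (hmin _ hc b d hbd hn'.1)
  · intro hc
    obtain ⟨j, h1, h2, h3, h4⟩ := exists_joinIrred σ hac
    refine ⟨j, ?_, fun τ hτ => ?_⟩
    · ext α
      rw [mem_descentArcs, Set.mem_singleton_iff, ← h3]
      constructor
      · rintro ⟨b, d, hbd, hn', rfl⟩
        obtain ⟨rfl, rfl⟩ := h4 b d hbd hn'
        rfl
      · rintro rfl
        exact ⟨a, c, hac, h2, rfl⟩
    · obtain ⟨m, hm⟩ := exists_isWeakMeet j τ
      rcases eq_or_ne m j with rfl | hne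
      · exact hm.2.1
      · exfalso
        obtain ⟨b, d, hbd, hn', hb⟩ := exists_descent_of_weakLE hm.1 hne
        obtain ⟨rfl, rfl⟩ := h4 b d hbd hn'
        have hmj : r j m := hr.meet j j j τ j m (r.refl' _) hτ (isWeakMeet_of_le WeakLE.rfl') hm
        have hms := weakLE_swap h2 hm.1 hb.asymm
        have hsm : r (Equiv.swap d b * j) m := hr.meet j m (Equiv.swap d b * j) _ _ _ hmj
          (r.refl' _) (isWeakMeet_of_ge (swap_weakLE hac h2)) (isWeakMeet_of_le hms)
        refine hc ?_
        rw [← h3, contracted_valArc hr hac h2]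
        exact r.trans' hmj (r.symm' hsm)

theorem bef_swap_up {w : Equiv.Perm (Fin n)} {p q : Fin n} (hpq : p < q) (hn : Next w p q)
    {x y : Fin n} (hyx : y < x) :
    Bef (Equiv.swap p q * w) x y ↔ Bef w x y ∨ (x = q ∧ y = p) := by
  rw [bef_swap hn]
  constructor
  · rintro (h | ⟨h, -⟩)
    · exact Or.inr h
    · exact Or.inl h
  · rintro (h | h)
    · refine Or.inr ⟨h, ?_⟩
      rintro ⟨rfl, rfl⟩
      exact hyx.asymm hpq
    · exact Or.inl h

theorem next_swap_left {w : Equiv.Perm (Fin n)} {p q s : Fin n} (h1 : Next w p q)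
    (h2 : Next w q s) : Next (Equiv.swap p q * w) p s := by
  have hps := h1.1.trans h2.1
  refine ⟨(bef_swap h1).2 (Or.inr ⟨hps, fun h => h2.1.ne h.2.symm⟩), fun z hz hz' => ?_⟩
  rcases (bef_swap h1).1 hz with ⟨h, -⟩ | ⟨hz, hne⟩
  · exact h1.1.ne h
  rcases (bef_swap h1).1 hz' with ⟨-, h⟩ | ⟨hz', -⟩
  · exact hps.ne h.symm
  rcases eq_or_ne z q with rfl | hzq
  · exact hne ⟨rfl, rfl⟩
  · exact h2.2 z (bef_of_not hzq.symm (h1.2 z hz)) hz'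

theorem next_swap_right {w : Equiv.Perm (Fin n)} {p q s : Fin n} (h1 : Next w p q)
    (h2 : Next w q s) : Next (Equiv.swap q s * w) p s := by
  have hps := h1.1.trans h2.1
  refine ⟨(bef_swap h2).2 (Or.inr ⟨hps, fun h => h1.1.ne h.1⟩), fun z hz hz' => ?_⟩
  rcases (bef_swap h2).1 hz with ⟨h, -⟩ | ⟨hz, -⟩
  · exact hps.ne h
  rcases (bef_swap h2).1 hz' with ⟨-, h⟩ | ⟨hz', hne⟩
  · exact h2.1.ne h.symm
  rcases eq_or_ne z q with rfl | hzq
  · exact hne ⟨rfl, rfl⟩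
  · exact h1.2 z hz (bef_of_not hzq fun hb => h2.2 z hb hz')

/-- In a hexagon of the weak order, contracting one of the two edges at the bottom contracts the
two edges on the sides. -/
theorem rel_hexagon (hr : IsLatticeCongruence r) {w : Equiv.Perm (Fin n)} {p q s : Fin n}
    (hpq : p < q) (hqs : q < s) (h1 : Next w p q) (h2 : Next w q s)
    (h : r (Equiv.swap p q * w) w ∨ r (Equiv.swap q s * w) w) :
    r (Equiv.swap p q * w) (Equiv.swap p s * (Equiv.swap p q * w)) ∧
      r (Equiv.swap q s * w) (Equiv.swap p s * (Equiv.swap q s * w)) := by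
  have hps := hpq.trans hqs
  set A := Equiv.swap p q * w with hA
  set C := Equiv.swap q s * w with hC
  have hA1 : Next A p s := next_swap_left h1 h2
  have hC1 : Next C p s := next_swap_right h1 h2
  set B := Equiv.swap p s * A with hB
  set D := Equiv.swap p s * C with hD
  have hB1 : Next B q s := next_swap_right h1.swap hA1
  set T := Equiv.swap q s * B with hT
  have bA : ∀ x y, y < x → (Bef A x y ↔ Bef w x y ∨ (x = q ∧ y = p)) := fun x y hyx =>
    bef_swap_up hpq h1 hyx
  have bC : ∀ x y, y < x → (Bef C x y ↔ Bef w x y ∨ (x = s ∧ y = q)) := fun x y hyx =>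
    bef_swap_up hqs h2 hyx
  have bB : ∀ x y, y < x → (Bef B x y ↔ (Bef w x y ∨ (x = q ∧ y = p)) ∨ (x = s ∧ y = p)) :=
    fun x y hyx => by rw [bef_swap_up hps hA1 hyx, bA x y hyx]
  have bD : ∀ x y, y < x → (Bef D x y ↔ (Bef w x y ∨ (x = s ∧ y = q)) ∨ (x = s ∧ y = p)) :=
    fun x y hyx => by rw [bef_swap_up hps hC1 hyx, bC x y hyx]
  have bT : ∀ x y, y < x → (Bef T x y ↔
      ((Bef w x y ∨ (x = q ∧ y = p)) ∨ (x = s ∧ y = p)) ∨ (x = s ∧ y = q)) :=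
    fun x y hyx => by rw [bef_swap_up hqs hB1 hyx, bB x y hyx]
  have wA : WeakLE w A := fun y x hyx hb => (bA x y hyx).2 (Or.inl hb)
  have wC : WeakLE w C := fun y x hyx hb => (bC x y hyx).2 (Or.inl hb)
  have wB : WeakLE w B := fun y x hyx hb => (bB x y hyx).2 (Or.inl (Or.inl hb))
  have wD : WeakLE w D := fun y x hyx hb => (bD x y hyx).2 (Or.inl (Or.inl hb))
  have AB : WeakLE A B := fun y x hyx hb => (bB x y hyx).2 (Or.inl ((bA x y hyx).1 hb))
  have CD : WeakLE C D := fun y x hyx hb => (bD x y hyx).2 (Or.inl ((bC x y hyx).1 hb))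
  have BT : WeakLE B T := fun y x hyx hb => (bT x y hyx).2 (Or.inl ((bB x y hyx).1 hb))
  have DT : WeakLE D T := fun y x hyx hb => (bT x y hyx).2 (by
    have := (bD x y hyx).1 hb
    tauto)
  have joinT : IsWeakJoin A C T := by
    refine ⟨AB.trans' BT, CD.trans' DT, fun u hu hu' y x hyx hb => ?_⟩
    have e1 : Bef u q p := hu p q hpq h1.swap.1
    have e2 : Bef u s q := hu' q s hqs h2.swap.1
    rcases (bT x y hyx).1 hb with ((hb | ⟨rfl, rfl⟩) | ⟨rfl, rfl⟩) | ⟨rfl, rfl⟩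
    · exact hu y x hyx ((bA x y hyx).2 (Or.inl hb))
    · exact e1
    · exact e2.trans e1
    · exact e2
  have meetw : IsWeakMeet B D w := by
    refine ⟨wB, wD, fun u hu hu' y x hyx hb => ?_⟩
    have e1 : ¬ Bef u q p := fun hc => by
      rcases (bD q p hpq).1 (hu' p q hpq hc) with (h | ⟨h, -⟩) | ⟨h, -⟩
      · exact h.asymm h1.1
      · exact hqs.ne h
      · exact hqs.ne h
    have e2 : ¬ Bef u s q := fun hc => by
      rcases (bB s q hqs).1 (hu q s hqs hc) with (h | ⟨h, -⟩) | ⟨-, h⟩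
      · exact h.asymm h2.1
      · exact hqs.ne' h
      · exact hpq.ne' h
    rcases (bB x y hyx).1 (hu y x hyx hb) with (h | ⟨rfl, rfl⟩) | ⟨rfl, rfl⟩
    · exact h
    · exact absurd hb e1
    · exact absurd (Bef.trans hb (bef_of_not hpq.ne e1)) e2
  have joinT' : IsWeakJoin C A T := ⟨joinT.2.1, joinT.1, fun u h h' => joinT.2.2 u h' h⟩
  have meetw' : IsWeakMeet D B w := ⟨meetw.2.1, meetw.1, fun u h h' => meetw.2.2 u h' h⟩
  -- a chain `w < X < Y < T` and the opposite chain `w < X' < Y' < T`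
  have key : ∀ X Y X' Y' : Equiv.Perm (Fin n), WeakLE w X → WeakLE X Y → WeakLE Y T →
      WeakLE w X' → WeakLE X' Y' → WeakLE Y' T → IsWeakJoin X X' T → IsWeakMeet Y Y' w →
      r X w → r X Y ∧ r X' Y' := by
    intro X Y X' Y' wX XY YT wX' XY' YT' hj hm h
    -- Joining X ~ w with X' makes X' and T equivalent, hence also Y', which lies between them.
    -- Meeting T ~ Y' with Y then makes Y equivalent to w, and joining with X gives Y ~ X.
    have e1 : r T X' := hr.join X w X' X' _ _ h (r.refl' _) hj (isWeakJoin_of_le wX')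
    have e2 : r Y' X' := hr.meet T X' Y' Y' _ _ e1 (r.refl' _) (isWeakMeet_of_ge YT')
      (isWeakMeet_of_le XY')
    have e3 : r T Y' := r.trans' e1 (r.symm' e2)
    have e4 : r Y w := hr.meet Y Y T Y' _ _ (r.refl' _) e3 (isWeakMeet_of_le YT) hm
    have e5 : r Y X := hr.join Y w X X _ _ e4 (r.refl' _) (isWeakJoin_of_ge XY)
      (isWeakJoin_of_le wX)
    exact ⟨r.symm' e5, r.symm' e2⟩
  rcases h with h | h
  · exact key A B C D wA AB BT wC CD DT joinT meetw h
  · exact (key C D A B wC CD DT wA AB BT joinT' meetw' h).symm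

theorem exists_valArc {α : RawArc} (h : IsArc n α) :
    ∃ (σ : Equiv.Perm (Fin n)) (a c : Fin n), a < c ∧ Next σ c a ∧ α = valArc σ a c := by
  obtain ⟨h1, h2, h3, h4⟩ := h
  let a : Fin n := ⟨α.left - 1, by omega⟩
  let c : Fin n := ⟨α.right - 1, by omega⟩
  have ha : (a : ℕ) + 1 = α.left := by simp only [a]; omega
  have hc : (c : ℕ) + 1 = α.right := by simp only [c]; omega
  have hac : a < c := by
    rw [Fin.lt_def]
    omega
  -- The word lists first the values in the set of the arc, then c and a, and finally all other
  -- values.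
  obtain ⟨σ, hσ⟩ := exists_perm_of_key (fun z : Fin n =>
    if z = c then n else if z = a then n + 1 else if (z : ℕ) + 1 ∈ α.above then z else n + 2 + z)
    (by
      intro x y hxy
      have := x.isLt
      have := y.isLt
      simp only at hxy
      ext
      split_ifs at hxy <;> omega)
  have hn : Next σ c a := by
    refine ⟨(hσ _ _).2 (by simp [hac.ne]), fun z hz hz' => ?_⟩
    rw [hσ] at hz hz'
    have := z.isLt
    simp only [hac.ne, if_true, if_false] at hz hz'
    split_ifs at hz hz' <;> omega
  refine ⟨σ, a, c, hac, hn, RawArc.ext ha.symm hc.symm (Finset.ext fun x => ?_)⟩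
  have key : ∀ z : Fin n, a < z → z < c → (Bef σ z c ↔ (z : ℕ) + 1 ∈ α.above) := by
    intro z hz hz'
    have := z.isLt
    rw [hσ]
    simp only [hz.ne', hz'.ne, if_true, if_false]
    split_ifs with h
    · simp [h]
    · simp only [h, iff_false]
      omega
  rw [mem_valArc_above]
  constructor
  · intro hx
    have hx' := Finset.mem_Ioo.1 (h4 hx)
    obtain ⟨w, rfl⟩ : ∃ w : Fin n, (w : ℕ) + 1 = x := ⟨⟨x - 1, by omega⟩, by simp only; omega⟩
    have h1 : a < w := Fin.lt_def.2 (by omega)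
    have h2 : w < c := Fin.lt_def.2 (by omega)
    exact ⟨w, ⟨(key w h1 h2).2 hx, h1, h2⟩, rfl⟩
  · rintro ⟨z, ⟨h1, h2, h3⟩, rfl⟩
    exact (key z h2 h3).1 h1

/-- The word that lists the values standing before c in τ, then a b c, then the rest is the bottom
of a hexagon. Its two bottom edges have the two restricted arcs. Its two side edges have arcs from a
to c that differ only at b, so one of them is the given arc. -/
theorem contracted_of_restrict (hr : IsLatticeCongruence r) {b : Fin n} (hab : a < b) (hbc : b < c)
    (h : Contracted r ((valArc τ a c).restrict ((a : ℕ) + 1) ((b : ℕ) + 1)) ∨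
      Contracted r ((valArc τ a c).restrict ((b : ℕ) + 1) ((c : ℕ) + 1))) :
    Contracted r (valArc τ a c) := by
  have hac := hab.trans hbc
  -- The cases for a, b and c are tested first, so whether τ has a or b before c does not influence
  -- their keys.
  obtain ⟨w, hw⟩ := exists_perm_of_key (fun z : Fin n =>
    if z = a then n else if z = b then n + 1 else if z = c then n + 2 else
      if Bef τ z c then z else n + 3 + z)
    (by
      intro x y hxy
      have := x.isLt
      have := y.isLt
      simp only at hxy
      ext
      split_ifs at hxy <;> omega)
  have h1 : Next w a b := by
    refine ⟨(hw _ _).2 (by simp [hab.ne']), fun z hz hz' => ?_⟩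
    rw [hw] at hz hz'
    have := z.isLt
    simp only [hab.ne', if_true, if_false] at hz hz'
    split_ifs at hz hz' <;> omega
  have h2 : Next w b c := by
    refine ⟨(hw _ _).2 (by simp [hab.ne', hbc.ne', hac.ne']), fun z hz hz' => ?_⟩
    rw [hw] at hz hz'
    have := z.isLt
    simp only [hab.ne', hbc.ne', hac.ne', if_true, if_false] at hz hz'
    split_ifs at hz hz' <;> omega
  have other : ∀ z d, z ≠ a → z ≠ b → z ≠ c → (d = a ∨ d = b ∨ d = c) →
      (Bef w z d ↔ Bef τ z c) := by
    intro z d ha hb hc hd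
    rw [hw]
    have := z.isLt
    have hd' : n ≤ (if d = a then n else if d = b then n + 1 else if d = c then n + 2 else
        if Bef τ d c then (d : ℕ) else n + 3 + d) ∧ (if d = a then n else if d = b then n + 1 else
        if d = c then n + 2 else if Bef τ d c then (d : ℕ) else n + 3 + d) ≤ n + 2 := by
      split_ifs <;> omega
    simp only [ha, hb, hc, if_false]
    by_cases h : Bef τ z c
    · simp only [h, if_true, iff_true]
      omega
    · simp only [h, if_false, iff_false]
      omega
  have hA := next_swap_left h1 h2
  have hC := next_swap_right h1 h2
  have eA : ∀ z d, z ≠ a → z ≠ b → (Bef (Equiv.swap a b * w) z d ↔ Bef w z d) :=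
    fun z d ha hb => bef_swap_of_ne h1 (fun h => ha h.1) (fun h => hb h.1)
  have eC : ∀ z d, z ≠ b → z ≠ c → (Bef (Equiv.swap b c * w) z d ↔ Bef w z d) :=
    fun z d ha hb => bef_swap_of_ne h2 (fun h => ha h.1) (fun h => hb h.1)
  have hside := rel_hexagon hr hab hbc h1 h2 (h.imp (fun h => ?_) fun h => ?_)
  · by_cases hb : Bef τ b c
    · have e : valArc τ a c =
          valArc (Equiv.swap a c * (Equiv.swap a b * w)) a c := by
        refine valArc_congr fun z hz hz' => ?_
        rw [bef_swap_of_ne hA (fun h => hz.ne' h.1) (fun h => hz'.ne h.1)]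
        rcases eq_or_ne z b with rfl | hzb
        · rw [bef_swap_of_ne h1 (fun h => hz.ne' h.1) (fun h => hac.ne' h.2)]
          exact iff_of_true hb h2.1
        · rw [eA z c hz.ne' hzb, other z c hz.ne' hzb hz'.ne (by tauto)]
      rw [e, contracted_valArc hr hac hA.swap, swap_swap_mul]
      exact r.symm' hside.1
    · have e : valArc τ a c =
          valArc (Equiv.swap a c * (Equiv.swap b c * w)) a c := by
        refine valArc_congr fun z hz hz' => ?_
        rw [bef_swap_of_ne hC (fun h => hz.ne' h.1) (fun h => hz'.ne h.1)]
        rcases eq_or_ne z b with rfl | hzb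
        · exact iff_of_false hb h2.swap.1.asymm
        · rw [eC z c hzb hz'.ne, other z c hz.ne' hzb hz'.ne (by tauto)]
      rw [e, contracted_valArc hr hac hC.swap, swap_swap_mul]
      exact r.symm' hside.2
  · rw [valArc_restrict (τ := Equiv.swap a b * w) (b := a) (d := b) le_rfl hbc.le,
      contracted_valArc hr hab h1.swap, swap_swap_mul] at h
    · exact h
    · intro z hz hz'
      rw [eA z b hz.ne' hz'.ne, other z b hz.ne' hz'.ne (hz'.trans hbc).ne (by tauto)]
  · rw [valArc_restrict (τ := Equiv.swap b c * w) (b := b) (d := c) hab.le le_rfl,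
      contracted_valArc hr hbc h2.swap, swap_swap_mul] at h
    · exact h
    · intro z hz hz'
      rw [eC z c hz.ne' hz'.ne, other z c (hab.trans hz).ne' hz.ne' hz'.ne (by tauto)]

theorem IsArc.restrict {α : RawArc} (h : IsArc n α) {b c : ℕ} (hb : α.left ≤ b) (hbc : b < c)
    (hc : c ≤ α.right) : IsArc n (α.restrict b c) :=
  ⟨h.1.trans hb, hbc, hc.trans h.2.2.1, Finset.inter_subset_right⟩

theorem RawArc.restrict_restrict {α : RawArc} {b c d e : ℕ} (hb : b ≤ d) (hc : e ≤ c) :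
    (α.restrict b c).restrict d e = α.restrict d e := by
  ext x
  · rfl
  · rfl
  · simp only [RawArc.restrict, Finset.mem_inter, Finset.mem_Ioo]
    constructor
    · rintro ⟨⟨h1, -⟩, h2⟩
      exact ⟨h1, h2⟩
    · rintro ⟨h1, h2⟩
      exact ⟨⟨h1, by omega⟩, h2⟩

theorem RawArc.restrict_self {α : RawArc} (h : α.above ⊆ Finset.Ioo α.left α.right) :
    α.restrict α.left α.right = α := by
  ext x
  · rfl
  · rfl
  · simp only [RawArc.restrict, Finset.mem_inter]
    exact ⟨fun hx => hx.1, fun hx => ⟨hx, h hx⟩⟩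

/-- A restriction is made of at most two cuts that each keep one end of the arc. -/
theorem Contracted.of_restrict (hr : IsLatticeCongruence r) {α : RawArc} (hα : IsArc n α)
    {b c : ℕ} (hb : α.left ≤ b) (hbc : b < c) (hc : c ≤ α.right)
    (h : Contracted r (α.restrict b c)) : Contracted r α := by
  have step : ∀ α : RawArc, IsArc n α → ∀ x, α.left < x → x < α.right →
      (Contracted r (α.restrict α.left x) ∨ Contracted r (α.restrict x α.right)) →
      Contracted r α := by
    intro α hα x h1 h2 h
    obtain ⟨τ, a, c, -, -, rfl⟩ := exists_valArc hα
    have hc := c.isLt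
    simp only [valArc] at h1 h2
    obtain ⟨w, rfl⟩ : ∃ w : Fin n, (w : ℕ) + 1 = x := ⟨⟨x - 1, by omega⟩, by simp only; omega⟩
    exact contracted_of_restrict hr (Fin.lt_def.2 (by omega)) (Fin.lt_def.2 (by omega)) h
  have h1 : Contracted r (α.restrict α.left c) := by
    rcases hb.eq_or_lt with rfl | hlt
    · exact h
    · refine step _ (hα.restrict le_rfl (hb.trans_lt hbc) hc) b hlt hbc (Or.inr ?_)
      change Contracted r ((α.restrict α.left c).restrict b c)
      rwa [RawArc.restrict_restrict hb le_rfl]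
  rcases hc.eq_or_lt with rfl | hlt
  · rwa [RawArc.restrict_self hα.2.2.2] at h1
  · exact step α hα c (hb.trans_lt hbc) hlt (Or.inl h1)

/-- The extended arc ideal of the uncontracted arcs of a lattice congruence. -/
def congruenceIdeal (hr : IsLatticeCongruence r) : ExtArcIdeal n where
  carrier := {α | IsArc n α ∧ ¬ Contracted r α}
  isExtArc _ h := ⟨h.1.2.1, h.1.2.2.1.trans (Nat.le_succ n), h.1.2.2.2⟩
  closed _ h _ _ hb hbc hc :=
    ⟨h.1.restrict hb hbc hc, fun h' => h.2 (h'.of_restrict hr h.1 hb hbc hc)⟩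

theorem congruenceIdeal_strict (hr : IsLatticeCongruence r) :
    (congruenceIdeal hr).strict.carrier = uncontractedArcs r := by
  ext α
  constructor
  · rintro ⟨⟨h1, h2⟩, -⟩
    obtain ⟨τ, a, c, hac, hn, rfl⟩ := exists_valArc h1
    exact (mem_uncontractedArcs hr hac hn).2 h2
  · intro h
    obtain ⟨τ, hτ, -⟩ := id h
    have hmem : α ∈ descentArcs τ := by simp [hτ]
    obtain ⟨a, c, hac, hn, rfl⟩ := mem_descentArcs.1 hmem
    have h1 := valArc_isArc (σ := τ) hac
    exact ⟨⟨h1, (mem_uncontractedArcs hr hac hn).1 h⟩, h1.1, h1.2.2.1⟩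

/-- Equivalent permutations are both equivalent to their meet m. Going down from either of them to m
by exchanging descents that are not inversions of m stays in the class, so each exchanged arc is
contracted. -/
theorem rel_iff_arcSetoid (hr : IsLatticeCongruence r) :
    r σ τ ↔ arcSetoid (congruenceIdeal hr).strict.carrier σ τ := by
  rw [congruenceIdeal_strict]
  have down : ∀ d : ℕ, ∀ x m : Equiv.Perm (Fin n), (disagree x m).card = d → WeakLE m x →
      r m x → arcSetoid (uncontractedArcs r) x m := by
    intro d
    induction d using Nat.strong_induction_on with
    | _ d ih =>
      intro x m hd hle hm
      rcases eq_or_ne m x with rfl | hne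
      · exact Setoid.refl' _ _
      · obtain ⟨a, c, hac, hn, hb⟩ := exists_descent_of_weakLE hle hne
        have hle' := weakLE_swap hn hle hb.asymm
        have hm' : r m (Equiv.swap c a * x) := hr.meet m x _ _ _ _ hm (r.refl' _)
          (isWeakMeet_of_le hle') (isWeakMeet_of_ge (swap_weakLE hac hn))
        refine Setoid.trans' _ (arcSetoid_of_step ⟨a, c, hac, hn, ?_, rfl⟩)
          (ih _ (hd ▸ card_disagree_swap hn hb) _ m rfl hle' hm')
        rw [mem_uncontractedArcs hr hac hn, not_not, contracted_valArc hr hac hn]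
        exact r.trans' (r.symm' hm) hm'
  constructor
  · intro h
    obtain ⟨m, hm⟩ := exists_isWeakMeet σ τ
    have h1 : r σ m := hr.meet σ σ σ τ _ _ (r.refl' _) h (isWeakMeet_of_le WeakLE.rfl') hm
    exact Setoid.trans' _ (down _ _ _ rfl hm.1 (r.symm' h1))
      (Setoid.symm' _ (down _ _ _ rfl hm.2.1 (r.symm' (r.trans' (r.symm' h) h1))))
  · intro h
    induction h with
    | rel _ _ h =>
      obtain ⟨a, c, hac, hn, hα, rfl⟩ := h
      rwa [mem_uncontractedArcs hr hac hn, not_not, contracted_valArc hr hac hn] at hα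
    | refl _ => exact r.refl' _
    | symm _ _ _ ih => exact r.symm' ih
    | trans _ _ _ _ _ ih ih' => exact r.trans' ih ih'

theorem rel_iff_eta (hr : IsLatticeCongruence r) :
    r σ τ ↔ eta (congruenceIdeal hr).strict σ = eta (congruenceIdeal hr).strict τ := by
  rw [eta_eq_iff, rel_iff_arcSetoid hr]

end FromCongruences

/-! ### The Hopf algebra of decorated permutations -/

theorem orderEmb_fin_eq {q p : ℕ} {R S : Fin q ↪o Fin p} (h : Set.range R = Set.range S) :
    R = S := OrderEmbedding.range_inj.1 h

section Words

theorem stdVal_self {n : ℕ} (σ : Equiv.Perm (Fin n)) (R : Fin n ↪o Fin n) : stdVal σ R = σ := by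
  have hR : ∀ i, R i = i := fun i => by
    have : Set.range R = Set.range (RelEmbedding.refl (· ≤ · : Fin n → Fin n → Prop)) := by
      rw [(Finite.injective_iff_surjective.1 R.injective).range_eq]
      exact Set.range_id.symm
    rw [orderEmb_fin_eq (S := RelEmbedding.refl _) this]
    rfl
  exact perm_ext_bef fun x y h => by rwa [bef_stdVal, hR, hR] at h

variable {p q s : ℕ}

/-- A word in which all values of R precede all values of S is determined by its two restrictions;
`exists_glue` provides it for any two restrictions. Cutting and gluing are the bijections behind all
statements about the coproduct. -/
theorem glue_ext {R : Fin q ↪o Fin p} {S : Fin s ↪o Fin p}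
    (hRS : ∀ x, x ∈ Set.range R ∨ x ∈ Set.range S) {ρ π : Equiv.Perm (Fin p)}
    (hρ : ∀ i j, Bef ρ (R i) (S j)) (hπ : ∀ i j, Bef π (R i) (S j))
    (hR : stdVal ρ R = stdVal π R) (hS : stdVal ρ S = stdVal π S) : ρ = π := by
  refine perm_ext_bef fun x y h => ?_
  rcases hRS x with ⟨i, rfl⟩ | ⟨i, rfl⟩ <;> rcases hRS y with ⟨j, rfl⟩ | ⟨j, rfl⟩
  · rwa [← bef_stdVal, hR, bef_stdVal] at h
  · exact hπ i j
  · exact absurd h (hρ j i).asymm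
  · rwa [← bef_stdVal, hS, bef_stdVal] at h

theorem exists_glue {R : Fin q ↪o Fin p} {S : Fin s ↪o Fin p}
    (hRS : ∀ x, x ∈ Set.range R ∨ x ∈ Set.range S) (hd : ∀ i j, R i ≠ S j)
    (σ : Equiv.Perm (Fin q)) (τ : Equiv.Perm (Fin s)) :
    ∃ ρ : Equiv.Perm (Fin p), (∀ i j, Bef ρ (R i) (S j)) ∧ stdVal ρ R = σ ∧ stdVal ρ S = τ := by
  have hex : ∀ x, ∃ u : Fin q ⊕ Fin s, Sum.elim R S u = x := fun x => by
    rcases hRS x with ⟨i, hi⟩ | ⟨j, hj⟩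
    · exact ⟨Sum.inl i, hi⟩
    · exact ⟨Sum.inr j, hj⟩
  have hinj : Function.Injective (Sum.elim R S) := R.injective.sumElim S.injective hd
  choose g hg using hex
  have gR : ∀ i, g (R i) = Sum.inl i := fun i => hinj (hg _)
  have gS : ∀ j, g (S j) = Sum.inr j := fun j => hinj (hg _)
  -- The keys of the second block are shifted by q, the length of the first.
  obtain ⟨ρ, hρ⟩ := exists_perm_of_key
    (fun x => Sum.elim (fun i => (σ⁻¹ i : ℕ)) (fun j => q + (τ⁻¹ j : ℕ)) (g x)) (by
      refine Function.Injective.comp (g := Sum.elim _ _) ?_ (Function.LeftInverse.injective hg)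
      refine Function.Injective.sumElim ?_ ?_ ?_
      · exact fun i j h => σ⁻¹.injective (Fin.ext h)
      · exact fun i j h => τ⁻¹.injective (Fin.ext (by simpa using h))
      · intro i j
        have := (σ⁻¹ i).isLt
        omega)
  refine ⟨ρ, fun i j => ?_, perm_ext_bef fun i j h => ?_, perm_ext_bef fun i j h => ?_⟩
  · rw [hρ, gR, gS]
    have := (σ⁻¹ i).isLt
    simp only [Sum.elim_inl, Sum.elim_inr]
    omega
  · rw [bef_stdVal, hρ, gR, gR] at h
    exact h
  · rw [bef_stdVal, hρ, gS, gS] at h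
    exact Nat.add_lt_add_iff_left.1 h

/-- The subsets of `A` that stand before the rest of `A` in the word of `ρ`. -/
def prefixes (ρ : Equiv.Perm (Fin p)) (A : Finset (Fin p)) : Finset (Finset (Fin p)) :=
  A.powerset.filter fun B => ∀ x ∈ B, ∀ y ∈ A \ B, Bef ρ x y

theorem mem_prefixes {ρ : Equiv.Perm (Fin p)} {A B : Finset (Fin p)} :
    B ∈ prefixes ρ A ↔ B ⊆ A ∧ ∀ x ∈ B, ∀ y ∈ A, y ∉ B → Bef ρ x y := by
  simp [prefixes]

/-- The increasing enumeration of a set of values. -/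
def enum (A : Finset (Fin p)) : Fin A.card ↪o Fin p := A.orderEmbOfFin rfl

theorem range_enum (A : Finset (Fin p)) : Set.range (enum A) = A := Finset.range_orderEmbOfFin _ _

theorem mem_range_enum {A : Finset (Fin p)} {x : Fin p} : x ∈ Set.range (enum A) ↔ x ∈ A := by
  rw [range_enum, Finset.mem_coe]

theorem enum_mem (A : Finset (Fin p)) (i : Fin A.card) : enum A i ∈ A :=
  Finset.orderEmbOfFin_mem _ _ i

end Words

/-- Decoration sets in which the empty decoration is neutral and selecting everything does not
change a decoration. -/
structure IsUnitalDecorationSet (𝔛 : DecorationData) : Prop extends IsDecorationSet 𝔛 where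
  empty_concat : ∀ {n : ℕ} (x : 𝔛.X n),
    (⟨_, 𝔛.concat 𝔛.empty x⟩ : Σ n, 𝔛.X n) = ⟨n, x⟩
  concat_empty : ∀ {n : ℕ} (x : 𝔛.X n), 𝔛.concat x 𝔛.empty = x
  select_self : ∀ {n : ℕ} (x : 𝔛.X n) (R : Fin n ↪o Fin n), 𝔛.select x R = x

section Hopf

variable {k : Type*} [Field k] {𝔛 : DecorationData}

theorem decPerm_induction {P : (DecPerm 𝔛 →₀ k) → Prop} (hadd : ∀ v w, P v → P w → P (v + w))
    (hsmul : ∀ (c : k) v, P v → P (c • v))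
    (hF : ∀ (n : ℕ) (σ : Equiv.Perm (Fin n)) (x : 𝔛.X n), P (F k σ x)) (v : DecPerm 𝔛 →₀ k) :
    P v := by
  induction v using Finsupp.induction_linear with
  | zero => simpa using hsmul 0 _ (hF 0 1 𝔛.empty)
  | add v w hv hw => exact hadd v w hv hw
  | single a c => simpa [F] using hsmul c _ (hF a.1 a.2.1 a.2.2)

theorem counit_F {n : ℕ} (σ : Equiv.Perm (Fin n)) (x : 𝔛.X n) :
    (decPermAlgebra k 𝔛).counit (F k σ x) = if n = 0 then 1 else 0 := by
  simp [decPermAlgebra, F]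

theorem mul_F {m n : ℕ} (σ : Equiv.Perm (Fin m)) (x : 𝔛.X m) (τ : Equiv.Perm (Fin n))
    (y : 𝔛.X n) : (decPermAlgebra k 𝔛).mul (F k σ x) (F k τ y) =
      ∑ ρ ∈ shiftedShuffle σ τ, F k ρ (𝔛.concat x y) := by
  simp [decPermAlgebra, F]

/-- The basis vector of the restriction of `(ρ, z)` to the values enumerated by `R`. -/
noncomputable def FRes (k : Type*) [Field k] {𝔛 : DecorationData} {p q : ℕ}
    (ρ : Equiv.Perm (Fin p)) (z : 𝔛.X p) (R : Fin q ↪o Fin p) : DecPerm 𝔛 →₀ k :=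
  F k (stdVal ρ R) (𝔛.select z R)

/-- The basis vector of the restriction of `(ρ, z)` to a set of values. -/
noncomputable def FSub (k : Type*) [Field k] {𝔛 : DecorationData} {p : ℕ}
    (ρ : Equiv.Perm (Fin p)) (z : 𝔛.X p) (A : Finset (Fin p)) : DecPerm 𝔛 →₀ k :=
  FRes k ρ z (enum A)

theorem FRes_congr {p q s : ℕ} (ρ : Equiv.Perm (Fin p)) (z : 𝔛.X p) {R : Fin q ↪o Fin p}
    {S : Fin s ↪o Fin p} (h : Set.range R = Set.range S) : FRes k ρ z R = FRes k ρ z S := by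
  obtain rfl : q = s := by
    have := congrArg Set.ncard h
    rwa [← Set.image_univ, ← Set.image_univ, Set.ncard_image_of_injective _ R.injective,
      Set.ncard_image_of_injective _ S.injective, Set.ncard_univ, Set.ncard_univ, Nat.card_fin,
      Nat.card_fin] at this
  rw [orderEmb_fin_eq h]

theorem FRes_eq_FSub {p q : ℕ} (ρ : Equiv.Perm (Fin p)) (z : 𝔛.X p) {R : Fin q ↪o Fin p}
    {A : Finset (Fin p)} (h : ∀ x, x ∈ Set.range R ↔ x ∈ A) : FRes k ρ z R = FSub k ρ z A :=
  FRes_congr ρ z (by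
    ext x
    rw [h, mem_range_enum])

theorem firstEmb_val {p : ℕ} (i : Fin (p + 1)) (j : Fin (i : ℕ)) : (firstEmb i j : ℕ) = j := rfl

theorem lastEmb_val {p : ℕ} (i : Fin (p + 1)) (j : Fin (p - (i : ℕ))) :
    (lastEmb i j : ℕ) = i + j := rfl

/-- A cut of the word is recorded by the set of the values before it. In this form the coproduct
does not refer to positions. -/
theorem comul_F {p : ℕ} (ρ : Equiv.Perm (Fin p)) (z : 𝔛.X p) :
    (decPermAlgebra k 𝔛).comul (F k ρ z) =
      ∑ A ∈ prefixes ρ Finset.univ, FSub k ρ z A ⊗ₜ[k] FSub k ρ z (Finset.univ \ A) := by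
  have h1 : (decPermAlgebra k 𝔛).comul (F k ρ z) =
      ∑ i : Fin (p + 1), FStd k ρ z (firstEmb i) ⊗ₜ[k] FStd k ρ z (lastEmb i) := by
    simp [decPermAlgebra, F]
  have h2 : ∀ {q : ℕ} (R : Fin q ↪o Fin p), FStd k ρ z R = FRes k ρ z (valuesAt ρ R) :=
    fun R => by rw [FStd, FRes, stdPos_eq_stdVal]
  rw [h1]
  let A : Fin (p + 1) → Finset (Fin p) := fun i => Finset.univ.filter fun x => (ρ⁻¹ x : ℕ) < i
  have hA : ∀ i x, x ∈ A i ↔ (ρ⁻¹ x : ℕ) < i := fun i x => by simp [A]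
  refine Finset.sum_bij (fun i _ => A i) ?_ ?_ ?_ ?_
  · intro i _
    rw [mem_prefixes]
    refine ⟨Finset.subset_univ _, fun x hx y _ hy => ?_⟩
    rw [hA] at hx hy
    exact Fin.lt_def.2 (by omega)
  · intro i _ j _ hij
    have key : ∀ i j, A i = A j → ¬ i < j := fun i j hij hlt => by
      have hi : (i : ℕ) < p := by have := Fin.lt_def.1 hlt; omega
      have h1 := hA i (ρ ⟨i, hi⟩)
      rw [hij, hA] at h1
      simp at h1
      omega
    exact le_antisymm (not_lt.1 (key j i hij.symm)) (not_lt.1 (key i j hij))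
  · intro B hB
    rw [mem_prefixes] at hB
    -- The cut right after the last entry of B; the supremum is 0 if B is empty.
    refine ⟨⟨B.sup fun x => (ρ⁻¹ x : ℕ) + 1, Nat.lt_succ_of_le (Finset.sup_le fun x _ =>
      (ρ⁻¹ x).isLt)⟩, Finset.mem_univ _, ?_⟩
    ext x
    rw [hA, Finset.lt_sup_iff]
    constructor
    · rintro ⟨y, hy, hxy⟩
      by_contra hx
      have := Fin.lt_def.1 (hB.2 y hy x (Finset.mem_univ x) hx)
      omega
    · exact fun hx => ⟨x, hx, by omega⟩
  · intro i _
    rw [h2, h2, FRes_eq_FSub, FRes_eq_FSub]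
    · intro x
      rw [mem_range_valuesAt, Finset.mem_sdiff, hA]
      simp only [Finset.mem_univ, true_and, not_lt, Set.mem_range, Fin.ext_iff, lastEmb_val]
      have := (ρ⁻¹ x).isLt
      exact ⟨fun ⟨j, hj⟩ => by omega, fun h => ⟨⟨(ρ⁻¹ x : ℕ) - i, by omega⟩, by simp only; omega⟩⟩
    · intro x
      rw [mem_range_valuesAt, hA]
      simp only [Set.mem_range, Fin.ext_iff, firstEmb_val]
      exact ⟨fun ⟨j, hj⟩ => by omega, fun h => ⟨⟨(ρ⁻¹ x : ℕ), h⟩, rfl⟩⟩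

theorem FRes_FRes (h𝔛 : IsDecorationSet 𝔛) {p q s : ℕ} (ρ : Equiv.Perm (Fin p)) (z : 𝔛.X p)
    (R : Fin q ↪o Fin p) (S : Fin s ↪o Fin q) :
    FRes k (stdVal ρ R) (𝔛.select z R) S = FRes k ρ z (S.trans R) := by
  rw [FRes, FRes, stdVal_stdVal, h𝔛.select_select]

theorem FSub_FRes (h𝔛 : IsDecorationSet 𝔛) {p q : ℕ} (ρ : Equiv.Perm (Fin p)) (z : 𝔛.X p)
    (R : Fin q ↪o Fin p) (B : Finset (Fin q)) :
    FSub k (stdVal ρ R) (𝔛.select z R) B = FSub k ρ z (B.map R.toEmbedding) := by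
  rw [FSub, FRes_FRes h𝔛]
  refine FRes_eq_FSub _ _ fun x => ?_
  simp only [Set.mem_range, RelEmbedding.coe_trans, Function.comp_apply, Finset.mem_map,
    RelEmbedding.coe_toEmbedding]
  constructor
  · rintro ⟨i, rfl⟩
    exact ⟨_, enum_mem B i, rfl⟩
  · rintro ⟨y, hy, rfl⟩
    obtain ⟨i, rfl⟩ := mem_range_enum.2 hy
    exact ⟨i, rfl⟩

/-- The prefixes of a restricted word, carried back along the enumeration of A, are the subsets of A
that precede the rest of A in ρ itself. So iterated coproducts only involve subsets of one ground
set. -/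
theorem comul_FSub (h𝔛 : IsDecorationSet 𝔛) {p : ℕ} (ρ : Equiv.Perm (Fin p)) (z : 𝔛.X p)
    (A : Finset (Fin p)) : (decPermAlgebra k 𝔛).comul (FSub k ρ z A) =
      ∑ B ∈ prefixes ρ A, FSub k ρ z B ⊗ₜ[k] FSub k ρ z (A \ B) := by
  rw [FSub, FRes, comul_F]
  have hpre : ∀ B : Finset (Fin p), B ⊆ A →
      (Finset.univ.filter fun i => enum A i ∈ B).map (enum A).toEmbedding = B := by
    intro B hB
    ext x
    simp only [Finset.mem_map, Finset.mem_filter, Finset.mem_univ, true_and,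
      RelEmbedding.coe_toEmbedding]
    constructor
    · rintro ⟨i, hi, rfl⟩
      exact hi
    · intro hx
      obtain ⟨i, rfl⟩ := mem_range_enum.2 (hB hx)
      exact ⟨i, hx, rfl⟩
  refine Finset.sum_bij (fun B _ => B.map (enum A).toEmbedding) ?_ ?_ ?_ ?_
  · intro B hB
    rw [mem_prefixes] at hB ⊢
    refine ⟨fun x hx => ?_, fun x hx y hy hxy => ?_⟩
    · obtain ⟨i, -, rfl⟩ := Finset.mem_map.1 hx
      exact enum_mem A i
    · obtain ⟨i, hi, rfl⟩ := Finset.mem_map.1 hx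
      obtain ⟨j, rfl⟩ := mem_range_enum.2 hy
      refine bef_stdVal.1 (hB.2 i hi j (Finset.mem_univ j) fun hj => hxy ?_)
      exact Finset.mem_map_of_mem _ hj
  · intro B _ C _ h
    exact Finset.map_injective _ h
  · intro B hB
    rw [mem_prefixes] at hB
    refine ⟨Finset.univ.filter fun i => enum A i ∈ B, ?_, hpre B hB.1⟩
    rw [mem_prefixes]
    refine ⟨Finset.subset_univ _, fun i hi j _ hj => ?_⟩
    simp only [Finset.mem_filter, Finset.mem_univ, true_and] at hi hj
    exact bef_stdVal.2 (hB.2 _ hi _ (enum_mem A j) hj)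
  · intro B _
    rw [FSub_FRes h𝔛, FSub_FRes h𝔛]
    congr 2
    ext x
    simp only [Finset.mem_map, Finset.mem_sdiff, Finset.mem_univ, true_and,
      RelEmbedding.coe_toEmbedding]
    constructor
    · rintro ⟨i, hi, rfl⟩
      exact ⟨enum_mem A i, fun ⟨j, hj, hij⟩ => hi ((enum A).injective hij ▸ hj)⟩
    · rintro ⟨hx, hn⟩
      obtain ⟨i, rfl⟩ := mem_range_enum.2 hx
      exact ⟨i, fun hi => hn ⟨i, hi, rfl⟩, rfl⟩

theorem FSub_univ (h𝔛 : IsUnitalDecorationSet 𝔛) {p : ℕ} (ρ : Equiv.Perm (Fin p)) (z : 𝔛.X p) :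
    FSub k ρ z Finset.univ = F k ρ z := by
  rw [← FRes_eq_FSub (R := RelEmbedding.refl _) ρ z (fun x => by simp), FRes, stdVal_self,
    h𝔛.select_self]

theorem coassoc_F (h𝔛 : IsUnitalDecorationSet 𝔛) {p : ℕ} (ρ : Equiv.Perm (Fin p)) (z : 𝔛.X p) :
    TensorProduct.assoc k _ _ _ ((decPermAlgebra k 𝔛).comul.rTensor _
      ((decPermAlgebra k 𝔛).comul (F k ρ z))) =
    (decPermAlgebra k 𝔛).comul.lTensor _ ((decPermAlgebra k 𝔛).comul (F k ρ z)) := by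
  rw [← FSub_univ h𝔛, comul_FSub h𝔛.toIsDecorationSet, map_sum, map_sum, map_sum]
  simp only [LinearMap.rTensor_tmul, LinearMap.lTensor_tmul, comul_FSub h𝔛.toIsDecorationSet,
    TensorProduct.sum_tmul, TensorProduct.tmul_sum, map_sum, TensorProduct.assoc_tmul]
  rw [Finset.sum_sigma', Finset.sum_sigma']
  -- Both sides cut the word into three blocks: prefixes C ⊆ B on the left correspond to the prefix
  -- C followed by B \ C on the right.
  refine Finset.sum_bij' (fun a _ => ⟨a.2, a.1 \ a.2⟩) (fun a _ => ⟨a.1 ∪ a.2, a.1⟩) ?_ ?_ ?_ ?_ ?_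
  · rintro ⟨B, C⟩ h
    simp only [Finset.mem_sigma, mem_prefixes, Finset.mem_sdiff, Finset.mem_univ, true_and,
      Finset.subset_univ, forall_true_left] at h ⊢
    refine ⟨fun x hx y hy => ?_, fun x hx => by simp_all, fun x hx y hy hxy => ?_⟩
    · by_cases hyB : y ∈ B
      · exact h.2.2 x hx y hyB hy
      · exact h.1 x (h.2.1 hx) y hyB
    · exact h.1 x hx.1 y fun hyB => hxy ⟨hyB, hy⟩
  · rintro ⟨B, C⟩ h
    simp only [Finset.mem_sigma, mem_prefixes, Finset.mem_sdiff, Finset.mem_univ, true_and,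
      Finset.subset_univ, forall_true_left, Finset.mem_union] at h ⊢
    refine ⟨fun x hx y hy => ?_, Finset.subset_union_left, fun x hx y _ hxy => h.1 x hx y hxy⟩
    rw [not_or] at hy
    rcases hx with hx | hx
    · exact h.1 x hx y hy.1
    · exact h.2.2 x hx y hy.1 hy.2
  · rintro ⟨B, C⟩ h
    simp only [Finset.mem_sigma, mem_prefixes] at h
    simp [Finset.union_sdiff_of_subset h.2.1]
  · rintro ⟨B, C⟩ h
    simp only [Finset.mem_sigma, mem_prefixes] at h
    have : (B ∪ C) \ B = C := by
      ext x
      have := @h.2.1 x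
      simp only [Finset.mem_sdiff, Finset.mem_union, Finset.mem_univ, true_and] at this ⊢
      tauto
    simp [this]
  · rintro ⟨B, C⟩ h
    simp only [Finset.mem_sigma, mem_prefixes] at h
    have : (Finset.univ \ C) \ (B \ C) = Finset.univ \ B := by
      ext x
      have := @h.2.1 x
      simp only [Finset.mem_sdiff, Finset.mem_univ, true_and]
      tauto
    simp [this]

theorem mem_shiftedShuffle {m n : ℕ} {σ : Equiv.Perm (Fin m)} {τ : Equiv.Perm (Fin n)}
    {ρ : Equiv.Perm (Fin (m + n))} : ρ ∈ shiftedShuffle σ τ ↔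
      stdVal ρ (Fin.castAddOrderEmb n) = σ ∧ stdVal ρ (Fin.natAddOrderEmb m) = τ := by
  simp [shiftedShuffle]

/-- Every permutation of m + n values is a shifted shuffle of exactly one pair, namely of its two
restrictions. -/
theorem mul_FSum {m n : ℕ} (x : 𝔛.X m) (y : 𝔛.X n) (P : Equiv.Perm (Fin m) → Prop)
    (Q : Equiv.Perm (Fin n) → Prop) :
    (decPermAlgebra k 𝔛).mul (FSum k x P) (FSum k y Q) = FSum k (𝔛.concat x y) fun ρ =>
      P (stdVal ρ (Fin.castAddOrderEmb n)) ∧ Q (stdVal ρ (Fin.natAddOrderEmb m)) := by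
  classical
  simp only [FSum, map_sum, LinearMap.sum_apply, mul_F]
  rw [Finset.sum_sigma', Finset.sum_sigma']
  refine Finset.sum_bij' (fun a _ => a.2) (fun ρ _ =>
    ⟨⟨stdVal ρ (Fin.natAddOrderEmb m), stdVal ρ (Fin.castAddOrderEmb n)⟩, ρ⟩) ?_ ?_ ?_ ?_ ?_
  · rintro ⟨⟨τ, σ⟩, ρ⟩ h
    simp only [Finset.mem_sigma, Finset.mem_filter, Finset.mem_univ, true_and,
      mem_shiftedShuffle] at h ⊢
    rw [h.2.1, h.2.2]
    exact ⟨h.1.2, h.1.1⟩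
  · intro ρ h
    simp only [Finset.mem_sigma, Finset.mem_filter, Finset.mem_univ, true_and,
      mem_shiftedShuffle, and_self, and_true] at h ⊢
    exact ⟨h.2, h.1⟩
  · rintro ⟨⟨τ, σ⟩, ρ⟩ h
    simp only [Finset.mem_sigma, mem_shiftedShuffle] at h
    rw [h.2.1, h.2.2]
  · intro ρ _
    rfl
  · intro a _
    rfl

theorem FSum_def {n : ℕ} (x : 𝔛.X n) (P : Equiv.Perm (Fin n) → Prop) [DecidablePred P] :
    FSum k x P = ∑ σ ∈ Finset.univ.filter P, F k σ x := by
  unfold FSum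
  congr!

theorem F_eq_FSum {n : ℕ} (σ : Equiv.Perm (Fin n)) (x : 𝔛.X n) :
    F k σ x = FSum k x fun π => π = σ := by
  rw [FSum_def, Finset.filter_eq', if_pos (Finset.mem_univ σ), Finset.sum_singleton]

theorem FSum_congr {n : ℕ} {x : 𝔛.X n} {P Q : Equiv.Perm (Fin n) → Prop}
    (h : ∀ σ, P σ ↔ Q σ) : FSum k x P = FSum k x Q := by
  rw [show P = Q from funext fun σ => propext (h σ)]

/-- Transport between sizes that are equal but not by definition, such as (a + b) + c and a + (b +
c). The embeddings are compared as functions to the natural numbers. -/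
theorem FSum_stdVal_congr {N N' a b c : ℕ} {x : 𝔛.X N} {x' : 𝔛.X N'}
    (hx : (⟨N, x⟩ : Σ n, 𝔛.X n) = ⟨N', x'⟩) {A : Fin a ↪o Fin N} {A' : Fin a ↪o Fin N'}
    {B : Fin b ↪o Fin N} {B' : Fin b ↪o Fin N'} {C : Fin c ↪o Fin N} {C' : Fin c ↪o Fin N'}
    (hA : ∀ i, (A i : ℕ) = A' i) (hB : ∀ i, (B i : ℕ) = B' i) (hC : ∀ i, (C i : ℕ) = C' i)
    (σ : Equiv.Perm (Fin a)) (τ : Equiv.Perm (Fin b)) (υ : Equiv.Perm (Fin c)) :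
    FSum k x (fun π => (stdVal π A = σ ∧ stdVal π B = τ) ∧ stdVal π C = υ) =
      FSum k x' (fun π => (stdVal π A' = σ ∧ stdVal π B' = τ) ∧ stdVal π C' = υ) := by
  cases hx
  obtain rfl : A = A' := RelEmbedding.ext fun i => Fin.ext (hA i)
  obtain rfl : B = B' := RelEmbedding.ext fun i => Fin.ext (hB i)
  obtain rfl : C = C' := RelEmbedding.ext fun i => Fin.ext (hC i)
  rfl

/-- Both products sum over the permutations with three prescribed restrictions. -/
theorem mul_assoc_F (h𝔛 : IsDecorationSet 𝔛) {a b c : ℕ} (σ : Equiv.Perm (Fin a)) (x : 𝔛.X a)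
    (τ : Equiv.Perm (Fin b)) (y : 𝔛.X b) (υ : Equiv.Perm (Fin c)) (z : 𝔛.X c) :
    (decPermAlgebra k 𝔛).mul ((decPermAlgebra k 𝔛).mul (F k σ x) (F k τ y)) (F k υ z) =
      (decPermAlgebra k 𝔛).mul (F k σ x) ((decPermAlgebra k 𝔛).mul (F k τ y) (F k υ z)) := by
  rw [F_eq_FSum, F_eq_FSum, F_eq_FSum, mul_FSum, mul_FSum, mul_FSum, mul_FSum]
  simp only [stdVal_stdVal]
  rw [FSum_congr (x := 𝔛.concat x (𝔛.concat y z)) fun _ => and_assoc.symm]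
  refine FSum_stdVal_congr (h𝔛.concat_assoc x y z) (fun i => ?_) (fun i => ?_) (fun i => ?_) σ τ υ
  · simp
  · simp
  · simp [Nat.add_assoc]

theorem one_mul_F (h𝔛 : IsUnitalDecorationSet 𝔛) {n : ℕ} (σ : Equiv.Perm (Fin n)) (x : 𝔛.X n) :
    (decPermAlgebra k 𝔛).mul (decPermAlgebra k 𝔛).one (F k σ x) = F k σ x := by
  change (decPermAlgebra k 𝔛).mul (F k 1 𝔛.empty) (F k σ x) = _
  rw [F_eq_FSum, F_eq_FSum, mul_FSum]
  -- The vacuous condition on the empty restriction is doubled to reach the shape with three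
  -- conditions of `FSum_stdVal_congr`, which takes care of the passage from 0 + n to n.
  rw [FSum_congr (Q := fun ρ => (stdVal ρ (Fin.castAddOrderEmb n) = 1 ∧
      stdVal ρ (Fin.castAddOrderEmb n) = 1) ∧ stdVal ρ (Fin.natAddOrderEmb 0) = σ)
    fun ρ => by rw [and_self],
    FSum_congr (x := x) (Q := fun ρ => (stdVal ρ (Fin.castLEOrderEmb (Nat.zero_le n)) = 1 ∧
      stdVal ρ (Fin.castLEOrderEmb (Nat.zero_le n)) = 1) ∧ stdVal ρ (RelEmbedding.refl _) = σ)
    fun ρ => by simp [stdVal_self, Subsingleton.elim _ (1 : Equiv.Perm (Fin 0))]]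
  exact FSum_stdVal_congr (h𝔛.empty_concat x) (fun i => i.elim0) (fun i => i.elim0)
    (fun i => by simp) _ _ _

theorem mul_one_F (h𝔛 : IsUnitalDecorationSet 𝔛) {n : ℕ} (σ : Equiv.Perm (Fin n)) (x : 𝔛.X n) :
    (decPermAlgebra k 𝔛).mul (F k σ x) (decPermAlgebra k 𝔛).one = F k σ x := by
  change (decPermAlgebra k 𝔛).mul (F k σ x) (F k 1 𝔛.empty) = _
  rw [F_eq_FSum, F_eq_FSum, mul_FSum, h𝔛.concat_empty]
  refine FSum_congr fun ρ => ?_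
  rw [stdVal_self (n := n) ρ (Fin.castAddOrderEmb 0)]
  exact and_iff_left (Subsingleton.elim _ _)

/-! ### The coproduct is multiplicative -/

/-- The union of a set of values and a shifted set of values. -/
def blockSet {m n : ℕ} (B : Finset (Fin m)) (C : Finset (Fin n)) : Finset (Fin (m + n)) :=
  B.map (Fin.castAddEmb n) ∪ C.map (Fin.natAddEmb m)

section Block

variable {m n : ℕ} {B : Finset (Fin m)} {C : Finset (Fin n)}

theorem castAdd_mem_blockSet {i : Fin m} : Fin.castAdd n i ∈ blockSet B C ↔ i ∈ B := by
  simp only [blockSet, Finset.mem_union, Finset.mem_map, Fin.castAddEmb_apply,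
    Fin.natAddEmb_apply]
  constructor
  · rintro (⟨j, hj, h⟩ | ⟨j, hj, h⟩)
    · rwa [← Fin.castAdd_injective m n h]
    · have := congrArg Fin.val h
      simp at this
      omega
  · exact fun h => Or.inl ⟨i, h, rfl⟩

theorem natAdd_mem_blockSet {i : Fin n} : Fin.natAdd m i ∈ blockSet B C ↔ i ∈ C := by
  simp only [blockSet, Finset.mem_union, Finset.mem_map, Fin.castAddEmb_apply,
    Fin.natAddEmb_apply]
  constructor
  · rintro (⟨j, hj, h⟩ | ⟨j, hj, h⟩)
    · have := congrArg Fin.val h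
      simp at this
      omega
    · rwa [← Fin.natAdd_injective n m h]
  · exact fun h => Or.inr ⟨i, h, rfl⟩

theorem blockEmb_castAdd {q s : ℕ} (R : Fin q ↪o Fin m) (S : Fin s ↪o Fin n) (i : Fin q) :
    blockEmb R S (Fin.castAdd s i) = Fin.castAdd n (R i) := by
  exact Fin.append_left (fun i => Fin.castAdd n (R i)) (fun j => Fin.natAdd m (S j)) i

theorem blockEmb_natAdd {q s : ℕ} (R : Fin q ↪o Fin m) (S : Fin s ↪o Fin n) (i : Fin s) :
    blockEmb R S (Fin.natAdd q i) = Fin.natAdd m (S i) := by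
  exact Fin.append_right (fun i => Fin.castAdd n (R i)) (fun j => Fin.natAdd m (S j)) i

theorem mem_range_blockEmb {x : Fin (m + n)} :
    x ∈ Set.range (blockEmb (enum B) (enum C)) ↔ x ∈ blockSet B C := by
  constructor
  · rintro ⟨i, rfl⟩
    induction i using Fin.addCases with
    | left i =>
      rw [blockEmb_castAdd, castAdd_mem_blockSet]
      exact enum_mem B i
    | right i =>
      rw [blockEmb_natAdd, natAdd_mem_blockSet]
      exact enum_mem C i
  · induction x using Fin.addCases with
    | left x =>
      rw [castAdd_mem_blockSet]
      intro h
      obtain ⟨i, rfl⟩ := mem_range_enum.2 h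
      exact ⟨_, blockEmb_castAdd _ _ i⟩
    | right x =>
      rw [natAdd_mem_blockSet]
      intro h
      obtain ⟨i, rfl⟩ := mem_range_enum.2 h
      exact ⟨_, blockEmb_natAdd _ _ i⟩

theorem sdiff_blockSet : Finset.univ \ blockSet B C = blockSet (Finset.univ \ B) (Finset.univ \ C) := by
  ext x
  induction x using Fin.addCases with
  | left x => simp [castAdd_mem_blockSet]
  | right x => simp [natAdd_mem_blockSet]

theorem stdVal_block_left {q s : ℕ} (ρ : Equiv.Perm (Fin (m + n))) (R : Fin q ↪o Fin m)
    (S : Fin s ↪o Fin n) : stdVal (stdVal ρ (blockEmb R S)) (Fin.castAddOrderEmb s) =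
      stdVal (stdVal ρ (Fin.castAddOrderEmb n)) R := by
  rw [stdVal_stdVal, stdVal_stdVal]
  congr 1
  exact RelEmbedding.ext fun i => blockEmb_castAdd R S i

theorem stdVal_block_right {q s : ℕ} (ρ : Equiv.Perm (Fin (m + n))) (R : Fin q ↪o Fin m)
    (S : Fin s ↪o Fin n) : stdVal (stdVal ρ (blockEmb R S)) (Fin.natAddOrderEmb q) =
      stdVal (stdVal ρ (Fin.natAddOrderEmb m)) S := by
  rw [stdVal_stdVal, stdVal_stdVal]
  congr 1
  exact RelEmbedding.ext fun i => blockEmb_natAdd R S i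

end Block

/-- A prefix set of a shuffle of σ and τ is a block made of a prefix set B of σ and a prefix set C
of τ. For fixed B and C, cutting a shuffle after this block gives a shuffle of the two prefixes and
a shuffle of the two rests, and gluing is the inverse map. -/
theorem comul_mul_F (h𝔛 : IsDecorationSet 𝔛) {m n : ℕ} (σ : Equiv.Perm (Fin m)) (x : 𝔛.X m)
    (τ : Equiv.Perm (Fin n)) (y : 𝔛.X n) :
    (decPermAlgebra k 𝔛).comul ((decPermAlgebra k 𝔛).mul (F k σ x) (F k τ y)) =
      TensorProduct.map₂ (decPermAlgebra k 𝔛).mul (decPermAlgebra k 𝔛).mul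
        ((decPermAlgebra k 𝔛).comul (F k σ x)) ((decPermAlgebra k 𝔛).comul (F k τ y)) := by
  classical
  set z := 𝔛.concat x y with hz
  have lhs : (decPermAlgebra k 𝔛).comul ((decPermAlgebra k 𝔛).mul (F k σ x) (F k τ y)) =
      ∑ BC ∈ prefixes σ Finset.univ ×ˢ prefixes τ Finset.univ,
        ∑ ρ ∈ (shiftedShuffle σ τ).filter fun ρ => blockSet BC.1 BC.2 ∈ prefixes ρ Finset.univ,
          FSub k ρ z (blockSet BC.1 BC.2) ⊗ₜ[k] FSub k ρ z (Finset.univ \ blockSet BC.1 BC.2) := by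
    have hset : ∀ A : Finset (Fin (m + n)), blockSet (Finset.univ.filter fun i => Fin.castAdd n i ∈ A)
        (Finset.univ.filter fun i => Fin.natAdd m i ∈ A) = A := fun A => by
      ext x
      induction x using Fin.addCases with
      | left x => simp [castAdd_mem_blockSet]
      | right x => simp [natAdd_mem_blockSet]
    simp only [mul_F, map_sum, comul_F]
    rw [Finset.sum_sigma', Finset.sum_sigma']
    refine Finset.sum_bij' (fun a _ => ⟨(Finset.univ.filter fun i => Fin.castAdd n i ∈ a.2,
      Finset.univ.filter fun i => Fin.natAdd m i ∈ a.2), a.1⟩)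
      (fun a _ => ⟨a.2, blockSet a.1.1 a.1.2⟩) ?_ ?_ ?_ ?_ ?_
    · rintro ⟨ρ, A⟩ h
      simp only [Finset.mem_sigma, Finset.mem_filter, Finset.mem_product] at h ⊢
      rw [hset]
      refine ⟨⟨?_, ?_⟩, h⟩
      · rw [mem_prefixes]
        refine ⟨Finset.subset_univ _, fun i hi j _ hj => ?_⟩
        simp only [Finset.mem_filter, Finset.mem_univ, true_and] at hi hj
        rw [← (mem_shiftedShuffle.1 h.1).1]
        exact bef_stdVal.2 ((mem_prefixes.1 h.2).2 _ hi _ (Finset.mem_univ _) hj)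
      · rw [mem_prefixes]
        refine ⟨Finset.subset_univ _, fun i hi j _ hj => ?_⟩
        simp only [Finset.mem_filter, Finset.mem_univ, true_and] at hi hj
        rw [← (mem_shiftedShuffle.1 h.1).2]
        exact bef_stdVal.2 ((mem_prefixes.1 h.2).2 _ hi _ (Finset.mem_univ _) hj)
    · rintro ⟨⟨B, C⟩, ρ⟩ h
      simp only [Finset.mem_sigma, Finset.mem_filter] at h ⊢
      exact h.2
    · rintro ⟨ρ, A⟩ _
      simp only [hset]
    · rintro ⟨⟨B, C⟩, ρ⟩ _
      simp [castAdd_mem_blockSet, natAdd_mem_blockSet]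
    · rintro ⟨ρ, A⟩ _
      simp only [hset]
      rfl
  rw [lhs, comul_F, comul_F, LinearMap.map_sum₂, Finset.sum_product]
  refine Finset.sum_congr rfl fun B hB => ?_
  rw [map_sum]
  refine Finset.sum_congr rfl fun C hC => ?_
  rw [TensorProduct.map₂_apply_tmul, TensorProduct.map_tmul, FSub, FSub, FSub, FSub, FRes, FRes, FRes, FRes, mul_F, mul_F,
    TensorProduct.sum_tmul]
  simp only [TensorProduct.tmul_sum]
  rw [← Finset.sum_product', h𝔛.concat_select, h𝔛.concat_select]
  set R := blockEmb (enum B) (enum C) with hR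
  set S := blockEmb (enum (Finset.univ \ B)) (enum (Finset.univ \ C)) with hS
  have hcover : ∀ x, x ∈ Set.range R ∨ x ∈ Set.range S := fun x => by
    rw [mem_range_blockEmb, mem_range_blockEmb, ← sdiff_blockSet]
    simpa using em _
  have hRB : ∀ i, R i ∈ blockSet B C := fun i => mem_range_blockEmb.1 ⟨i, rfl⟩
  have hSB : ∀ i, S i ∉ blockSet B C := fun i => by
    have := mem_range_blockEmb.1 (show S i ∈ Set.range S from ⟨i, rfl⟩)
    rw [← sdiff_blockSet] at this
    exact (Finset.mem_sdiff.1 this).2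
  have hpre : ∀ ρ, blockSet B C ∈ prefixes ρ Finset.univ ↔ ∀ i j, Bef ρ (R i) (S j) := by
    intro ρ
    rw [mem_prefixes]
    constructor
    · exact fun h i j => h.2 _ (hRB i) _ (Finset.mem_univ _) (hSB j)
    · refine fun h => ⟨Finset.subset_univ _, fun u hu v _ hv => ?_⟩
      obtain ⟨i, rfl⟩ := mem_range_blockEmb.2 hu
      obtain ⟨j, rfl⟩ := (hcover v).resolve_left fun h => hv (mem_range_blockEmb.1 h)
      exact h i j
  refine Finset.sum_bij (fun ρ _ => (stdVal ρ R, stdVal ρ S)) ?_ ?_ ?_ ?_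
  · intro ρ h
    rw [Finset.mem_filter, mem_shiftedShuffle] at h
    rw [Finset.mem_product, mem_shiftedShuffle, mem_shiftedShuffle]
    simp only [hR, hS, stdVal_block_left, stdVal_block_right, h.1.1, h.1.2, and_self]
  · intro ρ h π h' e
    rw [Finset.mem_filter, hpre] at h h'
    exact glue_ext hcover h.2 h'.2 (congrArg Prod.fst e) (congrArg Prod.snd e)
  · rintro ⟨ρ₁, ρ₂⟩ h
    rw [Finset.mem_product, mem_shiftedShuffle, mem_shiftedShuffle] at h
    obtain ⟨ρ, h1, h2, h3⟩ := exists_glue hcover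
      (fun i j e => hSB j (e ▸ hRB i)) ρ₁ ρ₂
    refine ⟨ρ, ?_, by rw [h2, h3]⟩
    have side : ∀ {q : ℕ} (A : Finset (Fin q)) (u : Fin q), u ∈ Set.range (enum A) ∨
        u ∈ Set.range (enum (Finset.univ \ A)) := fun A u => by
      rw [mem_range_enum, mem_range_enum]
      simpa using em _
    rw [Finset.mem_filter, hpre, mem_shiftedShuffle]
    refine ⟨⟨glue_ext (side B) (fun i j => ?_) (fun i j => ?_) ?_ ?_,
      glue_ext (side C) (fun i j => ?_) (fun i j => ?_) ?_ ?_⟩, h1⟩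
    · rw [bef_stdVal]
      have := h1 (Fin.castAdd _ i) (Fin.castAdd _ j)
      rwa [hR, hS, blockEmb_castAdd, blockEmb_castAdd] at this
    · exact (mem_prefixes.1 hB).2 _ (enum_mem B i) _ (Finset.mem_univ _)
        (Finset.mem_sdiff.1 (enum_mem _ j)).2
    · rw [← h.1.1, ← h2, hR, stdVal_block_left]
    · rw [← h.2.1, ← h3, hS, stdVal_block_left]
    · rw [bef_stdVal]
      have := h1 (Fin.natAdd _ i) (Fin.natAdd _ j)
      rwa [hR, hS, blockEmb_natAdd, blockEmb_natAdd] at this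
    · exact (mem_prefixes.1 hC).2 _ (enum_mem C i) _ (Finset.mem_univ _)
        (Finset.mem_sdiff.1 (enum_mem _ j)).2
    · rw [← h.1.2, ← h2, hR, stdVal_block_right]
    · rw [← h.2.2, ← h3, hS, stdVal_block_right]
  · intro ρ _
    change _ = FRes k ρ z R ⊗ₜ[k] FRes k ρ z S
    rw [FRes_eq_FSub (R := R) ρ z fun _ => mem_range_blockEmb,
      FRes_eq_FSub (R := S) ρ z fun _ => mem_range_blockEmb, sdiff_blockSet]

end Hopf

/-! ### Grading, counit and the axioms of a graded Hopf algebra -/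

section HopfStructure

variable {k : Type*} [Field k] {𝔛 : DecorationData}

theorem gr_eq_span (n : ℕ) : (decPermAlgebra k 𝔛).gr n =
    Submodule.span k {v | ∃ (σ : Equiv.Perm (Fin n)) (x : 𝔛.X n), v = F k σ x} := by
  change Finsupp.supported k k {a : DecPerm 𝔛 | a.1 = n} = _
  rw [Finsupp.supported_eq_span_single]
  congr 1
  ext v
  constructor
  · rintro ⟨⟨m, σ, x⟩, h, rfl⟩
    obtain rfl : m = n := h
    exact ⟨σ, x, rfl⟩
  · rintro ⟨σ, x, rfl⟩
    exact ⟨⟨n, σ, x⟩, rfl, rfl⟩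

theorem F_mem_gr {n : ℕ} (σ : Equiv.Perm (Fin n)) (x : 𝔛.X n) :
    F k σ x ∈ (decPermAlgebra k 𝔛).gr n := by
  rw [gr_eq_span]
  exact Submodule.subset_span ⟨σ, x, rfl⟩

theorem gr_internal : DirectSum.IsInternal (decPermAlgebra k 𝔛).gr := by
  change DirectSum.IsInternal fun n => Finsupp.supported k k {a : DecPerm 𝔛 | a.1 = n}
  refine DirectSum.isInternal_submodule_of_iSupIndep_of_iSup_eq_top ?_ ?_
  · intro n
    change Disjoint (Finsupp.supported k k {a : DecPerm 𝔛 | a.1 = n})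
      (⨆ m, ⨆ _ : m ≠ n, Finsupp.supported k k {a : DecPerm 𝔛 | a.1 = m})
    refine Disjoint.mono_right (iSup₂_le fun m hm => Finsupp.supported_mono
      (t := {a : DecPerm 𝔛 | a.1 ≠ n}) fun a (h : a.1 = m) => ?_)
      (Finsupp.disjoint_supported_supported (Set.disjoint_left.2 fun a ha hb => hb ha))
    exact fun e => hm (h.symm.trans e)
  · rw [← Finsupp.supported_iUnion, ← Finsupp.supported_univ]
    congr 1
    ext a
    simp

theorem counit_FSub {p : ℕ} (ρ : Equiv.Perm (Fin p)) (z : 𝔛.X p) (A : Finset (Fin p)) :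
    (decPermAlgebra k 𝔛).counit (FSub k ρ z A) = if A = ∅ then 1 else 0 := by
  rw [FSub, FRes, counit_F]
  simp only [Finset.card_eq_zero]

theorem counit_left_F (h𝔛 : IsUnitalDecorationSet 𝔛) {p : ℕ} (ρ : Equiv.Perm (Fin p))
    (z : 𝔛.X p) : (decPermAlgebra k 𝔛).counit.rTensor _ ((decPermAlgebra k 𝔛).comul (F k ρ z)) =
      (1 : k) ⊗ₜ[k] F k ρ z := by
  rw [comul_F, map_sum]
  simp only [LinearMap.rTensor_tmul, counit_FSub]
  rw [Finset.sum_eq_single_of_mem ∅ (by simp [mem_prefixes]) fun A _ hA => by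
    rw [if_neg hA, TensorProduct.zero_tmul], if_pos rfl, Finset.sdiff_empty, FSub_univ h𝔛]

theorem counit_right_F (h𝔛 : IsUnitalDecorationSet 𝔛) {p : ℕ} (ρ : Equiv.Perm (Fin p))
    (z : 𝔛.X p) : (decPermAlgebra k 𝔛).counit.lTensor _ ((decPermAlgebra k 𝔛).comul (F k ρ z)) =
      F k ρ z ⊗ₜ[k] (1 : k) := by
  rw [comul_F, map_sum]
  simp only [LinearMap.lTensor_tmul, counit_FSub]
  rw [Finset.sum_eq_single_of_mem Finset.univ (by simp [mem_prefixes]) fun A _ hA => by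
    rw [if_neg fun h => hA (Finset.univ_subset_iff.1 (Finset.sdiff_eq_empty_iff_subset.1 h)),
      TensorProduct.tmul_zero], if_pos (by simp), FSub_univ h𝔛]

theorem comul_one_F (h𝔛 : IsUnitalDecorationSet 𝔛) :
    (decPermAlgebra k 𝔛).comul (decPermAlgebra k 𝔛).one =
      (decPermAlgebra k 𝔛).one ⊗ₜ[k] (decPermAlgebra k 𝔛).one := by
  change (decPermAlgebra k 𝔛).comul (F k 1 𝔛.empty) = F k 1 𝔛.empty ⊗ₜ[k] F k 1 𝔛.empty
  have h : prefixes (1 : Equiv.Perm (Fin 0)) Finset.univ = {Finset.univ} := by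
    ext A
    simp [mem_prefixes, Subsingleton.elim A ∅]
  rw [comul_F, h, Finset.sum_singleton, Subsingleton.elim (Finset.univ \ _) Finset.univ,
    FSub_univ h𝔛]

theorem isGradedHopf_decPermAlgebra (h𝔛 : IsUnitalDecorationSet 𝔛) :
    IsGradedHopf (decPermAlgebra k 𝔛) where
  mul_assoc x y z := by
    induction x using decPerm_induction with
    | hadd v w hv hw => simp only [map_add, LinearMap.add_apply, hv, hw]
    | hsmul c v hv => simp only [map_smul, LinearMap.smul_apply, hv]
    | hF a σ x =>
      induction y using decPerm_induction with
      | hadd v w hv hw => simp only [map_add, LinearMap.add_apply, hv, hw]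
      | hsmul c v hv => simp only [map_smul, LinearMap.smul_apply, hv]
      | hF b τ y =>
        induction z using decPerm_induction with
        | hadd v w hv hw => simp only [map_add, hv, hw]
        | hsmul c v hv => simp only [map_smul, hv]
        | hF c υ z => exact mul_assoc_F h𝔛.toIsDecorationSet σ x τ y υ z
  one_mul x := by
    induction x using decPerm_induction with
    | hadd v w hv hw => simp only [map_add, hv, hw]
    | hsmul c v hv => simp only [map_smul, hv]
    | hF a σ x => exact one_mul_F h𝔛 σ x
  mul_one x := by
    induction x using decPerm_induction with
    | hadd v w hv hw => simp only [map_add, LinearMap.add_apply, hv, hw]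
    | hsmul c v hv => simp only [map_smul, LinearMap.smul_apply, hv]
    | hF a σ x => exact mul_one_F h𝔛 σ x
  coassoc x := by
    induction x using decPerm_induction with
    | hadd v w hv hw => simp only [map_add, hv, hw]
    | hsmul c v hv => simp only [map_smul, hv]
    | hF a σ x => exact coassoc_F h𝔛 σ x
  counit_left x := by
    induction x using decPerm_induction with
    | hadd v w hv hw => simp only [map_add, hv, hw, TensorProduct.tmul_add]
    | hsmul c v hv => simp only [map_smul, hv, TensorProduct.tmul_smul]
    | hF a σ x => exact counit_left_F h𝔛 σ x
  counit_right x := by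
    induction x using decPerm_induction with
    | hadd v w hv hw => simp only [map_add, hv, hw, TensorProduct.add_tmul]
    | hsmul c v hv => simp only [map_smul, hv, TensorProduct.smul_tmul']
    | hF a σ x => exact counit_right_F h𝔛 σ x
  comul_mul x y := by
    induction x using decPerm_induction with
    | hadd v w hv hw => simp only [map_add, LinearMap.add_apply, hv, hw]
    | hsmul c v hv => simp only [map_smul, LinearMap.smul_apply, hv]
    | hF a σ x =>
      induction y using decPerm_induction with
      | hadd v w hv hw => simp only [map_add, hv, hw]
      | hsmul c v hv => simp only [map_smul, hv]
      | hF b τ y => exact comul_mul_F h𝔛.toIsDecorationSet σ x τ y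
  comul_one := comul_one_F h𝔛
  counit_mul x y := by
    induction x using decPerm_induction with
    | hadd v w hv hw => simp only [map_add, LinearMap.add_apply, hv, hw, add_mul]
    | hsmul c v hv => simp only [map_smul, LinearMap.smul_apply, hv, smul_eq_mul, mul_assoc]
    | hF a σ x =>
      induction y using decPerm_induction with
      | hadd v w hv hw => simp only [map_add, hv, hw, mul_add]
      | hsmul c v hv => simp only [map_smul, hv, smul_eq_mul, mul_left_comm]
      | hF b τ y =>
        rw [mul_F, map_sum]
        simp only [counit_F, Finset.sum_const]
        by_cases h : a = 0 ∧ b = 0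
        · obtain ⟨rfl, rfl⟩ := h
          have : (shiftedShuffle σ τ).card = 1 := by
            rw [Finset.card_eq_one]
            refine ⟨1, Finset.eq_singleton_iff_unique_mem.2 ⟨mem_shiftedShuffle.2 ⟨?_, ?_⟩, ?_⟩⟩
            · exact Equiv.ext fun i => i.elim0
            · exact Equiv.ext fun i => i.elim0
            · exact fun ρ _ => Equiv.ext fun i => i.elim0
          simp [this]
        · rw [if_neg (by omega), smul_zero]
          split_ifs <;> simp_all
  counit_one := by
    change (decPermAlgebra k 𝔛).counit (F k 1 𝔛.empty) = 1
    simp [counit_F]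
  gr_internal := gr_internal
  gr_one := F_mem_gr 1 𝔛.empty
  gr_mul m n x hx y hy := by
    rw [gr_eq_span] at hx hy
    induction hx using Submodule.span_induction with
    | zero => simp
    | add v w _ _ hv hw =>
      rw [map_add, LinearMap.add_apply]
      exact add_mem hv hw
    | smul c v _ hv =>
      rw [map_smul, LinearMap.smul_apply]
      exact Submodule.smul_mem _ c hv
    | mem v h =>
      obtain ⟨σ, x, rfl⟩ := h
      induction hy using Submodule.span_induction with
      | zero => simp
      | add v w _ _ hv hw =>
        rw [map_add]
        exact add_mem hv hw
      | smul c v _ hv =>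
        rw [map_smul]
        exact Submodule.smul_mem _ c hv
      | mem v h =>
        obtain ⟨τ, y, rfl⟩ := h
        rw [mul_F]
        exact sum_mem fun ρ _ => F_mem_gr ρ _
  gr_comul p x hx := by
    rw [gr_eq_span] at hx
    induction hx using Submodule.span_induction with
    | zero => simp
    | add v w _ _ hv hw =>
      rw [map_add]
      exact add_mem hv hw
    | smul c v _ hv =>
      rw [map_smul]
      exact Submodule.smul_mem _ c hv
    | mem v h =>
      obtain ⟨ρ, z, rfl⟩ := h
      rw [comul_F]
      refine sum_mem fun A _ => ?_
      refine Submodule.mem_iSup_of_mem (A.card, (Finset.univ \ A).card)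
        (Submodule.mem_iSup_of_mem ?_ ?_)
      · rw [Finset.HasAntidiagonal.mem_antidiagonal]
        have := Finset.card_sdiff_add_card_eq_card (Finset.subset_univ A)
        rw [Finset.card_univ, Fintype.card_fin] at this
        omega
      · exact ⟨⟨_, F_mem_gr _ _⟩ ⊗ₜ ⟨_, F_mem_gr _ _⟩, rfl⟩
  gr_counit p hp x hx := by
    rw [gr_eq_span] at hx
    induction hx using Submodule.span_induction with
    | zero => simp
    | add v w _ _ hv hw => rw [map_add, hv, hw, add_zero]
    | smul c v _ hv => rw [map_smul, hv, smul_zero]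
    | mem v h =>
      obtain ⟨ρ, z, rfl⟩ := h
      rw [counit_F, if_neg hp]

end HopfStructure

/-! ### Conservative functions give Hopf subalgebras -/

section Subalgebra

variable {k : Type*} [Field k] {𝔛 : DecorationData} {arcs : ∀ {n : ℕ}, 𝔛.X n → ArcIdeal n}

theorem FSum_mem_gr {n : ℕ} (x : 𝔛.X n) (P : Equiv.Perm (Fin n) → Prop) :
    FSum k x P ∈ (decPermAlgebra k 𝔛).gr n :=
  sum_mem fun σ _ => F_mem_gr σ x

theorem homogeneous_of_span {k : Type*} [Field k] {V : Type*} [AddCommGroup V] [Module k V]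
    (gr : ℕ → Submodule k V) (s : Set V) (h : ∀ v ∈ s, ∃ n, v ∈ gr n) :
    Submodule.span k s = ⨆ n, Submodule.span k s ⊓ gr n := by
  refine le_antisymm (Submodule.span_le.2 fun v hv => ?_) (iSup_le fun n => inf_le_left)
  obtain ⟨n, hn⟩ := h v hv
  exact Submodule.mem_iSup_of_mem n ⟨Submodule.subset_span hv, hn⟩

theorem FSum_eta_mem {n : ℕ} (x : 𝔛.X n) (σ : Equiv.Perm (Fin n)) :
    FSum k x (fun τ => eta (arcs x) τ = eta (arcs x) σ) ∈ diagramAlgebra k 𝔛 arcs :=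
  Submodule.subset_span ⟨n, x, _, eta_isNoncrossing _ σ, eta_subset _ σ, rfl⟩

/-- The condition describes a union of fibers of `eta`, so the sum splits into class sums. -/
theorem FSum_mem_diagramAlgebra {n : ℕ} (x : 𝔛.X n) {P : Equiv.Perm (Fin n) → Prop}
    (hP : ∀ σ τ, eta (arcs x) σ = eta (arcs x) τ → P σ → P τ) :
    FSum k x P ∈ diagramAlgebra k 𝔛 arcs := by
  classical
  rw [FSum, ← Finset.sum_fiberwise_of_maps_to
    (t := (Finset.univ.filter P).image (eta (arcs x))) (g := eta (arcs x))
    fun σ hσ => Finset.mem_image_of_mem _ hσ]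
  refine sum_mem fun D hD => ?_
  obtain ⟨σ, hσ, rfl⟩ := Finset.mem_image.1 hD
  convert FSum_eta_mem (k := k) (arcs := arcs) x σ using 1
  rw [FSum]
  refine Finset.sum_congr ?_ fun _ _ => rfl
  ext τ
  simp only [Finset.mem_filter, Finset.mem_univ, true_and] at hσ ⊢
  exact and_iff_right_of_imp fun h => hP σ τ h.symm hσ

/-- Restricting a step to a set of values. -/
theorem arcStep_stdVal {p q : ℕ} {C C' : Set RawArc} {ρ ρ' : Equiv.Perm (Fin p)}
    (R : Fin q ↪o Fin p)
    (hC : ∀ a c, a < c → valArc (stdVal ρ R) a c ∈ C' → valArc ρ (R a) (R c) ∈ C)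
    (h : ArcStep C ρ ρ') :
    stdVal ρ R = stdVal ρ' R ∨ ArcStep C' (stdVal ρ R) (stdVal ρ' R) := by
  obtain ⟨a, c, hac, hn, hα, rfl⟩ := h
  by_cases hR : ∃ i j, R i = a ∧ R j = c
  · obtain ⟨a, c, rfl, rfl⟩ := hR
    have hn' : Next (stdVal ρ R) c a :=
      ⟨bef_stdVal.2 hn.1, fun z h1 h2 => hn.2 _ (bef_stdVal.1 h1) (bef_stdVal.1 h2)⟩
    have hac' := R.lt_iff_lt.1 hac
    refine Or.inr ⟨a, c, hac', hn', fun h => hα (hC a c hac' h), perm_ext_bef fun x y h => ?_⟩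
    rw [bef_stdVal, bef_swap hn] at h
    rw [bef_swap hn', bef_stdVal]
    simpa using h
  · refine Or.inl (perm_ext_bef fun x y h => ?_)
    rw [bef_stdVal] at h ⊢
    exact (bef_swap hn).2 (Or.inr ⟨h, fun e => hR ⟨y, x, e.2, e.1⟩⟩)

/-- By conservativity, an arc outside the ideal of the concatenation comes from no arc of the ideal
of the factor. So a step restricts to a step of the factor or to an equality. -/
theorem eta_stdVal_castAdd (hc : IsConservative 𝔛 arcs) {m n : ℕ} (x : 𝔛.X m) (y : 𝔛.X n)
    {ρ ρ' : Equiv.Perm (Fin (m + n))} (h : ArcStep (arcs (𝔛.concat x y)).carrier ρ ρ') :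
    eta (arcs x) (stdVal ρ (Fin.castAddOrderEmb n)) =
      eta (arcs x) (stdVal ρ' (Fin.castAddOrderEmb n)) := by
  have hC : ∀ a c, a < c → valArc (stdVal ρ (Fin.castAddOrderEmb n)) a c ∈ (arcs x).carrier →
      valArc ρ (Fin.castAddOrderEmb n a) (Fin.castAddOrderEmb n c) ∈
        (arcs (𝔛.concat x y)).carrier := by
    intro a c hac hα
    refine hc.concat_left x y ?_
    convert hα using 1
    refine RawArc.ext rfl rfl (Finset.ext fun u => ?_)
    rw [mem_valArc_above, mem_valArc_above]
    constructor
    · rintro ⟨z, ⟨h1, h2, h3⟩, rfl⟩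
      have hz : (z : ℕ) < m := lt_trans (Fin.lt_def.1 h3) c.isLt
      exact ⟨⟨z, hz⟩, ⟨bef_stdVal.2 h1, h2, h3⟩, rfl⟩
    · rintro ⟨z, ⟨h1, h2, h3⟩, rfl⟩
      exact ⟨Fin.castAdd n z, ⟨bef_stdVal.1 h1, h2, h3⟩, rfl⟩
  rcases arcStep_stdVal _ hC h with e | e
  · rw [e]
  · exact eta_eq_of_arcStep e

theorem eta_stdVal_natAdd (hc : IsConservative 𝔛 arcs) {m n : ℕ} (x : 𝔛.X m) (y : 𝔛.X n)
    {ρ ρ' : Equiv.Perm (Fin (m + n))} (h : ArcStep (arcs (𝔛.concat x y)).carrier ρ ρ') :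
    eta (arcs y) (stdVal ρ (Fin.natAddOrderEmb m)) =
      eta (arcs y) (stdVal ρ' (Fin.natAddOrderEmb m)) := by
  have hC : ∀ a c, a < c → valArc (stdVal ρ (Fin.natAddOrderEmb m)) a c ∈ (arcs y).carrier →
      valArc ρ (Fin.natAddOrderEmb m a) (Fin.natAddOrderEmb m c) ∈
        (arcs (𝔛.concat x y)).carrier := by
    intro a c hac hα
    refine hc.concat_right x y ⟨_, hα, ?_⟩
    refine RawArc.ext ?_ ?_ (Finset.ext fun u => ?_)
    · simp only [RawArc.shift, valArc, Fin.natAddOrderEmb_apply, Fin.val_natAdd]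
      omega
    · simp only [RawArc.shift, valArc, Fin.natAddOrderEmb_apply, Fin.val_natAdd]
      omega
    · simp only [RawArc.shift, Finset.mem_image, mem_valArc_above]
      constructor
      · rintro ⟨_, ⟨z, ⟨h1, h2, h3⟩, rfl⟩, rfl⟩
        refine ⟨Fin.natAdd m z, ⟨bef_stdVal.1 h1, (Fin.natAddOrderEmb m).lt_iff_lt.2 h2,
          (Fin.natAddOrderEmb m).lt_iff_lt.2 h3⟩, ?_⟩
        rw [Fin.val_natAdd]
        omega
      · rintro ⟨z, ⟨h1, h2, h3⟩, rfl⟩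
        induction z using Fin.addCases with
        | left z =>
          have := Fin.lt_def.1 h2
          simp only [Fin.natAddOrderEmb_apply, Fin.val_natAdd, Fin.val_castAdd] at this
          omega
        | right z =>
          refine ⟨_, ⟨z, ⟨bef_stdVal.2 h1, (Fin.natAddOrderEmb m).lt_iff_lt.1 h2,
            (Fin.natAddOrderEmb m).lt_iff_lt.1 h3⟩, rfl⟩, ?_⟩
          rw [Fin.val_natAdd]
          omega
  rcases arcStep_stdVal _ hC h with e | e
  · rw [e]
  · exact eta_eq_of_arcStep e

/-- Lifting a step from a set of values that stand together. -/
theorem arcStep_lift (hc : IsConservative 𝔛 arcs) {p q : ℕ} {ρ : Equiv.Perm (Fin p)} (z : 𝔛.X p)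
    (R : Fin q ↪o Fin p)
    (hR : ∀ i j y, Bef ρ (R i) y → Bef ρ y (R j) → y ∈ Set.range R) {τ : Equiv.Perm (Fin q)}
    (h : ArcStep (arcs (𝔛.select z R)).carrier (stdVal ρ R) τ) :
    ∃ ρ', ArcStep (arcs z).carrier ρ ρ' ∧ stdVal ρ' R = τ ∧
      ∀ x y, (x ∉ Set.range R ∨ y ∉ Set.range R) → (Bef ρ' x y ↔ Bef ρ x y) := by
  obtain ⟨a, c, hac, hn, hα, rfl⟩ := h
  have hn' : Next ρ (R c) (R a) := by
    refine ⟨bef_stdVal.1 hn.1, fun y h1 h2 => ?_⟩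
    obtain ⟨i, rfl⟩ := hR c a y h1 h2
    exact hn.2 i (bef_stdVal.2 h1) (bef_stdVal.2 h2)
  have hac' : R a < R c := R.lt_iff_lt.2 hac
  refine ⟨Equiv.swap (R c) (R a) * ρ, ⟨R a, R c, hac', hn', fun h => hα ?_, rfl⟩,
    perm_ext_bef fun x y h => ?_, fun x y h => bef_swap_of_ne hn' ?_ ?_⟩
  · have e : ∀ i, (R i : ℕ) + 1 ∈ (valArc ρ (R a) (R c)).above ↔
        (Bef (stdVal ρ R) i c ∧ a < i ∧ i < c) := fun i => by
      rw [succ_mem_valArc_above, bef_stdVal, R.lt_iff_lt, R.lt_iff_lt]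
    convert hc.select z R a c (valArc ρ (R a) (R c)).above hac
      (valArc_isArc (σ := ρ) hac').2.2.2 h using 1
    refine RawArc.ext rfl rfl (Finset.ext fun u => ?_)
    simp only [Finset.mem_image, Finset.mem_filter, Finset.mem_univ, true_and, e]
    exact mem_valArc_above
  · rw [bef_stdVal, bef_swap hn'] at h
    rw [bef_swap hn, bef_stdVal]
    simpa using h
  · rintro ⟨rfl, rfl⟩
    simp at h
  · rintro ⟨rfl, rfl⟩
    simp at h

/-- Grouping the first tensor factor by classes leaves the second factor constant on each group, and
the second factor is itself a sum over a union of classes. -/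
theorem sum_tmul_mem {a b : ℕ} (x : 𝔛.X a) (y : 𝔛.X b)
    {Q : Equiv.Perm (Fin a) → Equiv.Perm (Fin b) → Prop}
    (hQ₁ : ∀ σ σ' τ, eta (arcs x) σ = eta (arcs x) σ' → Q σ τ → Q σ' τ)
    (hQ₂ : ∀ σ τ τ', eta (arcs y) τ = eta (arcs y) τ' → Q σ τ → Q σ τ') :
    (∑ σ, F k σ x ⊗ₜ[k] FSum k y (Q σ)) ∈ LinearMap.range (TensorProduct.map
      (diagramAlgebra k 𝔛 arcs).subtype (diagramAlgebra k 𝔛 arcs).subtype) := by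
  classical
  rw [← Finset.sum_fiberwise_of_maps_to (t := Finset.univ.image (eta (arcs x)))
    (g := eta (arcs x)) fun σ hσ => Finset.mem_image_of_mem _ hσ]
  refine sum_mem fun D hD => ?_
  obtain ⟨σ, -, rfl⟩ := Finset.mem_image.1 hD
  have e : (∑ τ ∈ Finset.univ.filter (fun τ => eta (arcs x) τ = eta (arcs x) σ),
      F k τ x ⊗ₜ[k] FSum k y (Q τ)) =
      FSum k x (fun τ => eta (arcs x) τ = eta (arcs x) σ) ⊗ₜ[k] FSum k y (Q σ) := by
    rw [FSum, TensorProduct.sum_tmul]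
    refine Finset.sum_congr (by congr) fun τ hτ => ?_
    have hτ' : eta (arcs x) τ = eta (arcs x) σ := (Finset.mem_filter.1 hτ).2
    rw [FSum_congr fun υ => ⟨hQ₁ τ σ υ hτ', hQ₁ σ τ υ hτ'.symm⟩]
  rw [e]
  exact ⟨⟨_, FSum_eta_mem x σ⟩ ⊗ₜ ⟨_, FSum_mem_diagramAlgebra y (hQ₂ σ)⟩, rfl⟩

/-- For a fixed prefix set A the terms are the gluings of a word σ on A and a word τ on the
complement. Both blocks are contiguous in the glued word, so a step of σ or τ lifts to a step of the
gluing and does not affect P. Thus P is a union of classes in each factor separately. -/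
theorem comul_FSum_mem (hc : IsConservative 𝔛 arcs) {p : ℕ} (z : 𝔛.X p)
    {P : Equiv.Perm (Fin p) → Prop} (hP : ∀ σ τ, eta (arcs z) σ = eta (arcs z) τ → P σ → P τ) :
    (decPermAlgebra k 𝔛).comul (FSum k z P) ∈ LinearMap.range (TensorProduct.map
      (diagramAlgebra k 𝔛 arcs).subtype (diagramAlgebra k 𝔛 arcs).subtype) := by
  classical
  rw [FSum, map_sum]
  simp only [comul_F]
  rw [Finset.sum_comm' (t' := Finset.univ) (s' := fun A => Finset.univ.filter fun ρ =>
    P ρ ∧ A ∈ prefixes ρ Finset.univ) (by simp)]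
  refine sum_mem fun A _ => ?_
  have hcover : ∀ x, x ∈ Set.range (enum A) ∨ x ∈ Set.range (enum (Finset.univ \ A)) :=
    fun x => by
      rw [mem_range_enum, mem_range_enum]
      simpa using em _
  have hS : ∀ j, enum (Finset.univ \ A) j ∉ A := fun j =>
    (Finset.mem_sdiff.1 (enum_mem _ j)).2
  have hpre : ∀ ρ, A ∈ prefixes ρ Finset.univ ↔
      ∀ i j, Bef ρ (enum A i) (enum (Finset.univ \ A) j) := by
    intro ρ
    rw [mem_prefixes]
    constructor
    · exact fun h i j => h.2 _ (enum_mem A i) _ (Finset.mem_univ _) (hS j)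
    · refine fun h => ⟨Finset.subset_univ _, fun u hu v _ hv => ?_⟩
      obtain ⟨i, rfl⟩ := mem_range_enum.2 hu
      obtain ⟨j, rfl⟩ := (hcover v).resolve_left fun h => hv (mem_range_enum.1 h)
      exact h i j
  choose glue hg1 hg2 hg3 using exists_glue hcover fun i j e => hS j (e ▸ enum_mem A i)
  have hnot : ∀ j, enum (Finset.univ \ A) j ∉ Set.range (enum A) := fun j => by
    rw [mem_range_enum]
    exact hS j
  have hnot' : ∀ i, enum A i ∉ Set.range (enum (Finset.univ \ A)) := fun i => by
    rw [mem_range_enum]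
    exact fun h => (Finset.mem_sdiff.1 h).2 (enum_mem A i)
  have e : (∑ ρ ∈ Finset.univ.filter (fun ρ => P ρ ∧ A ∈ prefixes ρ Finset.univ),
      FSub k ρ z A ⊗ₜ[k] FSub k ρ z (Finset.univ \ A)) =
      ∑ σ, F k σ (𝔛.select z (enum A)) ⊗ₜ[k]
        FSum k (𝔛.select z (enum (Finset.univ \ A))) (fun τ => P (glue σ τ)) := by
    simp only [FSum, TensorProduct.tmul_sum]
    rw [Finset.sum_sigma']
    refine Finset.sum_bij' (fun ρ _ => ⟨stdVal ρ (enum A), stdVal ρ (enum (Finset.univ \ A))⟩)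
      (fun a _ => glue a.1 a.2) ?_ ?_ ?_ ?_ ?_
    · intro ρ h
      rw [Finset.mem_filter, hpre] at h
      simp only [Finset.mem_sigma, Finset.mem_univ, Finset.mem_filter, true_and]
      rw [← glue_ext hcover h.2.2 (hg1 _ _) (hg2 _ _).symm (hg3 _ _).symm]
      exact h.2.1
    · rintro ⟨σ, τ⟩ h
      simp only [Finset.mem_sigma, Finset.mem_univ, Finset.mem_filter, true_and] at h ⊢
      exact ⟨h, (hpre _).2 (hg1 σ τ)⟩
    · intro ρ h
      rw [Finset.mem_filter, hpre] at h
      exact (glue_ext hcover h.2.2 (hg1 _ _) (hg2 _ _).symm (hg3 _ _).symm).symm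
    · rintro ⟨σ, τ⟩ _
      simp only [hg2, hg3]
    · intro ρ _
      rfl
  rw [e]
  have step : ∀ ρ ρ', ArcStep (arcs z).carrier ρ ρ' → P ρ = P ρ' := fun ρ ρ' h =>
    propext ⟨hP _ _ (eta_eq_of_arcStep h), hP _ _ (eta_eq_of_arcStep h).symm⟩
  refine sum_tmul_mem _ _ (fun σ σ' τ h => ?_) (fun σ τ τ' h => ?_)
  · refine (iff_of_eq (arcSetoid_induction (fun σ => P (glue σ τ)) (fun σ σ' h => ?_)
      (eta_eq_iff.1 h))).1
    obtain ⟨ρ', h1, h2, h3⟩ := arcStep_lift hc (ρ := glue σ τ) z (enum A) (fun i j y _ h2 => by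
      refine (hcover y).resolve_right ?_
      rintro ⟨l, rfl⟩
      exact h2.asymm (hg1 σ τ j l)) (by rwa [hg2])
    rw [step _ _ h1]
    congr 1
    refine glue_ext hcover (fun i j => (h3 _ _ (Or.inr (hnot j))).2 (hg1 σ τ i j)) (hg1 _ _)
      (by rw [h2, hg2]) ?_
    rw [hg3, ← hg3 σ τ]
    refine perm_ext_bef fun u v huv => ?_
    rw [bef_stdVal] at huv ⊢
    exact (h3 _ _ (Or.inl (hnot u))).1 huv
  · refine (iff_of_eq (arcSetoid_induction (fun τ => P (glue σ τ)) (fun τ τ' h => ?_)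
      (eta_eq_iff.1 h))).1
    obtain ⟨ρ', h1, h2, h3⟩ := arcStep_lift hc (ρ := glue σ τ) z (enum (Finset.univ \ A))
      (fun i j y h1 _ => by
        refine (hcover y).resolve_left ?_
        rintro ⟨l, rfl⟩
        exact Bef.asymm h1 (hg1 σ τ l i)) (by rwa [hg3])
    rw [step _ _ h1]
    congr 1
    refine glue_ext hcover (fun i j => (h3 _ _ (Or.inl (hnot' i))).2 (hg1 σ τ i j)) (hg1 _ _) ?_
      (by rw [h2, hg3])
    rw [hg2, ← hg2 σ τ]
    refine perm_ext_bef fun u v huv => ?_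
    rw [bef_stdVal] at huv ⊢
    exact (h3 _ _ (Or.inl (hnot' u))).1 huv

theorem isHopfSubalgebra_diagramAlgebra (hc : IsConservative 𝔛 arcs) :
    IsHopfSubalgebra (decPermAlgebra k 𝔛) (diagramAlgebra k 𝔛 arcs) where
  one_mem := by
    change F k 1 𝔛.empty ∈ _
    rw [F_eq_FSum]
    refine FSum_mem_diagramAlgebra _ fun σ τ _ _ => Equiv.ext fun i => i.elim0
  mul_mem x hx y hy := by
    induction hx using Submodule.span_induction with
    | zero => simp
    | add v w _ _ hv hw =>
      rw [map_add, LinearMap.add_apply]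
      exact add_mem hv hw
    | smul c v _ hv =>
      rw [map_smul, LinearMap.smul_apply]
      exact Submodule.smul_mem _ c hv
    | mem v h =>
      obtain ⟨m, x, D, -, -, rfl⟩ := h
      induction hy using Submodule.span_induction with
      | zero => simp
      | add v w _ _ hv hw =>
        rw [map_add]
        exact add_mem hv hw
      | smul c v _ hv =>
        rw [map_smul]
        exact Submodule.smul_mem _ c hv
      | mem v h =>
        obtain ⟨n, y, E, -, -, rfl⟩ := h
        rw [mul_FSum]
        refine FSum_mem_diagramAlgebra _ fun σ τ h => ?_
        rw [arcSetoid_induction _ (fun _ _ => eta_stdVal_castAdd hc x y) (eta_eq_iff.1 h),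
          arcSetoid_induction _ (fun _ _ => eta_stdVal_natAdd hc x y) (eta_eq_iff.1 h)]
        exact id
  comul_mem x hx := by
    induction hx using Submodule.span_induction with
    | zero => simp
    | add v w _ _ hv hw =>
      rw [map_add]
      exact add_mem hv hw
    | smul c v _ hv =>
      rw [map_smul]
      exact Submodule.smul_mem _ c hv
    | mem v h =>
      obtain ⟨m, x, D, -, -, rfl⟩ := h
      exact comul_FSum_mem hc x fun σ τ h h' => h.symm.trans h'
  homogeneous := by
    refine homogeneous_of_span _ _ ?_
    rintro v ⟨n, x, D, -, -, rfl⟩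
    exact ⟨n, FSum_mem_gr x _⟩

theorem IsHopfMorphism.map_isHopfSubalgebra {k : Type*} [Field k] {V V' : Type*}
    [AddCommGroup V] [Module k V] [AddCommGroup V'] [Module k V'] {A : HopfData k V}
    {B : HopfData k V'} {f : V →ₗ[k] V'} (hf : IsHopfMorphism A B f) {W : Submodule k V}
    (hW : IsHopfSubalgebra A W) : IsHopfSubalgebra B (W.map f) where
  one_mem := ⟨A.one, hW.one_mem, hf.map_one⟩
  mul_mem := by
    rintro _ ⟨x, hx, rfl⟩ _ ⟨y, hy, rfl⟩
    exact ⟨_, hW.mul_mem x hx y hy, hf.map_mul x y⟩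
  comul_mem := by
    rintro _ ⟨x, hx, rfl⟩
    rw [hf.map_comul]
    obtain ⟨t, ht⟩ := hW.comul_mem x hx
    rw [← ht]
    have hW' : ∀ x ∈ W, f x ∈ W.map f := fun x hx => ⟨x, hx, rfl⟩
    refine ⟨TensorProduct.map (f.restrict hW') (f.restrict hW') t, ?_⟩
    rw [← LinearMap.comp_apply, ← LinearMap.comp_apply, ← TensorProduct.map_comp,
      ← TensorProduct.map_comp]
    rfl
  homogeneous := by
    refine le_antisymm ?_ (iSup_le fun n => inf_le_left)
    conv_lhs => rw [hW.homogeneous, Submodule.map_iSup]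
    refine iSup_mono fun n => ?_
    rintro _ ⟨x, hx, rfl⟩
    exact ⟨⟨x, hx.1, rfl⟩, hf.map_gr n x hx.2⟩

end Subalgebra

/-! ### Extended arc ideals form a decoration set -/

/-- The part of an arc between `l` and `r`, shifted by `m` to the left. -/
def RawArc.part (γ : RawArc) (l r m : ℕ) : RawArc :=
  ⟨l - m, r - m, (γ.above ∩ Finset.Ioo l r).image (· - m)⟩

theorem RawArc.mem_part_above {γ : RawArc} {l r m : ℕ} (h : m ≤ l) {x : ℕ} :
    x ∈ (γ.part l r m).above ↔ x + m ∈ γ.above ∧ l < x + m ∧ x + m < r := by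
  simp only [part, Finset.mem_image, Finset.mem_inter, Finset.mem_Ioo]
  constructor
  · rintro ⟨y, hy, rfl⟩
    rwa [Nat.sub_add_cancel (by omega)]
  · exact fun h => ⟨x + m, h, by omega⟩

theorem RawArc.part_part {γ : RawArc} {l r m l' r' m' : ℕ} (h : m ≤ l) (hl : l ≤ l' + m)
    (hr : r' + m ≤ r) (h' : m' ≤ l') :
    (γ.part l r m).part l' r' m' = γ.part (l' + m) (r' + m) (m' + m) := by
  refine RawArc.ext ?_ ?_ (Finset.ext fun x => ?_)
  · simp only [part]
    omega
  · simp only [part]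
    omega
  · rw [mem_part_above h', mem_part_above h, mem_part_above (by omega), ← add_assoc]
    constructor
    · rintro ⟨⟨h1, h2, h3⟩, h4, h5⟩
      exact ⟨h1, by omega, by omega⟩
    · rintro ⟨h1, h4, h5⟩
      exact ⟨⟨h1, by omega, by omega⟩, by omega, by omega⟩

theorem RawArc.part_self {γ : RawArc} (h : γ.above ⊆ Finset.Ioo γ.left γ.right) :
    γ.part γ.left γ.right 0 = γ := by
  refine RawArc.ext rfl rfl (Finset.ext fun x => ?_)
  rw [mem_part_above (by omega), add_zero]
  exact ⟨fun h => h.1, fun hx => ⟨hx, Finset.mem_Ioo.1 (h hx)⟩⟩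

theorem RawArc.isExtArc_part {n : ℕ} {γ : RawArc} {l r m : ℕ} (hm : m ≤ l) (hlr : l < r)
    (hr : r ≤ n + m + 1) : IsExtArc n (γ.part l r m) := by
  refine ⟨by simp only [RawArc.part]; omega, by simp only [RawArc.part]; omega, fun x hx => ?_⟩
  rw [RawArc.mem_part_above hm] at hx
  simp only [RawArc.part, Finset.mem_Ioo]
  omega

/-- Membership in a concatenation, in terms of the two parts of an arc. -/
def IsGlued (m n : ℕ) (P Q : RawArc → Prop) (γ : RawArc) : Prop :=
  IsExtArc (m + n) γ ∧ (γ.left ≤ m → P (γ.part γ.left (min γ.right (m + 1)) 0)) ∧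
    (m + 1 ≤ γ.right → Q (γ.part (max γ.left m) γ.right m))

/-- The edge from m to m + 1 belongs to both ideals, so the left part of an arc ends at m + 1 at the
latest and the right part starts at m at the earliest. The criterion treats the three kinds of arcs
of a concatenation uniformly and reduces associativity and the unit laws to cutting twice. -/
theorem ExtArcIdeal.mem_concat {m n : ℕ} {I : ExtArcIdeal m} {J : ExtArcIdeal n} {γ : RawArc} :
    γ ∈ (I.concat J).carrier ↔ IsGlued m n (· ∈ I.carrier) (· ∈ J.carrier) γ := by
  constructor
  · intro hγ
    refine ⟨(I.concat J).isExtArc γ hγ, ?_⟩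
    obtain ((⟨h, hr⟩ | ⟨β, h, hl, rfl⟩) | ⟨α, hα, β, hβ, hr, hl, rfl⟩) := hγ
    · refine ⟨fun _ => ?_, fun h => by omega⟩
      rw [min_eq_left (by omega), RawArc.part_self (I.isExtArc γ h).2.2]
      exact h
    · refine ⟨fun h => by simp only [RawArc.shift] at h; omega, fun _ => ?_⟩
      convert h using 1
      have hb := (J.isExtArc β h).2.2
      refine RawArc.ext ?_ ?_ (Finset.ext fun x => ?_)
      · simp only [RawArc.part, RawArc.shift]
        omega
      · simp only [RawArc.part, RawArc.shift]
        omega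
      · rw [RawArc.mem_part_above (by omega)]
        simp only [RawArc.shift, Finset.mem_image, add_left_inj, exists_eq_right]
        refine ⟨fun h => h.1, fun hx => ⟨hx, ?_⟩⟩
        have := Finset.mem_Ioo.1 (hb hx)
        omega
    · have ha := (I.isExtArc α hα).2.2
      have hb := J.isExtArc β hβ
      refine ⟨fun h => ?_, fun h => ?_⟩
      · convert hα using 1
        refine RawArc.ext ?_ ?_ (Finset.ext fun x => ?_)
        · simp only [RawArc.part, RawArc.shift, RawArc.juxt]
          omega
        · have := hb.1
          simp only [RawArc.part, RawArc.shift, RawArc.juxt]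
          omega
        · rw [RawArc.mem_part_above (by omega)]
          have := hb.1
          simp only [RawArc.shift, RawArc.juxt, Finset.mem_image, Finset.mem_union, add_zero]
          constructor
          · rintro ⟨h1 | ⟨y, hy, rfl⟩, h2⟩
            · exact h1
            · have := Finset.mem_Ioo.1 (hb.2.2 hy)
              omega
          · intro hx
            have := Finset.mem_Ioo.1 (ha hx)
            exact ⟨Or.inl hx, by omega, by omega⟩
      · convert hβ using 1
        have := (I.isExtArc α hα).1
        refine RawArc.ext ?_ ?_ (Finset.ext fun x => ?_)
        · simp only [RawArc.part, RawArc.shift, RawArc.juxt]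
          omega
        · simp only [RawArc.part, RawArc.shift, RawArc.juxt]
          omega
        · rw [RawArc.mem_part_above (by omega)]
          simp only [RawArc.shift, RawArc.juxt, Finset.mem_image, Finset.mem_union, add_left_inj,
            exists_eq_right]
          constructor
          · rintro ⟨h1 | h1, h2⟩
            · have := Finset.mem_Ioo.1 (ha h1)
              omega
            · exact h1
          · intro hx
            have := Finset.mem_Ioo.1 (hb.2.2 hx)
            exact ⟨Or.inr hx, by omega, by omega⟩
  · rintro ⟨⟨h1, h2, h3⟩, hI, hJ⟩
    by_cases hr : γ.right ≤ m
    · have := hI (by omega)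
      rw [min_eq_left (by omega), RawArc.part_self h3] at this
      exact Or.inl (Or.inl ⟨this, hr⟩)
    have hJ := hJ (by omega)
    by_cases hl : m + 1 ≤ γ.left
    · rw [max_eq_left (by omega)] at hJ
      refine Or.inl (Or.inr ⟨_, hJ, by simp only [RawArc.part]; omega, ?_⟩)
      refine RawArc.ext ?_ ?_ (Finset.ext fun x => ?_)
      · simp only [RawArc.part, RawArc.shift]
        omega
      · simp only [RawArc.part, RawArc.shift]
        omega
      · simp only [RawArc.shift, Finset.mem_image, RawArc.mem_part_above (show m ≤ γ.left by omega)]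
        constructor
        · intro hx
          have := Finset.mem_Ioo.1 (h3 hx)
          refine ⟨x - m, ?_, by omega⟩
          rw [Nat.sub_add_cancel (by omega)]
          exact ⟨hx, this⟩
        · rintro ⟨y, ⟨hy, -⟩, rfl⟩
          exact hy
    · have hI := hI (by omega)
      rw [min_eq_right (by omega)] at hI
      rw [max_eq_right (by omega)] at hJ
      refine Or.inr ⟨_, hI, _, hJ, rfl, by simp [RawArc.part], ?_⟩
      refine RawArc.ext rfl ?_ (Finset.ext fun x => ?_)
      · simp only [RawArc.part, RawArc.shift, RawArc.juxt]
        omega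
      · simp only [RawArc.juxt, RawArc.shift, Finset.mem_union, Finset.mem_image,
          RawArc.mem_part_above le_rfl, RawArc.mem_part_above (Nat.zero_le _), add_zero]
        constructor
        · intro hx
          have := Finset.mem_Ioo.1 (h3 hx)
          by_cases hxm : x < m + 1
          · exact Or.inl ⟨hx, this.1, hxm⟩
          · refine Or.inr ⟨x - m, ?_, by omega⟩
            rw [Nat.sub_add_cancel (by omega)]
            exact ⟨hx, by omega, this.2⟩
        · rintro (⟨hx, -⟩ | ⟨y, ⟨hy, -⟩, rfl⟩)
          · exact hx
          · exact hy

theorem ExtArcIdeal.sigma_ext {m n : ℕ} {I : ExtArcIdeal m} {J : ExtArcIdeal n} (h : m = n)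
    (hc : I.carrier = J.carrier) : (⟨m, I⟩ : Σ n, ExtArcIdeal n) = ⟨n, J⟩ := by
  subst h
  rw [ExtArcIdeal.ext hc]

/-- Both sides say that the three parts of γ lie in I, J and K, because a part of a part is a part
(`RawArc.part_part`). -/
theorem ExtArcIdeal.concat_assoc {m n p : ℕ} (I : ExtArcIdeal m) (J : ExtArcIdeal n)
    (K : ExtArcIdeal p) :
    ((I.concat J).concat K).carrier = (I.concat (J.concat K)).carrier := by
  ext γ
  simp only [mem_concat, IsGlued]
  rw [add_assoc]
  refine and_congr_right fun hγ => ?_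
  have hγ' := hγ.1
  have hγ'' := hγ.2.1
  constructor
  · rintro ⟨hI, hK⟩
    refine ⟨fun hl => ?_, fun hr => ⟨RawArc.isExtArc_part (by omega) (by omega) (by omega), fun hl => ?_,
      fun hr' => ?_⟩⟩
    · have := (hI (by omega)).2.1 (by simp only [RawArc.part]; omega)
      rw [RawArc.part_part (by omega) (by simp only [RawArc.part]; omega)
        (by simp only [RawArc.part]; omega) (by omega)] at this
      convert this using 2 <;> (try simp only [RawArc.part]) <;> omega
    · simp only [RawArc.part] at hl
      have := (hI (by omega)).2.2 (by simp only [RawArc.part]; omega)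
      rw [RawArc.part_part (by omega) (by simp only [RawArc.part]; omega)
        (by simp only [RawArc.part]; omega) (by omega)] at this
      rw [RawArc.part_part (by omega) (by simp only [RawArc.part]; omega)
        (by simp only [RawArc.part]; omega) (by omega)]
      convert this using 2 <;> (try simp only [RawArc.part]) <;> omega
    · simp only [RawArc.part] at hr'
      have := hK (by omega)
      rw [RawArc.part_part (by omega) (by simp only [RawArc.part]; omega)
        (by simp only [RawArc.part]; omega) (by omega)]
      convert this using 2 <;> (try simp only [RawArc.part]) <;> omega
  · rintro ⟨hI, hJK⟩
    refine ⟨fun hl => ⟨RawArc.isExtArc_part (by omega) (by omega) (by omega), fun hl' => ?_, fun hr => ?_⟩,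
      fun hr => ?_⟩
    · simp only [RawArc.part] at hl'
      have := hI (by omega)
      rw [RawArc.part_part (by omega) (by simp only [RawArc.part]; omega)
        (by simp only [RawArc.part]; omega) (by omega)]
      convert this using 2 <;> (try simp only [RawArc.part]) <;> omega
    · simp only [RawArc.part] at hr
      have := (hJK (by omega)).2.1 (by simp only [RawArc.part]; omega)
      rw [RawArc.part_part (by omega) (by simp only [RawArc.part]; omega)
        (by simp only [RawArc.part]; omega) (by omega)] at this
      rw [RawArc.part_part (by omega) (by simp only [RawArc.part]; omega)
        (by simp only [RawArc.part]; omega) (by omega)]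
      convert this using 2 <;> (try simp only [RawArc.part]) <;> omega
    · have := (hJK (by omega)).2.2 (by simp only [RawArc.part]; omega)
      rw [RawArc.part_part (by omega) (by simp only [RawArc.part]; omega)
        (by simp only [RawArc.part]; omega) (by omega)] at this
      convert this using 2 <;> (try simp only [RawArc.part]) <;> omega

theorem ExtArcIdeal.unit_concat {n : ℕ} (I : ExtArcIdeal n) :
    (ExtArcIdeal.unit.concat I).carrier = I.carrier := by
  ext γ
  rw [mem_concat, IsGlued, zero_add]
  constructor
  · rintro ⟨⟨h1, -, h3⟩, -, h⟩
    have := h (by omega)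
    rwa [max_eq_left (by omega), RawArc.part_self h3] at this
  · intro h
    have hγ := I.isExtArc γ h
    have := hγ.1
    refine ⟨hγ, fun _ => RawArc.isExtArc_part (by omega) (by omega) (by omega), fun _ => ?_⟩
    rwa [max_eq_left (by omega), RawArc.part_self hγ.2.2]

theorem ExtArcIdeal.concat_unit {n : ℕ} (I : ExtArcIdeal n) :
    I.concat ExtArcIdeal.unit = I := by
  refine ExtArcIdeal.ext (Set.ext fun γ => ?_)
  rw [mem_concat, IsGlued]
  constructor
  · rintro ⟨⟨h1, h2, h3⟩, h, -⟩
    have := h (by omega)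
    rwa [min_eq_left (by omega), RawArc.part_self h3] at this
  · intro h
    have hγ := I.isExtArc γ h
    have h1 := hγ.1
    have h2 := hγ.2.1
    refine ⟨hγ, fun _ => ?_, fun _ => RawArc.isExtArc_part (by omega) (by omega) (by omega)⟩
    rwa [min_eq_left (by omega), RawArc.part_self hγ.2.2]

/-! ### Selection -/

theorem extEnum_zero {p q : ℕ} (R : Fin q ↪o Fin p) : extEnum R 0 = 0 := if_pos rfl

theorem extEnum_top {p q : ℕ} (R : Fin q ↪o Fin p) {i : ℕ} (h : q < i) :
    extEnum R i = p + 1 := by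
  rw [extEnum, if_neg (by omega), dif_neg (by omega)]

theorem extEnum_succ {p q : ℕ} (R : Fin q ↪o Fin p) (i : Fin q) :
    extEnum R ((i : ℕ) + 1) = (R i : ℕ) + 1 := by
  rw [extEnum, if_neg (by omega), dif_pos (by simp)]
  simp

theorem extEnum_cases {q : ℕ} {i : ℕ} :
    i = 0 ∨ q < i ∨ ∃ j : Fin q, i = (j : ℕ) + 1 := by
  by_cases h0 : i = 0
  · exact Or.inl h0
  by_cases h1 : q < i
  · exact Or.inr (Or.inl h1)
  · exact Or.inr (Or.inr ⟨⟨i - 1, by omega⟩, by simp only; omega⟩)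

theorem extEnum_lt_iff {p q : ℕ} (R : Fin q ↪o Fin p) {i j : ℕ} (hi : i ≤ q + 1)
    (hj : j ≤ q + 1) : extEnum R i < extEnum R j ↔ i < j := by
  refine ⟨fun h => ?_, fun h => extEnum_strict R h hj⟩
  by_contra hij
  rcases (not_lt.1 hij).lt_or_eq with h' | rfl
  · have := extEnum_strict R h' hi
    omega
  · omega

theorem mem_selSet_iff {p q : ℕ} (R : Fin q ↪o Fin p) {x : ℕ} :
    x ∈ selSet R ↔ ∃ i, 1 ≤ i ∧ i ≤ q ∧ extEnum R i = x := by
  constructor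
  · rintro ⟨i, rfl⟩
    exact ⟨i + 1, by omega, i.isLt, extEnum_succ R i⟩
  · rintro ⟨i, h1, h2, rfl⟩
    exact extEnum_mem R h1 h2

/-- No bound on i is needed: 0 goes to 0, and every index that is too large goes to the upper end
point. -/
theorem extEnum_trans {p q s : ℕ} (R : Fin q ↪o Fin p) (S : Fin s ↪o Fin q) (i : ℕ) :
    extEnum (S.trans R) i = extEnum R (extEnum S i) := by
  rcases extEnum_cases (q := s) (i := i) with rfl | h | ⟨j, rfl⟩
  · simp only [extEnum_zero]
  · rw [extEnum_top _ h, extEnum_top _ h, extEnum_top _ (by omega)]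
  · rw [extEnum_succ, extEnum_succ, extEnum_succ]
    rfl

theorem extEnum_le {p q : ℕ} (R : Fin q ↪o Fin p) (i : ℕ) : extEnum R i ≤ p + 1 := by
  rcases extEnum_cases (q := q) (i := i) with rfl | h | ⟨j, rfl⟩
  · rw [extEnum_zero]
    omega
  · rw [extEnum_top _ h]
  · rw [extEnum_succ]
    omega

theorem ArcPath.mono {C : Set RawArc} {X Y : Set ℕ} (hXY : Y ⊆ X) {a b : ℕ} {T : Finset ℕ}
    (h : ArcPath C X a b T) : ArcPath C Y a b T := by
  induction h with
  | single a b S h => exact .single a b S h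
  | cons a y b S T h hy _ ih => exact .cons a y b S T h (fun e => hy (hXY e)) ih

theorem ArcPath.append {C : Set RawArc} {X : Set ℕ} {a y b : ℕ} {S T : Finset ℕ}
    (h : ArcPath C X a y S) (hy : y ∉ X) (h' : ArcPath C X y b T) : ArcPath C X a b (S ∪ T) := by
  induction h with
  | single a y S h => exact .cons a y b S T h hy h'
  | cons a z y S U h hz _ ih =>
    rw [Finset.union_assoc]
    exact .cons a z b S _ h hz (ih hy h')

theorem ExtArcIdeal.pathBounds {p : ℕ} (K : ExtArcIdeal p) {X : Set ℕ} {a b : ℕ} {T : Finset ℕ}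
    (h : ArcPath K.carrier X a b T) : a < b ∧ T ⊆ Finset.Ioo a b :=
  h.bounds fun α h => ⟨(K.isExtArc α h).1, (K.isExtArc α h).2.2⟩

theorem ExtArcIdeal.mem_select {p q : ℕ} {K : ExtArcIdeal p} {R : Fin q ↪o Fin p} {α : RawArc} :
    α ∈ (K.select R).carrier ↔ α.left < α.right ∧ α.right ≤ q + 1 ∧
      ∃ T, ArcPath K.carrier (selSet R) (extEnum R α.left) (extEnum R α.right) T ∧
        α.above = (Finset.Icc 1 q).filter fun l => extEnum R l ∈ T := Iff.rfl

theorem ExtArcIdeal.mem_select_of_path {p q : ℕ} {K : ExtArcIdeal p} {R : Fin q ↪o Fin p}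
    {a b : ℕ} {T : Finset ℕ} (hb : b ≤ q + 1) (ha : a ≤ q + 1)
    (h : ArcPath K.carrier (selSet R) (extEnum R a) (extEnum R b) T) :
    (⟨a, b, (Finset.Icc 1 q).filter fun l => extEnum R l ∈ T⟩ : RawArc) ∈ (K.select R).carrier :=
  ⟨(extEnum_lt_iff R ha hb).1 (K.pathBounds h).1, hb, T, h, rfl⟩

/-- Every vertex of [n] is selected, so a path has no interior vertex and consists of a single arc.
-/
theorem ExtArcIdeal.select_self {n : ℕ} (K : ExtArcIdeal n) (R : Fin n ↪o Fin n) :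
    K.select R = K := by
  have hR : ∀ i ≤ n + 1, extEnum R i = i := by
    intro i hi
    rcases extEnum_cases (q := n) (i := i) with rfl | h | ⟨j, rfl⟩
    · exact extEnum_zero R
    · rw [extEnum_top R h]
      omega
    · rw [extEnum_succ, show R j = j from DFunLike.congr_fun (orderEmb_fin_eq (S := RelEmbedding.refl _) <| by
        rw [(Finite.injective_iff_surjective.1 R.injective).range_eq]
        exact Set.range_id.symm) j]
  have hfil : ∀ {a b : ℕ} {T : Finset ℕ}, a < b → b ≤ n + 1 → T ⊆ Finset.Ioo a b →
      (Finset.Icc 1 n).filter (fun l => extEnum R l ∈ T) = T := by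
    intro a b T hab hb hT
    ext x
    rw [Finset.mem_filter, Finset.mem_Icc]
    constructor
    · rintro ⟨h, h'⟩
      rwa [hR x (by omega)] at h'
    · intro hx
      have := Finset.mem_Ioo.1 (hT hx)
      refine ⟨by omega, ?_⟩
      rwa [hR x (by omega)]
  refine ExtArcIdeal.ext (Set.ext fun α => ?_)
  rw [mem_select]
  constructor
  · rintro ⟨h1, h2, T, hp, hT⟩
    rw [hR _ (by omega), hR _ (by omega)] at hp
    have hb := K.pathBounds hp
    rw [hfil h1 h2 hb.2] at hT
    cases hp with
    | single _ _ _ h =>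
      convert h using 1
      exact RawArc.ext rfl rfl hT
    | cons _ y _ _ _ h hy hp =>
      refine absurd ((mem_selSet_iff R).2 ⟨y, ?_, ?_, hR y ?_⟩) hy
      · have : α.left < y := (K.isExtArc _ h).1
        omega
      all_goals
        have := (K.pathBounds hp).1
        omega
  · intro h
    obtain ⟨h1, h2, h3⟩ := K.isExtArc α h
    refine ⟨h1, h2, α.above, ?_, (hfil h1 h2 h3).symm⟩
    rw [hR _ (by omega), hR _ (by omega)]
    exact .single _ _ _ h

/-- Each arc of the selection is replaced by a path that witnesses it. The interior vertices of
these paths avoid R, and their joints avoid S, so the concatenated path avoids the composed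
selection. -/
theorem ArcPath.of_select {p q s : ℕ} {K : ExtArcIdeal p} {R : Fin q ↪o Fin p}
    {S : Fin s ↪o Fin q} {a b : ℕ} {T : Finset ℕ}
    (h : ArcPath (K.select R).carrier (selSet S) a b T) :
    ∃ T', ArcPath K.carrier (selSet (S.trans R)) (extEnum R a) (extEnum R b) T' ∧
      ∀ l, 1 ≤ l → l ≤ q → (extEnum R l ∈ T' ↔ l ∈ T) := by
  have hsub : selSet (S.trans R) ⊆ selSet R := by
    rintro _ ⟨i, rfl⟩
    exact ⟨S i, rfl⟩
  induction h with
  | single a b U h =>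
    obtain ⟨h1, h2, T, hp, hT⟩ := h
    refine ⟨T, hp.mono hsub, fun l hl hl' => ?_⟩
    simp only at hT
    rw [hT, Finset.mem_filter, Finset.mem_Icc]
    exact ⟨fun h => ⟨⟨hl, hl'⟩, h⟩, fun h => h.2⟩
  | cons a y b U V h hy hp ih =>
    obtain ⟨h1, h2, T, hp', hT⟩ := h
    obtain ⟨T', hT1, hT2⟩ := ih
    refine ⟨T ∪ T', (hp'.mono hsub).append (fun hyX => hy ?_) hT1, fun l hl hl' => ?_⟩
    · obtain ⟨i, hi⟩ := hyX
      refine ⟨i, ?_⟩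
      simp only at h1 h2
      have hi' : extEnum R ((S i : ℕ) + 1) = extEnum R y := by
        rw [extEnum_succ]
        exact hi
      have := (S i).isLt
      have e1 := (extEnum_lt_iff R (i := y) (j := (S i : ℕ) + 1) h2 (by omega)).2
      have e2 := (extEnum_lt_iff R (i := (S i : ℕ) + 1) (j := y) (by omega) h2).2
      simp only
      omega
    · simp only at hT
      rw [Finset.mem_union, Finset.mem_union, hT2 l hl hl', hT, Finset.mem_filter, Finset.mem_Icc]
      simp [hl, hl']

/-- Conversely, a path is cut at its interior vertices in R, and the pieces are arcs of the first
selection. Here c is the first cut. The start w is arbitrary because the induction moves it through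
vertices outside R. -/
theorem ArcPath.split_select {p q s : ℕ} {K : ExtArcIdeal p} {R : Fin q ↪o Fin p}
    {S : Fin s ↪o Fin q} {w v : ℕ} (hv : v ≤ q + 1) {T : Finset ℕ}
    (h : ArcPath K.carrier (selSet (S.trans R)) w (extEnum R v) T) :
    ArcPath K.carrier (selSet R) w (extEnum R v) T ∨
      ∃ c T₁ T', 1 ≤ c ∧ c ≤ q ∧ c ∉ selSet S ∧ ArcPath K.carrier (selSet R) w (extEnum R c) T₁ ∧
        ArcPath (K.select R).carrier (selSet S) c v T' ∧
        ∀ l, 1 ≤ l → l ≤ q → (extEnum R l ∈ T ↔ extEnum R l ∈ T₁ ∨ l ∈ T') := by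
  generalize hb : extEnum R v = b at h
  induction h with
  | single a b U h => exact Or.inl (.single a b U h)
  | cons a y b U V h hy hp ih =>
    subst hb
    by_cases hyR : y ∈ selSet R
    · obtain ⟨c, hc1, hc2, rfl⟩ := (mem_selSet_iff R).1 hyR
      have hcS : c ∉ selSet S := by
        rintro ⟨i, rfl⟩
        refine hy ⟨i, ?_⟩
        simp only
        rw [extEnum_succ]
        rfl
      rcases ih rfl with h' | ⟨c', T₁, T', hc1', hc2', hcS', h1, h2, h3⟩
      · refine Or.inr ⟨c, U, (Finset.Icc 1 q).filter fun l => extEnum R l ∈ V, hc1, hc2, hcS,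
          .single _ _ _ h, .single _ _ _ (ExtArcIdeal.mem_select_of_path hv (by omega) h'),
          fun l hl hl' => ?_⟩
        rw [Finset.mem_union, Finset.mem_filter, Finset.mem_Icc]
        simp [hl, hl']
      · refine Or.inr ⟨c, U, ((Finset.Icc 1 q).filter fun l => extEnum R l ∈ T₁) ∪ T', hc1, hc2,
          hcS, .single _ _ _ h, .cons c c' v _ _ (ExtArcIdeal.mem_select_of_path (by omega)
            (by omega) h1) hcS' h2, fun l hl hl' => ?_⟩
        rw [Finset.mem_union, Finset.mem_union, Finset.mem_filter, Finset.mem_Icc, h3 l hl hl']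
        simp [hl, hl']
    · rcases ih rfl with h' | ⟨c', T₁, T', hc1', hc2', hcS', h1, h2, h3⟩
      · exact Or.inl (.cons a y _ U V h hyR h')
      · refine Or.inr ⟨c', U ∪ T₁, T', hc1', hc2', hcS', .cons a y _ U T₁ h hyR h1, h2,
          fun l hl hl' => ?_⟩
        rw [Finset.mem_union, Finset.mem_union, h3 l hl hl', or_assoc]

theorem ExtArcIdeal.select_select {p q s : ℕ} (K : ExtArcIdeal p) (R : Fin q ↪o Fin p)
    (S : Fin s ↪o Fin q) : (K.select R).select S = K.select (S.trans R) := by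
  refine ExtArcIdeal.ext (Set.ext fun α => ?_)
  rw [mem_select, mem_select]
  refine and_congr_right fun h1 => and_congr_right fun h2 => ?_
  have hS : ∀ l, 1 ≤ l → l ≤ s → 1 ≤ extEnum S l ∧ extEnum S l ≤ q := by
    intro l hl hl'
    rcases extEnum_cases (q := s) (i := l) with rfl | h | ⟨j, rfl⟩
    · omega
    · omega
    · rw [extEnum_succ]
      omega
  simp only [extEnum_trans]
  constructor
  · rintro ⟨T, hp, hT⟩
    obtain ⟨T', hp', hT'⟩ := hp.of_select
    refine ⟨T', hp', hT.trans (Finset.filter_congr fun l hl => ?_)⟩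
    obtain ⟨hl, hl'⟩ := Finset.mem_Icc.1 hl
    exact (hT' _ (hS l hl hl').1 (hS l hl hl').2).symm
  · rintro ⟨T, hp, hT⟩
    rcases hp.split_select (extEnum_le S _) with h | ⟨c, T₁, T', hc1, hc2, hcS, hp1, hp2, h⟩
    · refine ⟨_, .single _ _ _ (mem_select_of_path (extEnum_le S _) (extEnum_le S _) h),
        hT.trans (Finset.filter_congr fun l hl => ?_)⟩
      obtain ⟨hl, hl'⟩ := Finset.mem_Icc.1 hl
      rw [Finset.mem_filter, Finset.mem_Icc]
      simp [hS l hl hl']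
    · refine ⟨_, .cons _ c _ _ _ (mem_select_of_path (by omega) (extEnum_le S _) hp1) hcS hp2,
        hT.trans (Finset.filter_congr fun l hl => ?_)⟩
      obtain ⟨hl, hl'⟩ := Finset.mem_Icc.1 hl
      rw [Finset.mem_union, Finset.mem_filter, Finset.mem_Icc,
        h _ (hS l hl hl').1 (hS l hl hl').2]
      simp [hS l hl hl']

/-! ### Selection commutes with concatenation -/

theorem extEnum_blockEmb_left {m n q s : ℕ} (R : Fin q ↪o Fin m) (S : Fin s ↪o Fin n) {i : ℕ}
    (h : i ≤ q) : extEnum (blockEmb R S) i = extEnum R i := by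
  rcases extEnum_cases (q := q) (i := i) with rfl | h' | ⟨j, rfl⟩
  · simp only [extEnum_zero]
  · omega
  · rw [extEnum_succ]
    have := extEnum_succ (blockEmb R S) (Fin.castAdd s j)
    rwa [blockEmb_castAdd] at this

theorem extEnum_blockEmb_right {m n q s : ℕ} (R : Fin q ↪o Fin m) (S : Fin s ↪o Fin n) {i : ℕ}
    (h : q < i) : extEnum (blockEmb R S) i = extEnum S (i - q) + m := by
  obtain ⟨i, rfl⟩ := Nat.exists_eq_add_of_lt h
  rw [show q + i + 1 - q = i + 1 by omega]
  rcases extEnum_cases (q := s) (i := i + 1) with h' | h' | ⟨j, h'⟩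
  · omega
  · rw [extEnum_top S h', extEnum_top _ (by omega)]
    omega
  · obtain rfl : i = j := by omega
    rw [extEnum_succ]
    have := extEnum_succ (blockEmb R S) (Fin.natAdd q j)
    rw [blockEmb_natAdd] at this
    simp only [Fin.val_natAdd] at this
    omega

theorem extEnum_le_of_le {p q : ℕ} (R : Fin q ↪o Fin p) {i : ℕ} (h : i ≤ q) :
    extEnum R i ≤ p := by
  have := extEnum_strict R (show i < q + 1 by omega) le_rfl
  rw [extEnum_top R (show q < q + 1 by omega)] at this
  omega

theorem extEnum_pos {p q : ℕ} (R : Fin q ↪o Fin p) {i : ℕ} (h : 1 ≤ i) : 1 ≤ extEnum R i := by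
  rcases extEnum_cases (q := q) (i := i) with rfl | h' | ⟨j, rfl⟩
  · omega
  · rw [extEnum_top R h']
    omega
  · rw [extEnum_succ]
    omega

theorem mem_selSet_blockEmb_left {m n q s : ℕ} {R : Fin q ↪o Fin m} {S : Fin s ↪o Fin n} {x : ℕ}
    (h : x ≤ m) : x ∈ selSet (blockEmb R S) ↔ x ∈ selSet R := by
  rw [mem_selSet_iff, mem_selSet_iff]
  constructor
  · rintro ⟨i, h1, h2, rfl⟩
    by_cases hi : i ≤ q
    · exact ⟨i, h1, hi, (extEnum_blockEmb_left R S hi).symm⟩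
    · rw [extEnum_blockEmb_right R S (by omega)] at h
      have := extEnum_pos S (show 1 ≤ i - q by omega)
      omega
  · rintro ⟨i, h1, h2, rfl⟩
    exact ⟨i, h1, by omega, extEnum_blockEmb_left R S h2⟩

theorem mem_selSet_blockEmb_right {m n q s : ℕ} {R : Fin q ↪o Fin m} {S : Fin s ↪o Fin n} {x : ℕ}
    (h : 1 ≤ x) : x + m ∈ selSet (blockEmb R S) ↔ x ∈ selSet S := by
  rw [mem_selSet_iff, mem_selSet_iff]
  constructor
  · rintro ⟨i, h1, h2, hx⟩
    by_cases hi : i ≤ q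
    · rw [extEnum_blockEmb_left R S hi] at hx
      have := extEnum_le_of_le R hi
      omega
    · rw [extEnum_blockEmb_right R S (by omega)] at hx
      exact ⟨i - q, by omega, by omega, by omega⟩
  · rintro ⟨i, h1, h2, rfl⟩
    refine ⟨i + q, by omega, by omega, ?_⟩
    rw [extEnum_blockEmb_right R S (by omega), Nat.add_sub_cancel]

section ConcatSelect

variable {m n q s : ℕ} {I : ExtArcIdeal m} {J : ExtArcIdeal n} {R : Fin q ↪o Fin m}
  {S : Fin s ↪o Fin n}

/-- As soon as an arc of the path goes beyond m, its left part ends at m + 1 and completes the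
truncated path; later arcs are dropped. -/
theorem ArcPath.left_part {a b : ℕ} {T : Finset ℕ}
    (h : ArcPath (I.concat J).carrier (selSet (blockEmb R S)) a b T) (ha : a ≤ m) :
    ArcPath I.carrier (selSet R) a (min b (m + 1)) (T ∩ Finset.Ioo a (min b (m + 1))) := by
  have key : ∀ {a b : ℕ} {U : Finset ℕ}, (⟨a, b, U⟩ : RawArc) ∈ (I.concat J).carrier → a ≤ m →
      (⟨a, min b (m + 1), U ∩ Finset.Ioo a (min b (m + 1))⟩ : RawArc) ∈ I.carrier := by
    intro a b U h ha
    have := (ExtArcIdeal.mem_concat.1 h).2.1 ha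
    simpa [RawArc.part] using this
  induction h with
  | single a b U h => exact .single _ _ _ (key h ha)
  | cons a y b U V h hy hp ih =>
    obtain ⟨hay, -, hU⟩ := (I.concat J).isExtArc _ h
    obtain ⟨hyb, hV⟩ := (I.concat J).pathBounds hp
    simp only at hay hU
    have hU' : ∀ x ∈ U, a < x ∧ x < y := fun x hx => Finset.mem_Ioo.1 (hU hx)
    have hV' : ∀ x ∈ V, y < x ∧ x < b := fun x hx => Finset.mem_Ioo.1 (hV hx)
    by_cases hym : y ≤ m
    · have h1 := key h ha
      rw [min_eq_left (by omega)] at h1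
      have h2 := ArcPath.cons a y _ _ _ h1 (fun e => hy ((mem_selSet_blockEmb_left hym).2 e))
        (ih hym)
      convert h2 using 1
      ext x
      simp only [Finset.mem_inter, Finset.mem_union, Finset.mem_Ioo]
      constructor
      · rintro ⟨hx | hx, h3, h4⟩
        · exact Or.inl ⟨hx, hU' x hx⟩
        · exact Or.inr ⟨hx, (hV' x hx).1, h4⟩
      · rintro (⟨hx, h3, h4⟩ | ⟨hx, h3, h4⟩)
        · exact ⟨Or.inl hx, h3, by omega⟩
        · exact ⟨Or.inr hx, by omega, h4⟩
    · have h1 := key h ha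
      rw [min_eq_right (by omega)] at h1 ⊢
      convert ArcPath.single a _ _ h1 using 1
      ext x
      simp only [Finset.mem_inter, Finset.mem_union, Finset.mem_Ioo]
      constructor
      · rintro ⟨hx | hx, h3, h4⟩
        · exact ⟨hx, h3, h4⟩
        · have := hV' x hx
          omega
      · exact fun ⟨hx, h⟩ => ⟨Or.inl hx, h⟩

/-- Arcs that end at m or before are dropped. The sets are compared only at x ≥ 1, because 0 stands
for the vertex m of the other side. -/
theorem ArcPath.right_part {a b : ℕ} {T : Finset ℕ}
    (h : ArcPath (I.concat J).carrier (selSet (blockEmb R S)) a b T) (hb : m + 1 ≤ b) :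
    ∃ U, ArcPath J.carrier (selSet S) (max a m - m) (b - m) U ∧
      ∀ x, 1 ≤ x → (x ∈ U ↔ x + m ∈ T) := by
  have key : ∀ {a b : ℕ} {V : Finset ℕ}, (⟨a, b, V⟩ : RawArc) ∈ (I.concat J).carrier →
      m + 1 ≤ b → ∃ U, (⟨max a m - m, b - m, U⟩ : RawArc) ∈ J.carrier ∧
        ∀ x, 1 ≤ x → (x ∈ U ↔ x + m ∈ V) := by
    intro a b V h hb
    refine ⟨(RawArc.part ⟨a, b, V⟩ (max a m) b m).above, (ExtArcIdeal.mem_concat.1 h).2.2 hb,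
      fun x hx => ?_⟩
    rw [RawArc.mem_part_above (by omega)]
    refine ⟨fun h => h.1, fun hx' => ⟨hx', ?_⟩⟩
    have := Finset.mem_Ioo.1 (((I.concat J).isExtArc _ h).2.2 hx')
    simp only at this ⊢
    omega
  induction h with
  | single a b V h =>
    obtain ⟨U, h1, h2⟩ := key h hb
    exact ⟨U, .single _ _ _ h1, h2⟩
  | cons a y b V W h hy hp ih =>
    obtain ⟨hay, -, hV⟩ := (I.concat J).isExtArc _ h
    simp only at hay hV
    obtain ⟨U, h1, h2⟩ := ih hb
    by_cases hym : y ≤ m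
    · rw [max_eq_right hym] at h1
      refine ⟨U, by rwa [max_eq_right (by omega)], fun x hx => ?_⟩
      rw [h2 x hx, Finset.mem_union]
      refine ⟨Or.inr, fun h => h.resolve_left fun hxV => ?_⟩
      have := Finset.mem_Ioo.1 (hV hxV)
      omega
    · rw [max_eq_left (by omega)] at h1
      obtain ⟨U', h1', h2'⟩ := key h (by omega)
      refine ⟨U' ∪ U, .cons _ _ _ _ _ h1' (fun e => hy ?_) h1, fun x hx => ?_⟩
      · rw [← mem_selSet_blockEmb_right (R := R) (m := m) (by omega),
          Nat.sub_add_cancel (by omega)] at e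
        exact e
      · rw [Finset.mem_union, Finset.mem_union, h2 x hx, h2' x hx]

theorem ArcPath.concat_left {a b : ℕ} {T : Finset ℕ}
    (h : ArcPath I.carrier (selSet R) a b T) (hb : b ≤ m) :
    ArcPath (I.concat J).carrier (selSet (blockEmb R S)) a b T := by
  induction h with
  | single a b U h => exact .single _ _ _ (Or.inl (Or.inl ⟨h, hb⟩))
  | cons a y b U V h hy hp ih =>
    have := (I.pathBounds hp).1
    exact .cons _ _ _ _ _ (Or.inl (Or.inl ⟨h, by simp only; omega⟩))
      (fun e => hy ((mem_selSet_blockEmb_left (by omega)).1 e)) (ih hb)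

theorem ArcPath.concat_right {a b : ℕ} {T : Finset ℕ}
    (h : ArcPath J.carrier (selSet S) a b T) (ha : 1 ≤ a) :
    ArcPath (I.concat J).carrier (selSet (blockEmb R S)) (a + m) (b + m) (T.image (· + m)) := by
  induction h with
  | single a b U h => exact .single _ _ _ (Or.inl (Or.inr ⟨_, h, ha, rfl⟩))
  | cons a y b U V h hy hp ih =>
    have : a < y := (J.isExtArc _ h).1
    rw [Finset.image_union]
    exact .cons _ _ _ _ _ (Or.inl (Or.inr ⟨_, h, ha, rfl⟩))
      (fun e => hy ((mem_selSet_blockEmb_right (by omega)).1 e)) (ih (by omega))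

/-- The last arc of the path is terminal in I and is joined with the initial arc of J; all earlier
arcs stay in the left part. -/
theorem ArcPath.concat_arc {a b : ℕ} {T U : Finset ℕ}
    (h : ArcPath I.carrier (selSet R) a (m + 1) T) (hJ : (⟨0, b, U⟩ : RawArc) ∈ J.carrier) :
    ArcPath (I.concat J).carrier (selSet (blockEmb R S)) a (b + m) (T ∪ U.image (· + m)) := by
  generalize hc : m + 1 = c at h
  induction h with
  | single a c V h => exact .single _ _ _ (Or.inr ⟨_, h, _, hJ, hc.symm, rfl, rfl⟩)
  | cons a y c V W h hy hp ih =>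
    have := (I.pathBounds hp).1
    rw [Finset.union_assoc]
    exact .cons _ _ _ _ _ (Or.inl (Or.inl ⟨h, by simp only; omega⟩))
      (fun e => hy ((mem_selSet_blockEmb_left (by omega)).1 e)) (ih hc)

theorem ArcPath.concat {a b : ℕ} {T U : Finset ℕ}
    (h : ArcPath I.carrier (selSet R) a (m + 1) T) (hJ : ArcPath J.carrier (selSet S) 0 b U) :
    ArcPath (I.concat J).carrier (selSet (blockEmb R S)) a (b + m) (T ∪ U.image (· + m)) := by
  cases hJ with
  | single _ _ _ hJ => exact h.concat_arc hJ
  | cons _ y _ V W hJ hy hp =>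
    have : 0 < y := (J.isExtArc _ hJ).1
    rw [Finset.image_union, ← Finset.union_assoc]
    exact (h.concat_arc hJ).append (fun e => hy ((mem_selSet_blockEmb_right (by omega)).1 e))
      (hp.concat_right (by omega))

theorem ExtArcIdeal.concat_select_subset :
    ((I.select R).concat (J.select S)).carrier ⊆ ((I.concat J).select (blockEmb R S)).carrier := by
  rintro γ ((⟨⟨h1, h2, T, hp, hT⟩, hr⟩ | ⟨β, ⟨h1, h2, T, hp, hT⟩, hl, rfl⟩) |
    ⟨α, ⟨h1, h2, T, hp, hT⟩, β, ⟨k1, k2, U, hq, hU⟩, hr, hl, rfl⟩)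
  · refine mem_select.2 ⟨h1, by omega, T, ?_, ?_⟩
    · rw [extEnum_blockEmb_left _ _ hr, extEnum_blockEmb_left _ _ (by omega)]
      exact hp.concat_left (extEnum_le_of_le R hr)
    · rw [hT]
      ext l
      simp only [Finset.mem_filter, Finset.mem_Icc]
      constructor
      · rintro ⟨hl, hl'⟩
        rw [extEnum_blockEmb_left _ _ hl.2]
        exact ⟨⟨hl.1, by omega⟩, hl'⟩
      · rintro ⟨hl, hl'⟩
        by_cases hlq : l ≤ q
        · rw [extEnum_blockEmb_left _ _ hlq] at hl'
          exact ⟨⟨hl.1, hlq⟩, hl'⟩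
        · have h3 := (Finset.mem_Ioo.1 ((I.pathBounds hp).2 hl')).2
          rw [extEnum_blockEmb_right _ _ (by omega)] at h3
          have := extEnum_le_of_le R hr
          omega
  · refine mem_select.2 ⟨by simp only [RawArc.shift]; omega, by simp only [RawArc.shift]; omega,
      T.image (· + m), ?_, ?_⟩
    · simp only [RawArc.shift]
      rw [extEnum_blockEmb_right _ _ (by omega), extEnum_blockEmb_right _ _ (by omega)]
      simp only [Nat.add_sub_cancel]
      exact hp.concat_right (extEnum_pos S hl)
    · simp only [RawArc.shift, hT]
      ext l
      simp only [Finset.mem_filter, Finset.mem_Icc, Finset.mem_image]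
      constructor
      · rintro ⟨l, ⟨hl, hl'⟩, rfl⟩
        rw [extEnum_blockEmb_right _ _ (by omega), Nat.add_sub_cancel]
        exact ⟨by omega, _, hl', rfl⟩
      · rintro ⟨hl, x, hx, hl'⟩
        by_cases hlq : l ≤ q
        · rw [extEnum_blockEmb_left _ _ hlq] at hl'
          have := (Finset.mem_Ioo.1 ((J.pathBounds hp).2 hx)).1
          have := extEnum_le_of_le R hlq
          omega
        · rw [extEnum_blockEmb_right _ _ (by omega)] at hl'
          obtain rfl : x = extEnum S (l - q) := by omega
          exact ⟨l - q, ⟨by omega, hx⟩, by omega⟩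
  · refine mem_select.2 ⟨by simp only [RawArc.shift, RawArc.juxt]; omega,
      by simp only [RawArc.shift, RawArc.juxt]; omega, T ∪ U.image (· + m), ?_, ?_⟩
    · simp only [RawArc.shift, RawArc.juxt]
      rw [extEnum_blockEmb_left _ _ (by omega), extEnum_blockEmb_right _ _ (by omega),
        Nat.add_sub_cancel]
      rw [hr, extEnum_top R (Nat.lt_succ_self q)] at hp
      rw [hl, extEnum_zero] at hq
      exact hp.concat hq
    · simp only [RawArc.shift, RawArc.juxt, hT, hU]
      ext l
      simp only [Finset.mem_filter, Finset.mem_Icc, Finset.mem_image, Finset.mem_union]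
      rw [hr, extEnum_top R (Nat.lt_succ_self q)] at hp
      constructor
      · rintro (⟨hl, hl'⟩ | ⟨l, ⟨hl, hl'⟩, rfl⟩)
        · rw [extEnum_blockEmb_left _ _ hl.2]
          exact ⟨by omega, Or.inl hl'⟩
        · rw [extEnum_blockEmb_right _ _ (by omega), Nat.add_sub_cancel]
          exact ⟨by omega, Or.inr ⟨_, hl', rfl⟩⟩
      · rintro ⟨hl', hl''⟩
        by_cases hlq : l ≤ q
        · rw [extEnum_blockEmb_left _ _ hlq] at hl''
          rcases hl'' with h | ⟨x, hx, h⟩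
          · exact Or.inl ⟨⟨hl'.1, hlq⟩, h⟩
          · have := (Finset.mem_Ioo.1 ((J.pathBounds hq).2 hx)).1
            have := extEnum_le_of_le R hlq
            omega
        · rw [extEnum_blockEmb_right _ _ (by omega)] at hl''
          have hpos := extEnum_pos S (show 1 ≤ l - q by omega)
          rcases hl'' with h | ⟨x, hx, h⟩
          · have := (Finset.mem_Ioo.1 ((I.pathBounds hp).2 h)).2
            omega
          · obtain rfl : x = extEnum S (l - q) := by omega
            exact Or.inr ⟨l - q, ⟨by omega, hx⟩, by omega⟩

/-- By `mem_concat` it is enough to treat the two parts of an arc, and these are witnessed by the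
two truncations of its path. -/
theorem ExtArcIdeal.select_concat_subset :
    ((I.concat J).select (blockEmb R S)).carrier ⊆ ((I.select R).concat (J.select S)).carrier := by
  rintro γ hγ
  have hγ' := ((I.concat J).select (blockEmb R S)).isExtArc γ hγ
  obtain ⟨h1, h2, T, hp, hT⟩ := hγ
  refine mem_concat.2 ⟨hγ', fun h => ?_, fun h => ?_⟩
  · have hl := extEnum_blockEmb_left R S h
    have hle := extEnum_le_of_le R h
    have hr : min (extEnum (blockEmb R S) γ.right) (m + 1) =
        extEnum R (min γ.right (q + 1)) := by
      by_cases hr : γ.right ≤ q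
      · have := extEnum_le_of_le R hr
        rw [extEnum_blockEmb_left R S hr, min_eq_left (by omega), min_eq_left (by omega)]
      · have := extEnum_pos S (show 1 ≤ γ.right - q by omega)
        rw [extEnum_blockEmb_right R S (by omega), min_eq_right (by omega),
          min_eq_right (by omega), extEnum_top R (by omega)]
    have hp' := hp.left_part (by omega)
    rw [hr, hl] at hp'
    refine mem_select.2 ⟨by simp only [RawArc.part]; omega, by simp only [RawArc.part]; omega,
      _, hp', ?_⟩
    ext l
    rw [RawArc.mem_part_above (by omega), hT]
    simp only [add_zero, Finset.mem_filter, Finset.mem_Icc, Finset.mem_inter, Finset.mem_Ioo]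
    constructor
    · rintro ⟨⟨h3, h4⟩, h5, h6⟩
      rw [extEnum_blockEmb_left R S (by omega)] at h4
      exact ⟨by omega, h4, extEnum_strict R h5 (by omega), extEnum_strict R h6 (by omega)⟩
    · rintro ⟨h3, h4, h5, h6⟩
      rw [extEnum_blockEmb_left R S (by omega)]
      rw [extEnum_lt_iff R (by omega) (by omega)] at h5 h6
      exact ⟨⟨by omega, h4⟩, h5, h6⟩
  · have hr := extEnum_blockEmb_right R S (show q < γ.right by omega)
    have hpos := extEnum_pos S (show 1 ≤ γ.right - q by omega)
    have hl : max (extEnum (blockEmb R S) γ.left) m - m =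
        extEnum S (max γ.left q - q) := by
      by_cases hl : γ.left ≤ q
      · have := extEnum_le_of_le R hl
        rw [extEnum_blockEmb_left R S hl, max_eq_right (by omega), max_eq_right (by omega),
          Nat.sub_self, Nat.sub_self, extEnum_zero]
      · rw [extEnum_blockEmb_right R S (by omega), max_eq_left (by omega),
          max_eq_left (by omega), Nat.add_sub_cancel]
    obtain ⟨U, hp', hU⟩ := hp.right_part (show m + 1 ≤ _ by omega)
    rw [hr, hl, Nat.add_sub_cancel] at hp'
    refine mem_select.2 ⟨by simp only [RawArc.part]; omega, by simp only [RawArc.part]; omega,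
      _, hp', ?_⟩
    have hpb := (J.pathBounds hp').2
    ext l
    rw [RawArc.mem_part_above (by omega), hT]
    simp only [Finset.mem_filter, Finset.mem_Icc]
    constructor
    · rintro ⟨⟨h3, h4⟩, h5, h6⟩
      rw [extEnum_blockEmb_right R S (by omega), Nat.add_sub_cancel] at h4
      exact ⟨by omega, (hU _ (extEnum_pos S (by omega))).2 h4⟩
    · rintro ⟨h3, h4⟩
      have hlt := Finset.mem_Ioo.1 (hpb h4)
      rw [extEnum_lt_iff S (by omega) (by omega), extEnum_lt_iff S (by omega) (by omega)] at hlt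
      rw [extEnum_blockEmb_right R S (by omega), Nat.add_sub_cancel]
      exact ⟨⟨by omega, (hU _ (extEnum_pos S (by omega))).1 h4⟩, by omega, by omega⟩

end ConcatSelect

theorem isUnitalDecorationSet_extIdeals : IsUnitalDecorationSet extIdeals where
  concat_assoc x y z := ExtArcIdeal.sigma_ext (add_assoc _ _ _) (ExtArcIdeal.concat_assoc x y z)
  select_select K R S := ExtArcIdeal.select_select K R S
  concat_select _ _ _ _ := ExtArcIdeal.ext
    (ExtArcIdeal.concat_select_subset.antisymm ExtArcIdeal.select_concat_subset)
  empty_concat I := ExtArcIdeal.sigma_ext (zero_add _) (ExtArcIdeal.unit_concat I)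
  concat_empty I := ExtArcIdeal.concat_unit I
  select_self K R := ExtArcIdeal.select_self K R

/-- Strict arcs are neither initial nor terminal, so concatenation keeps them. For selections, an
arc between two selected vertices is a path of length one. -/
theorem isConservative_extIdeals : IsConservative extIdeals ExtArcIdeal.strict where
  concat_left x y α h := ⟨Or.inl (Or.inl ⟨h.1, h.2.2⟩), h.2.1, le_trans h.2.2 (by omega)⟩
  concat_right {m n} x y := by
    rintro _ ⟨α, h, rfl⟩
    have h1 := h.2.1
    have h2 := h.2.2
    exact ⟨Or.inl (Or.inr ⟨α, h.1, h.2.1, rfl⟩), by simp only [RawArc.shift]; omega,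
      by simp only [RawArc.shift]; omega⟩
  select {p q} z R a b S hab hS h := by
    refine ⟨⟨by simpa using hab, by simp only; omega, S, ?_, ?_⟩, by simp, by simp only; omega⟩
    · rw [extEnum_succ, extEnum_succ]
      exact .single _ _ _ h.1
    · ext l
      simp only [Finset.mem_image, Finset.mem_filter, Finset.mem_univ, true_and, Finset.mem_Icc]
      constructor
      · rintro ⟨c, hc, rfl⟩
        rw [extEnum_succ]
        exact ⟨by omega, hc⟩
      · rintro ⟨hl, hl'⟩
        obtain ⟨j, rfl⟩ := (extEnum_cases (i := l)).resolve_left (by omega) |>.resolve_left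
          (show ¬ q < l by omega)
        rw [extEnum_succ] at hl'
        exact ⟨j, hl', rfl⟩

/-! ### Words of permutree decorations -/

theorem sigma_fun_ext {α : Type} {m n : ℕ} {f : Fin m → α} {g : Fin n → α} (h : m = n)
    (hf : f = g ∘ Fin.cast h) : (⟨m, f⟩ : Σ n, Fin n → α) = ⟨n, g⟩ := by
  subst h
  rw [hf]
  rfl

theorem isUnitalDecorationSet_permutreeWords : IsUnitalDecorationSet permutreeWords where
  concat_assoc {m n p} x y z := sigma_fun_ext (add_assoc m n p) (Fin.append_assoc x y z)
  select_select _ _ _ := rfl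
  concat_select x y R S := by
    funext i
    induction i using Fin.addCases with
    | left i =>
      refine (Fin.append_left _ _ i).trans ?_
      refine (Fin.append_left (α := Bool × Bool) x y (R i)).symm.trans ?_
      exact congrArg (Fin.append (α := Bool × Bool) x y) (blockEmb_castAdd R S i).symm
    | right i =>
      refine (Fin.append_right _ _ i).trans ?_
      refine (Fin.append_right (α := Bool × Bool) x y (S i)).symm.trans ?_
      exact congrArg (Fin.append (α := Bool × Bool) x y) (blockEmb_natAdd R S i).symm
  empty_concat {n} x := sigma_fun_ext (zero_add n) (Fin.elim0_append x)
  concat_empty x := Fin.append_elim0 x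
  select_self {n} x R := by
    have : R = RelEmbedding.refl _ := orderEmb_fin_eq <| by
      rw [(Finite.injective_iff_surjective.1 R.injective).range_eq]
      exact Set.range_id.symm
    subst this
    rfl

/-- A vertex with decoration `d` is no obstacle for an arc, where `p` says that the vertex belongs
to the set of the arc. -/
def Passes (d : Bool × Bool) (p : Prop) : Prop := (p → d.1 = false) ∧ (¬ p → d.2 = false)

theorem mem_wordIdeal {n : ℕ} {δ : Fin n → Bool × Bool} {α : RawArc} :
    α ∈ (wordIdeal δ).carrier ↔ IsExtArc n α ∧ ∀ c : Fin n, α.left < (c : ℕ) + 1 →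
      (c : ℕ) + 1 < α.right → Passes (δ c) ((c : ℕ) + 1 ∈ α.above) := Iff.rfl

/-- Walls are local: the condition at a vertex concerns only the part of the arc on its side. -/
theorem wordIdeal_append {m n : ℕ} (δ : Fin m → Bool × Bool) (ε : Fin n → Bool × Bool) :
    wordIdeal (Fin.append δ ε) = (wordIdeal δ).concat (wordIdeal ε) := by
  refine ExtArcIdeal.ext (Set.ext fun γ => ?_)
  simp only [ExtArcIdeal.mem_concat, mem_wordIdeal, IsGlued]
  refine and_congr_right fun hγ => ?_
  have h1 := hγ.1
  have h2 := hγ.2.1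
  constructor
  · refine fun h => ⟨fun hl => ⟨RawArc.isExtArc_part (by omega) (by omega) (by omega), fun c hc hc' => ?_⟩,
      fun hr => ⟨RawArc.isExtArc_part (by omega) (by omega) (by omega), fun c hc hc' => ?_⟩⟩
    · simp only [RawArc.part] at hc hc'
      have := h (Fin.castAdd n c) (by simp only [Fin.val_castAdd]; omega)
        (by simp only [Fin.val_castAdd]; omega)
      rw [Fin.append_left, Fin.val_castAdd] at this
      rw [RawArc.mem_part_above (by omega), and_iff_left ⟨by omega, by omega⟩]
      exact this
    · simp only [RawArc.part] at hc hc'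
      have := h (Fin.natAdd m c) (by simp only [Fin.val_natAdd]; omega)
        (by simp only [Fin.val_natAdd]; omega)
      rw [Fin.append_right, Fin.val_natAdd] at this
      rw [RawArc.mem_part_above (by omega), and_iff_left ⟨by omega, by omega⟩]
      convert this using 2
      omega
  · rintro ⟨hI, hJ⟩ c hc hc'
    induction c using Fin.addCases with
    | left c =>
      rw [Fin.val_castAdd] at hc hc' ⊢
      rw [Fin.append_left]
      have := (hI (by omega)).2 c (by simp only [RawArc.part]; omega)
        (by simp only [RawArc.part]; omega)
      rwa [RawArc.mem_part_above (by omega), and_iff_left ⟨by omega, by omega⟩] at this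
    | right c =>
      rw [Fin.val_natAdd] at hc hc' ⊢
      rw [Fin.append_right]
      have := (hJ (by omega)).2 c (by simp only [RawArc.part]; omega)
        (by simp only [RawArc.part]; omega)
      rw [RawArc.mem_part_above (by omega), and_iff_left ⟨by omega, by omega⟩] at this
      convert this using 2
      omega

/-- A selected vertex is not an interior vertex of the path, so a single arc passes by it. -/
theorem ArcPath.passes {n : ℕ} {δ : Fin n → Bool × Bool} {X : Set ℕ} {a b : ℕ} {T : Finset ℕ}
    (h : ArcPath (wordIdeal δ).carrier X a b T) (c : Fin n) (hX : (c : ℕ) + 1 ∈ X)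
    (ha : a < (c : ℕ) + 1) (hb : (c : ℕ) + 1 < b) : Passes (δ c) ((c : ℕ) + 1 ∈ T) := by
  induction h with
  | single a b U h => exact h.2 c ha hb
  | cons a y b U V h hy hp ih =>
    have hU := h.1.2.2
    have hV := ((wordIdeal δ).pathBounds hp).2
    rw [Finset.mem_union]
    rcases lt_trichotomy ((c : ℕ) + 1) y with hc | hc | hc
    · rw [or_iff_left fun hx => by have := Finset.mem_Ioo.1 (hV hx); omega]
      exact h.2 c ha hc
    · exact absurd (hc ▸ hX) hy
    · rw [or_iff_right fun hx => by have := Finset.mem_Ioo.1 (hU hx); simp only at this; omega]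
      exact ih hc hb

/-- Walls at unselected vertices do not matter, as the path can stop there. The interval is broken
at such vertices until only selected ones remain inside; then one arc suffices. -/
theorem exists_arcPath_wordIdeal {n : ℕ} {δ : Fin n → Bool × Bool} {X : Set ℕ} (T : Finset ℕ)
    (N : ℕ) : ∀ a b, b - a ≤ N → a < b → b ≤ n + 1 →
    (∀ c : Fin n, a < (c : ℕ) + 1 → (c : ℕ) + 1 < b → (c : ℕ) + 1 ∈ X →
      Passes (δ c) ((c : ℕ) + 1 ∈ T)) →
    ∃ T', ArcPath (wordIdeal δ).carrier X a b T' ∧ ∀ x ∈ X, a < x → x < b → (x ∈ T' ↔ x ∈ T) := by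
  induction N with
  | zero =>
    intro a b h h'
    omega
  | succ N ih =>
    intro a b hN hab hb hc
    by_cases hy : ∃ y, a < y ∧ y < b ∧ y ∉ X
    · obtain ⟨y, hay, hyb, hy⟩ := hy
      obtain ⟨T₁, h1, h1'⟩ := ih a y (by omega) hay (by omega) fun c h h' => hc c h (by omega)
      obtain ⟨T₂, h2, h2'⟩ := ih y b (by omega) hyb (by omega) fun c h h' => hc c (by omega) h'
      refine ⟨_, h1.append hy h2, fun x hx hax hxb => ?_⟩
      have b1 := ((wordIdeal δ).pathBounds h1).2
      have b2 := ((wordIdeal δ).pathBounds h2).2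
      rw [Finset.mem_union]
      rcases lt_trichotomy x y with hc | rfl | hc
      · rw [or_iff_left fun hx => by have := Finset.mem_Ioo.1 (b2 hx); omega]
        exact h1' x hx hax hc
      · exact absurd hx hy
      · rw [or_iff_right fun hx => by have := Finset.mem_Ioo.1 (b1 hx); omega]
        exact h2' x hx hc hxb
    · push Not at hy
      refine ⟨T ∩ Finset.Ioo a b, .single _ _ _ ⟨⟨hab, hb, Finset.inter_subset_right⟩,
        fun c h h' => ?_⟩, fun x hx h h' => by simp [h, h']⟩
      have := hc c h h' (hy _ h h')
      simp only at h h'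
      change Passes _ _
      rwa [Finset.mem_inter, Finset.mem_Ioo, and_iff_left ⟨h, h'⟩]

theorem wordIdeal_select {p q : ℕ} (δ : Fin p → Bool × Bool) (R : Fin q ↪o Fin p) :
    wordIdeal (δ ∘ R) = (wordIdeal δ).select R := by
  refine ExtArcIdeal.ext (Set.ext fun α => ?_)
  rw [mem_wordIdeal, ExtArcIdeal.mem_select]
  constructor
  · rintro ⟨⟨h1, h2, h3⟩, h⟩
    have hiff : ∀ c : Fin q, (R c : ℕ) + 1 ∈ α.above.image (extEnum R) ↔
        (c : ℕ) + 1 ∈ α.above := by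
      intro c
      rw [← extEnum_succ, Finset.mem_image]
      constructor
      · rintro ⟨l, hl, he⟩
        have hlb := Finset.mem_Ioo.1 (h3 hl)
        have e1 := (extEnum_lt_iff R (i := l) (j := (c : ℕ) + 1) (by omega) (by omega)).2
        have e2 := (extEnum_lt_iff R (i := (c : ℕ) + 1) (j := l) (by omega) (by omega)).2
        obtain rfl : l = (c : ℕ) + 1 := by omega
        exact hl
      · exact fun h => ⟨_, h, rfl⟩
    obtain ⟨T, hT, hT'⟩ := exists_arcPath_wordIdeal (δ := δ) (X := selSet R)
      (α.above.image (extEnum R)) _ _ _ le_rfl (extEnum_strict R h1 h2) (extEnum_le R _) (by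
        rintro c hc hc' ⟨i, hi⟩
        obtain rfl : R i = c := Fin.ext (by simpa using hi)
        rw [hiff]
        rw [← extEnum_succ, extEnum_lt_iff R (by omega) (by omega)] at hc hc'
        exact h i hc hc')
    refine ⟨h1, h2, T, hT, Finset.ext fun l => ?_⟩
    rw [Finset.mem_filter, Finset.mem_Icc]
    constructor
    · intro hl
      have hlb := Finset.mem_Ioo.1 (h3 hl)
      exact ⟨by omega, (hT' _ (extEnum_mem R (by omega) (by omega))
        (extEnum_strict R hlb.1 (by omega)) (extEnum_strict R hlb.2 h2)).2
        (Finset.mem_image_of_mem _ hl)⟩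
    · rintro ⟨hl, hlT⟩
      have := Finset.mem_Ioo.1 (((wordIdeal δ).pathBounds hT).2 hlT)
      rw [hT' _ (extEnum_mem R hl.1 hl.2) this.1 this.2] at hlT
      obtain ⟨c, rfl⟩ := (extEnum_cases (i := l)).resolve_left (by omega) |>.resolve_left
        (show ¬ q < l by omega)
      rw [extEnum_succ] at hlT
      exact (hiff c).1 hlT
  · rintro ⟨h1, h2, T, hp, hT⟩
    have hext := ((wordIdeal δ).select R).isExtArc α ⟨h1, h2, T, hp, hT⟩
    refine ⟨hext, fun c hc hc' => ?_⟩
    have := hp.passes (R c) ⟨c, rfl⟩ (by rw [← extEnum_succ]; exact extEnum_strict R hc (by omega))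
      (by rw [← extEnum_succ]; exact extEnum_strict R hc' (by omega))
    rwa [hT, Finset.mem_filter, Finset.mem_Icc, extEnum_succ,
      and_iff_right ⟨by omega, by omega⟩]

theorem wordIdeal_empty : wordIdeal (Fin.elim0 : Fin 0 → Bool × Bool) = ExtArcIdeal.unit :=
  ExtArcIdeal.ext (Set.ext fun _ => and_iff_left fun c => c.elim0)

/-- The decoration of a vertex is read off from the two extended arcs that pass only this vertex.
Since arcs may start at 0 and end at n + 1, this also works for the first and the last vertex. -/
theorem wordIdeal_injective {n : ℕ} :
    Function.Injective (wordIdeal : (Fin n → Bool × Bool) → ExtArcIdeal n) := by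
  have key : ∀ (δ : Fin n → Bool × Bool) (c : Fin n) (S : Finset ℕ),
      S ⊆ Finset.Ioo (c : ℕ) (c + 2) → ((⟨c, c + 2, S⟩ : RawArc) ∈ (wordIdeal δ).carrier ↔
        Passes (δ c) ((c : ℕ) + 1 ∈ S)) := by
    intro δ c S hS
    rw [mem_wordIdeal]
    constructor
    · exact fun h => h.2 c (by simp) (by simp)
    · refine fun h => ⟨⟨by simp, by simp only; omega, hS⟩, fun b hb hb' => ?_⟩
      simp only at hb hb'
      obtain rfl : b = c := Fin.ext (by omega)
      exact h
  intro δ ε h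
  funext c
  have h1 := key δ c {(c : ℕ) + 1} (by simp)
  have h2 := key δ c ∅ (by simp)
  rw [h, key ε c _ (by simp)] at h1 h2
  simp only [Passes, Finset.mem_singleton, Finset.notMem_empty, true_implies, not_true_eq_false,
    false_implies, and_true, not_false_eq_true, true_and] at h1 h2
  exact Prod.ext (Bool.eq_iff_iff.2 (by simpa using (not_congr h1).symm))
    (Bool.eq_iff_iff.2 (by simpa using (not_congr h2).symm))

/-- The decoration by an extended arc ideal that belongs to a word of decorations. -/
def wordDecoration {n : ℕ} (δ : permutreeWords.X n) : extIdeals.X n := wordIdeal (n := n) δ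

theorem wordDecoration_concat {m n : ℕ} (x : permutreeWords.X m) (y : permutreeWords.X n) :
    wordDecoration (permutreeWords.concat x y) =
      extIdeals.concat (wordDecoration x) (wordDecoration y) :=
  wordIdeal_append x y

theorem wordDecoration_select {p q : ℕ} (x : permutreeWords.X p) (R : Fin q ↪o Fin p) :
    wordDecoration (permutreeWords.select x R) = extIdeals.select (wordDecoration x) R :=
  wordIdeal_select x R

/-- The arc ideal of a word of decorations. -/
def wordArcs {n : ℕ} (δ : permutreeWords.X n) : ArcIdeal n :=
  ExtArcIdeal.strict (wordDecoration δ)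

theorem isConservative_permutreeWords : IsConservative permutreeWords wordArcs where
  concat_left x y := by
    simp only [wordArcs]
    rw [wordDecoration_concat]
    exact isConservative_extIdeals.concat_left (wordDecoration x) (wordDecoration y)
  concat_right x y := by
    simp only [wordArcs]
    rw [wordDecoration_concat]
    exact isConservative_extIdeals.concat_right (wordDecoration x) (wordDecoration y)
  select z R a b S h1 h2 h3 := by
    simp only [wordArcs]
    rw [wordDecoration_select]
    exact isConservative_extIdeals.select (wordDecoration z) R a b S h1 h2 h3

/-! ### The embedding into permutations decorated by extended arc ideals -/

section Map

variable {k : Type*} [Field k]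

theorem permutreeMap_F {n : ℕ} (σ : Equiv.Perm (Fin n)) (δ : permutreeWords.X n) :
    permutreeMap k (F k σ δ) = F k σ (wordDecoration δ) :=
  Finsupp.mapDomain_single

theorem permutreeMap_injective : Function.Injective (permutreeMap k) := by
  refine Finsupp.mapDomain_injective ?_
  rintro ⟨m, σ, δ⟩ ⟨n, τ, ε⟩ h
  obtain rfl : m = n := congrArg Sigma.fst h
  have h' := eq_of_heq (Sigma.mk.inj h).2
  obtain rfl : σ = τ := congrArg Prod.fst h'
  obtain rfl : δ = ε := wordIdeal_injective (congrArg Prod.snd h')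
  rfl

theorem isHopfMorphism_permutreeMap : IsHopfMorphism (decPermAlgebra k permutreeWords)
    (decPermAlgebra k extIdeals) (permutreeMap k) where
  map_mul x y := by
    induction x using decPerm_induction with
    | hadd v w hv hw => simp only [map_add, LinearMap.add_apply, hv, hw]
    | hsmul c v hv => simp only [map_smul, LinearMap.smul_apply, hv]
    | hF m σ x =>
      induction y using decPerm_induction with
      | hadd v w hv hw => simp only [map_add, hv, hw]
      | hsmul c v hv => simp only [map_smul, hv]
      | hF n τ y =>
        rw [mul_F, map_sum, permutreeMap_F, permutreeMap_F, mul_F]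
        refine Finset.sum_congr rfl fun ρ _ => ?_
        rw [permutreeMap_F, wordDecoration_concat]
  map_one := (permutreeMap_F _ _).trans (congrArg _ wordIdeal_empty)
  map_comul x := by
    induction x using decPerm_induction with
    | hadd v w hv hw => simp only [map_add, hv, hw]
    | hsmul c v hv => simp only [map_smul, hv]
    | hF m σ x =>
      rw [permutreeMap_F, comul_F, comul_F, map_sum]
      refine Finset.sum_congr rfl fun A _ => ?_
      have hF : ∀ A, permutreeMap k (FSub k (𝔛 := permutreeWords) σ x A) =
          FSub k σ (wordDecoration x) A := by
        intro A
        rw [FSub, FRes, FSub, FRes, permutreeMap_F, wordDecoration_select]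
      rw [TensorProduct.map_tmul, hF, hF]
  map_counit x := by
    induction x using decPerm_induction with
    | hadd v w hv hw => simp only [map_add, hv, hw]
    | hsmul c v hv => simp only [map_smul, hv]
    | hF m σ x => rw [permutreeMap_F, counit_F, counit_F]
  map_gr n x hx := by
    rw [gr_eq_span] at hx
    induction hx using Submodule.span_induction with
    | zero => simp
    | add v w _ _ hv hw =>
      rw [map_add]
      exact add_mem hv hw
    | smul c v _ hv =>
      rw [map_smul]
      exact Submodule.smul_mem _ c hv
    | mem v h =>
      obtain ⟨σ, δ, rfl⟩ := h
      rw [permutreeMap_F]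
      exact F_mem_gr σ _

theorem permutreeMap_FSum {n : ℕ} (δ : permutreeWords.X n) (P : Equiv.Perm (Fin n) → Prop) :
    permutreeMap k (FSum k δ P) = FSum k (wordDecoration δ) P := by
  rw [FSum, FSum, map_sum]
  exact Finset.sum_congr rfl fun σ _ => permutreeMap_F σ δ

end Map

/-! ### Components of a graph without a vertex -/

section Comp

variable {V : Type*} {G : SimpleGraph V} {u v w x y : V}

/-- The vertices `u` and `w` are in the same component of the graph without `v`. -/
def Comp (G : SimpleGraph V) (v u w : V) : Prop := ∃ p : G.Walk u w, v ∉ p.support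

theorem Comp.refl (h : v ≠ u) : Comp G v u u := ⟨.nil, by simpa using h⟩

theorem Comp.ne (h : Comp G v u w) : w ≠ v := by
  obtain ⟨p, hp⟩ := h
  rintro rfl
  exact hp p.end_mem_support

theorem Comp.step (h : Comp G v u x) (hxy : G.Adj x y) (hy : y ≠ v) : Comp G v u y := by
  obtain ⟨p, hp⟩ := h
  refine ⟨p.concat hxy, ?_⟩
  rw [SimpleGraph.Walk.support_concat]
  simpa using ⟨hp, hy.symm⟩

theorem Comp.induction {S : V → Prop} (h : Comp G v u w) (hu : S u)
    (hS : ∀ x y, S x → G.Adj x y → y ≠ v → S y) : S w := by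
  obtain ⟨p, hp⟩ := h
  induction p with
  | nil => exact hu
  | cons hxy p ih =>
    rw [SimpleGraph.Walk.support_cons, List.mem_cons, not_or] at hp
    refine ih (hS _ _ hu hxy ?_) hp.2
    rintro rfl
    exact hp.2 p.start_mem_support

/-- Otherwise there would be two paths from v to w, the edge and one through u. -/
theorem Comp.eq_of_adj (hG : G.IsAcyclic) (h : Comp G v u w) (hu : G.Adj v u) (hw : G.Adj v w) :
    w = u := by
  classical
  obtain ⟨p, hp⟩ := h
  have hb : v ∉ p.bypass.support := fun h => hp (p.support_bypass_subset_support h)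
  have h1 : (SimpleGraph.Walk.cons hu p.bypass).IsPath :=
    (SimpleGraph.Walk.cons_isPath_iff _ _).2 ⟨p.bypass_isPath, hb⟩
  have h2 : (SimpleGraph.Walk.cons hw .nil).IsPath :=
    (SimpleGraph.Walk.cons_isPath_iff _ _).2 ⟨.nil, by simpa using hw.ne⟩
  have := congrArg (fun p : G.Path v w => (p : G.Walk v w).snd)
    ((hG.subsingleton_path v w).elim ⟨_, h1⟩ ⟨_, h2⟩)
  simpa using this.symm

theorem exists_isPath_of_ne (hG : G.Preconnected) (h : u ≠ w) :
    ∃ (x : V) (p : G.Walk x w), G.Adj u x ∧ p.IsPath ∧ u ∉ p.support := by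
  classical
  obtain ⟨p⟩ := hG u w
  have hp := p.bypass_isPath
  generalize p.bypass = q at hp
  cases q with
  | nil => exact absurd rfl h
  | cons hux q =>
    rw [SimpleGraph.Walk.cons_isPath_iff] at hp
    exact ⟨_, q, hux, hp.1, hp.2⟩

/-- A walk from u to v has to leave S, which is possible only by entering v, and u is the only
neighbor of v in S. -/
theorem isBridge_of_invariant {S : V → Prop} (hu : S u) (hv : ¬ S v)
    (hS : ∀ x y, S x → G.Adj x y → y ≠ v → S y) (hx : ∀ x, S x → G.Adj v x → x = u) :
    G.IsBridge s(v, u) := by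
  rw [SimpleGraph.isBridge_iff_forall_walk_mem_edges]
  intro p
  have key : ∀ (x : V) (q : G.Walk x v), S x → s(v, u) ∈ q.edges := by
    intro x q hxS
    generalize hw : v = w at q
    induction q with
    | nil => exact absurd (hw ▸ hxS) hv
    | @cons x y w hxy q ih =>
      subst hw
      rw [SimpleGraph.Walk.edges_cons, List.mem_cons]
      by_cases hy : y = v
      · subst hy
        rw [hx x hxS hxy.symm]
        exact Or.inl Sym2.eq_swap
      · exact Or.inr (ih (hS x y hxS hxy hy) rfl)
  have := key u p.reverse hu
  rwa [SimpleGraph.Walk.edges_reverse, List.mem_reverse] at this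

end Comp

/-! ### Linear extensions of permutrees -/

namespace Permutree

variable {n : ℕ} {δ : Fin n → Bool × Bool}

/-- The underlying tree. -/
abbrev graph (T : Permutree δ) : SimpleGraph (Fin n) := SimpleGraph.fromRel T.edge

theorem adj_iff (T : Permutree δ) {x y : Fin n} : T.graph.Adj x y ↔ T.edge x y ∨ T.edge y x := by
  rw [SimpleGraph.fromRel_adj]
  refine and_iff_right_of_imp ?_
  rintro h rfl
  exact T.asymm x x (or_self_iff.1 h) (or_self_iff.1 h)

theorem adj_of_edge (T : Permutree δ) {x y : Fin n} (h : T.edge x y) : T.graph.Adj x y :=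
  T.adj_iff.2 (Or.inl h)

theorem fromRel_swap {V : Type*} (r : V → V → Prop) :
    SimpleGraph.fromRel (fun u v => r v u) = SimpleGraph.fromRel r := by
  ext x y
  simp only [SimpleGraph.fromRel_adj, or_comm]

/-- The permutree with all edges reversed. -/
def dual (T : Permutree δ) : Permutree fun v => (δ v).swap where
  edge u v := T.edge v u
  asymm u v h := T.asymm v u h
  connected := by
    rw [fromRel_swap]
    exact T.connected
  acyclic := by
    rw [fromRel_swap]
    exact T.acyclic
  parent_unique v h u u' := T.child_unique v h u u'
  child_unique v h u u' := T.parent_unique v h u u'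
  parent_side := by
    rw [fromRel_swap]
    exact T.child_side
  child_side := by
    rw [fromRel_swap]
    exact T.parent_side
  parent_side_unique v h u u' := T.child_side_unique v h u u'
  child_side_unique v h u u' := T.parent_side_unique v h u u'

theorem dual_graph (T : Permutree δ) : T.dual.graph = T.graph := fromRel_swap _

theorem parent_comp (T : Permutree δ) {v u : Fin n} (hv : (δ v).1 = true) (h : T.edge v u) :
    (u < v ∧ ∀ w, Comp T.graph v u w → w < v) ∨ (v < u ∧ ∀ w, Comp T.graph v u w → v < w) :=
  (T.parent_side v hv u h).imp (fun h => ⟨h.1, fun w ⟨p, hp⟩ => h.2 w p hp⟩)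
    fun h => ⟨h.1, fun w ⟨p, hp⟩ => h.2 w p hp⟩

theorem child_comp (T : Permutree δ) {v u : Fin n} (hv : (δ v).2 = true) (h : T.edge u v) :
    (u < v ∧ ∀ w, Comp T.graph v u w → w < v) ∨ (v < u ∧ ∀ w, Comp T.graph v u w → v < w) :=
  (T.child_side v hv u h).imp (fun h => ⟨h.1, fun w ⟨p, hp⟩ => h.2 w p hp⟩)
    fun h => ⟨h.1, fun w ⟨p, hp⟩ => h.2 w p hp⟩

/-- The vertex `y` separates `a` and all its neighbors from `b`. -/
def Separates (T : Permutree δ) (y a b : Fin n) : Prop :=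
  ((a < y ∧ y < b) ∨ (b < y ∧ y < a)) ∧ ∀ v, T.graph.Adj a v → v ≠ y → (v < y ↔ a < y)

/-- A vertex with two parents is a north vertex, and its two ancestor subtrees lie on opposite sides
of it. A neighbor of a other than y belongs to the subtree of a. -/
theorem separates_of_comp (T : Permutree δ) {y z z' a b : Fin n} (hz : T.edge y z)
    (hz' : T.edge y z') (hne : z ≠ z') (ha : Comp T.graph y z a) (hb : Comp T.graph y z' b) :
    (δ y).1 = true ∧ T.Separates y a b := by
  have hy : (δ y).1 = true := by
    by_contra hy
    exact hne (T.parent_unique y (Bool.eq_false_iff.2 hy) z z' hz hz')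
  have hs := fun h => hne (T.parent_side_unique y hy z z' hz hz' h)
  refine ⟨hy, ?_⟩
  rcases T.parent_comp hy hz with ⟨h1, h2⟩ | ⟨h1, h2⟩ <;>
    rcases T.parent_comp hy hz' with ⟨h3, h4⟩ | ⟨h3, h4⟩
  · exact absurd (iff_of_true h1 h3) hs
  · exact ⟨Or.inl ⟨h2 a ha, h4 b hb⟩, fun v hv hvy =>
      iff_of_true (h2 v (ha.step hv hvy)) (h2 a ha)⟩
  · exact ⟨Or.inr ⟨h4 b hb, h2 a ha⟩, fun v hv hvy =>
      iff_of_false (h2 v (ha.step hv hvy)).asymm (h2 a ha).asymm⟩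
  · exact absurd (iff_of_false h1.asymm h3.asymm) hs

/-- As long as the path goes down, its vertices are descendants of b. The vertex where it first
turns upwards has two parents: the one from which the path came and the one to which it goes. -/
theorem descendant_or_valley_aux (T : Permutree δ) {x a b : Fin n} (p : T.graph.Walk x a)
    (hp : p.IsPath) (hx : T.edge x b) (hb : b ∉ p.support) : Relation.TransGen T.edge a b ∨
      ∃ y z z', y ∈ p.support ∧ Relation.TransGen T.edge y b ∧ T.edge y z ∧ T.edge y z' ∧
        z ≠ z' ∧ Comp T.graph y z a ∧ Comp T.graph y z' b := by
  induction p generalizing b with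
  | nil => exact Or.inl (.single hx)
  | @cons x x' a hxx' p ih =>
    rw [SimpleGraph.Walk.cons_isPath_iff] at hp
    rw [SimpleGraph.Walk.support_cons, List.mem_cons, not_or] at hb
    rcases T.adj_iff.1 hxx' with hup | hdown
    · refine Or.inr ⟨x, x', b, by simp, .single hx, hup, hx, ?_, ⟨p, hp.2⟩,
        Comp.refl (Ne.symm hb.1)⟩
      rintro rfl
      exact hb.2 p.start_mem_support
    · rcases ih hp.1 hdown hp.2 with h | ⟨y, z, z', hy, h1, h2, h3, h4, h5, h6⟩
      · exact Or.inl (h.tail hx)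
      · refine Or.inr ⟨y, z, z', by simp [hy], h1.tail hx, h2, h3, h4, h5,
          h6.step (T.adj_of_edge hx) ?_⟩
        rintro rfl
        exact hb.2 hy

/-- If the path from `b` to `a` starts downwards, then `a` is a descendant of `b`, or there is a
descendant of `b` with two ancestor subtrees that separates `a` from `b`. -/
theorem descendant_or_valley (T : Permutree δ) {x a b : Fin n} (p : T.graph.Walk x a)
    (hp : p.IsPath) (hx : T.edge x b) (hb : b ∉ p.support) : Relation.TransGen T.edge a b ∨
      ∃ y, Relation.TransGen T.edge y b ∧ (δ y).1 = true ∧ T.Separates y a b := by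
  refine (T.descendant_or_valley_aux p hp hx hb).imp_right ?_
  rintro ⟨y, z, z', -, h1, h2, h3, h4, h5, h6⟩
  exact ⟨y, h1, T.separates_of_comp h2 h3 h4 h5 h6⟩

theorem ancestor_or_peak (T : Permutree δ) {x a b : Fin n} (p : T.graph.Walk x a)
    (hp : p.IsPath) (hx : T.edge b x) (hb : b ∉ p.support) : Relation.TransGen T.edge b a ∨
      ∃ y, Relation.TransGen T.edge b y ∧ (δ y).2 = true ∧ T.Separates y a b := by
  have h : ∃ q : T.dual.graph.Walk x a, q.IsPath ∧ b ∉ q.support := by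
    rw [dual_graph]
    exact ⟨p, hp, hb⟩
  obtain ⟨q, hq, hb'⟩ := h
  refine (T.dual.descendant_or_valley q hq hx hb').imp (fun h => Relation.transGen_swap.1 h) ?_
  rintro ⟨y, h1, h2, h3⟩
  refine ⟨y, Relation.transGen_swap.1 h1, h2, ?_⟩
  rw [Separates, dual_graph] at h3
  exact h3

variable {B : Fin n → Fin n → Prop}

theorem transGen_of (htrans : ∀ x y z, B x y → B y z → B x z) {e : Fin n → Fin n → Prop}
    (hB : ∀ u v, e u v → B u v) {u v : Fin n} (h : Relation.TransGen e u v) : B u v := by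
  induction h with
  | single h => exact hB _ _ h
  | tail _ h ih => exact htrans _ _ _ ih (hB _ _ h)

/-- An edge does not pass above a vertex with two ancestor subtrees. -/
theorem not_edge_of_north (T : Permutree δ) (hasymm : ∀ x y, B x y → ¬ B y x)
    (htrans : ∀ x y z, B x y → B y z → B x z) (hB : ∀ u v, T.edge u v → B u v) {u v b : Fin n}
    (hb : (u < b ∧ b < v) ∨ (v < b ∧ b < u)) (hbu : B b u) (hn : (δ b).1 = true) :
    ¬ T.edge u v := by
  intro huv
  have hne : b ≠ u := by
    rintro rfl
    omega
  have hvb : v ≠ b := by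
    rintro rfl
    omega
  obtain ⟨w, p, hbw, hp, hbp⟩ := exists_isPath_of_ne T.connected hne
  have hu : Comp T.graph b w u := ⟨p, hbp⟩
  have hv := hu.step (T.adj_of_edge huv) hvb
  -- If the path from b to u starts upwards, u and v are in one ancestor subtree of b and hence on
  -- the same side of b. If it starts downwards, u is not a descendant of b because b precedes it;
  -- so a valley y separates u from b, and with u also its neighbor v.
  rcases T.adj_iff.1 hbw with h | h
  · rcases T.parent_comp hn h with ⟨-, h⟩ | ⟨-, h⟩
    · have := h u hu
      have := h v hv
      omega
    · have := h u hu
      have := h v hv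
      omega
  · rcases T.descendant_or_valley p hp h hbp with h | ⟨y, h1, -, h2, h3⟩
    · exact hasymm _ _ hbu (transGen_of htrans hB h)
    · have hvy : v ≠ y := by
        rintro rfl
        exact hasymm _ _ (hB _ _ huv) (htrans _ _ _ (transGen_of htrans hB h1) hbu)
      have := h3 v (T.adj_of_edge huv) hvy
      omega

/-- An edge does not pass below a vertex with two descendant subtrees. -/
theorem not_edge_of_south (T : Permutree δ) (hasymm : ∀ x y, B x y → ¬ B y x)
    (htrans : ∀ x y z, B x y → B y z → B x z) (hB : ∀ u v, T.edge u v → B u v) {u v b : Fin n}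
    (hb : (u < b ∧ b < v) ∨ (v < b ∧ b < u)) (hbv : B v b) (hs : (δ b).2 = true) :
    ¬ T.edge u v :=
  T.dual.not_edge_of_north (B := fun x y => B y x) (u := v) (v := u) (fun x y => hasymm y x)
    (fun _ _ _ h h' => htrans _ _ _ h' h) (fun u v => hB v u) hb.symm hbv hs

/-! ### Walls, edges and classes of linear extensions -/

/-- There is a wall between two values `x` and `y` that stand next to each other in this order. -/
def Wall (δ : Fin n → Bool × Bool) (σ : Equiv.Perm (Fin n)) (x y : Fin n) : Prop :=
  ∃ b, ((x < b ∧ b < y) ∨ (y < b ∧ b < x)) ∧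
    ((Bef σ b x ∧ (δ b).1 = true) ∨ (Bef σ y b ∧ (δ b).2 = true))

theorem not_edge_of_wall (T : Permutree δ) {σ : Equiv.Perm (Fin n)} (hσ : T.IsLinearExtension σ)
    {x y : Fin n} (h : Wall δ σ x y) : ¬ T.edge x y := by
  obtain ⟨b, hb, ⟨h1, h2⟩ | ⟨h1, h2⟩⟩ := h
  · exact T.not_edge_of_north (B := Bef σ) (fun _ _ h => h.asymm) (fun _ _ _ h h' => h.trans h') hσ
      hb h1 h2
  · exact T.not_edge_of_south (B := Bef σ) (fun _ _ h => h.asymm) (fun _ _ _ h h' => h.trans h') hσ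
      hb h1 h2

/-- If y were an ancestor of x without being a parent, a vertex would stand between the neighbors,
and a descendant would stand on the wrong side. So the tree path gives a peak after y or a valley
before x, whose value lies between x and y. -/
theorem wall_of_not_edge (T : Permutree δ) {σ : Equiv.Perm (Fin n)} (hσ : T.IsLinearExtension σ)
    {x y : Fin n} (hn : Next σ x y) (h : ¬ T.edge x y) : Wall δ σ x y := by
  have htr : ∀ {u v}, Relation.TransGen T.edge u v → Bef σ u v :=
    fun h => transGen_of (fun _ _ _ h h' => h.trans h') hσ h
  obtain ⟨w, p, hw, hp, hxp⟩ := exists_isPath_of_ne T.connected hn.1.ne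
  rcases T.adj_iff.1 hw with hw | hw
  · rcases T.ancestor_or_peak p hp hw hxp with h' | ⟨v, h1, h2, h3, h4⟩
    · cases h' with
      | single h' => exact absurd h' h
      | tail h1 h2 => exact absurd (hσ _ _ h2) (hn.2 _ (htr h1))
    · have hv : v ≠ y := by
        rintro rfl
        omega
      exact ⟨v, by omega, Or.inr ⟨bef_of_not hv.symm (hn.2 v (htr h1)), h2⟩⟩
  · rcases T.descendant_or_valley p hp hw hxp with h' | ⟨v, h1, h2, h3, h4⟩
    · exact absurd (htr h') hn.1.asymm
    · exact ⟨v, by omega, Or.inl ⟨htr h1, h2⟩⟩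

theorem IsLinearExtension.swap {T : Permutree δ} {σ : Equiv.Perm (Fin n)}
    (hσ : T.IsLinearExtension σ) {x y : Fin n} (hn : Next σ x y) (h : ¬ T.edge x y) :
    T.IsLinearExtension (Equiv.swap x y * σ) := fun u v huv =>
  (bef_swap hn).2 (Or.inr ⟨hσ u v huv, by rintro ⟨rfl, rfl⟩; exact h huv⟩)

theorem Wall.swap {σ : Equiv.Perm (Fin n)} {x y : Fin n} (hn : Next σ x y) (h : Wall δ σ x y) :
    Wall δ (Equiv.swap x y * σ) y x := by
  obtain ⟨b, hb, h⟩ := h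
  have h1 : b ≠ x := by
    rintro rfl
    omega
  have h2 : b ≠ y := by
    rintro rfl
    omega
  refine ⟨b, hb.symm, h.imp (And.imp_left fun h => ?_) (And.imp_left fun h => ?_)⟩
  · exact (bef_swap hn).2 (Or.inr ⟨h.trans hn.1, fun e => h1 e.1⟩)
  · exact (bef_swap hn).2 (Or.inr ⟨hn.1.trans h, fun e => h2 e.2⟩)

/-- A value between a and c stands either before c or after a. In the first case it is in the set of
the arc and blocks by north, in the second it is not and blocks by south. -/
theorem wall_iff {σ : Equiv.Perm (Fin n)} {a c : Fin n} (hac : a < c) (hn : Next σ c a) :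
    Wall δ σ c a ↔ valArc σ a c ∉ (wordArcs (δ : permutreeWords.X n)).carrier := by
  have hmem : valArc σ a c ∈ (wordArcs (δ : permutreeWords.X n)).carrier ↔
      ∀ b, a < b → b < c → Passes (δ b) (Bef σ b c) := by
    change (_ ∈ (wordIdeal δ).carrier ∧ _) ↔ _
    have h := valArc_isArc (σ := σ) hac
    rw [and_iff_left ⟨h.1, h.2.2.1⟩, mem_wordIdeal,
      and_iff_right ⟨h.2.1, h.2.2.1.trans (Nat.le_succ n), h.2.2.2⟩]
    refine forall_congr' fun b => ?_
    have e1 : (valArc σ a c).left < (b : ℕ) + 1 ↔ a < b := by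
      simp only [valArc, Fin.lt_def]
      omega
    have e2 : (b : ℕ) + 1 < (valArc σ a c).right ↔ b < c := by
      simp only [valArc, Fin.lt_def]
      omega
    rw [e1, e2, succ_mem_valArc_above]
    refine forall_congr' fun h1 => forall_congr' fun h2 => ?_
    rw [and_iff_left ⟨h1, h2⟩]
  rw [hmem]
  push Not
  constructor
  · rintro ⟨b, hb, h⟩
    refine ⟨b, by omega, by omega, fun hP => ?_⟩
    rcases h with ⟨h1, h2⟩ | ⟨h1, h2⟩
    · simp [hP.1 h1] at h2
    · simp [hP.2 (hn.1.trans h1).asymm] at h2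
  · rintro ⟨b, h1, h2, h⟩
    refine ⟨b, Or.inr ⟨h1, h2⟩, ?_⟩
    by_contra hc
    push Not at hc
    refine h ⟨fun h => by simpa using hc.1 h, fun h => ?_⟩
    have hcb := bef_of_not h2.ne' h
    simpa using hc.2 (bef_of_not h1.ne (hn.2 b hcb))

/-- A step is an exchange across a wall, and no edge joins two neighbors across a wall. The wall
survives the exchange, which gives the converse. -/
theorem isLinearExtension_of_arcStep {T : Permutree δ} {σ τ : Equiv.Perm (Fin n)}
    (h : ArcStep (wordArcs (δ : permutreeWords.X n)).carrier σ τ) :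
    T.IsLinearExtension σ ↔ T.IsLinearExtension τ := by
  obtain ⟨a, c, hac, hn, hα, rfl⟩ := h
  have hw := (wall_iff hac hn).2 hα
  refine ⟨fun hσ => hσ.swap hn (T.not_edge_of_wall hσ hw), fun hτ => ?_⟩
  have := hτ.swap hn.swap (T.not_edge_of_wall hτ (hw.swap hn))
  rwa [swap_swap_mul] at this

/-- Neighbors of σ on whose order τ disagrees are not joined by an edge, so there is a wall between
them. Their exchange stays among the linear extensions and is a step, taken downwards or upwards
according to the sizes of the two values. -/
theorem arcSetoid_of_isLinearExtension (T : Permutree δ) (N : ℕ) : ∀ σ τ : Equiv.Perm (Fin n),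
    (disagree σ τ).card ≤ N → T.IsLinearExtension σ → T.IsLinearExtension τ →
    arcSetoid (wordArcs (δ : permutreeWords.X n)).carrier σ τ := by
  induction N with
  | zero =>
    intro σ τ h _ _
    by_contra hne
    obtain ⟨x, y, hn, hb⟩ := exists_next_of_ne (σ := σ) (τ := τ) fun e => hne (e ▸ Setoid.refl' _ _)
    have := card_disagree_swap hn hb
    omega
  | succ N ih =>
    intro σ τ h hσ hτ
    by_cases hne : σ = τ
    · rw [hne]
    obtain ⟨x, y, hn, hb⟩ := exists_next_of_ne hne
    have hxy : ¬ T.edge x y := fun h => hb.asymm (hτ _ _ h)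
    have hw := T.wall_of_not_edge hσ hn hxy
    have := card_disagree_swap hn hb
    refine Setoid.trans' _ ?_ (ih _ τ (by omega) (hσ.swap hn hxy) hτ)
    rcases lt_or_gt_of_ne hn.1.ne with hlt | hlt
    · refine Setoid.symm' _ (arcSetoid_of_step ⟨x, y, hlt, hn.swap, ?_, swap_swap_mul.symm⟩)
      exact (wall_iff hlt hn.swap).1 (hw.swap hn)
    · exact arcSetoid_of_step ⟨y, x, hlt, hn, (wall_iff hlt hn).1 hw, rfl⟩

theorem isLinearExtension_iff_eta (T : Permutree δ) {σ τ : Equiv.Perm (Fin n)}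
    (hσ : T.IsLinearExtension σ) : T.IsLinearExtension τ ↔
      eta (wordArcs (δ : permutreeWords.X n)) τ = eta (wordArcs (δ : permutreeWords.X n)) σ := by
  rw [eta_eq_iff]
  refine ⟨fun hτ => T.arcSetoid_of_isLinearExtension _ τ σ le_rfl hτ hσ, fun h => ?_⟩
  exact (iff_of_eq (arcSetoid_induction (fun σ => T.IsLinearExtension σ)
    (fun σ τ h => propext (isLinearExtension_of_arcStep h)) h)).2 hσ

theorem exists_isLinearExtension (T : Permutree δ) : ∃ σ, T.IsLinearExtension σ := by
  have hirr : ∀ v, ¬ Relation.TransGen T.edge v v := by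
    intro v h
    obtain ⟨u, hvu, huv⟩ := Relation.TransGen.head'_iff.1 h
    -- A directed walk that leaves v through its parent u cannot return to v: by acyclicity it would
    -- have to arrive through u, against the direction of that edge.
    have key : ∀ w, Relation.ReflTransGen T.edge u w → Comp T.graph v u w := by
      intro w hw
      induction hw with
      | refl => exact Comp.refl (T.adj_of_edge hvu).ne
      | @tail x y _ hxy ih =>
        refine ih.step (T.adj_of_edge hxy) ?_
        rintro rfl
        have := ih.eq_of_adj T.acyclic (T.adj_of_edge hvu) (T.adj_of_edge hxy).symm
        exact T.asymm _ _ hvu (this ▸ hxy)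
    exact (key v huv).ne rfl
  have : IsPartialOrder (Fin n) (Relation.ReflTransGen T.edge) :=
    { refl := fun _ => .refl
      trans := fun _ _ _ h h' => h.trans h'
      antisymm := fun x y h h' => by
        rcases Relation.reflTransGen_iff_eq_or_transGen.1 h with e | h
        · exact e.symm
        · exact absurd (h.trans_left h') (hirr x) }
  obtain ⟨s, hs, hle⟩ := extend_partialOrder (Relation.ReflTransGen T.edge)
  obtain ⟨σ, hσ⟩ := exists_perm_of_rel (fun x y => s x y ∧ x ≠ y) (fun x h => h.2 rfl)
    (fun x y z h h' => ⟨hs.trans _ _ _ h.1 h'.1, by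
      rintro rfl
      exact h.2 (hs.antisymm _ _ h.1 h'.1)⟩)
    (fun x y h => (hs.total x y).imp (fun h' => ⟨h', h⟩) fun h' => ⟨h', h.symm⟩)
  exact ⟨σ, fun u v huv => (hσ u v).2 ⟨hle u v (.single huv), (T.adj_of_edge huv).ne⟩⟩

end Permutree

/-! ### Every permutation is a linear extension of a permutree -/

namespace Permutree

variable {n : ℕ} {δ : Fin n → Bool × Bool}

/-! ### The place where a new largest vertex is inserted -/

section Site

/-- The neighbor of `q` in whose direction a new largest vertex lies, if `B` is the set of the
vertices that stand before the new one. -/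
def Toward (T : Permutree δ) (B : Fin n → Prop) (q p : Fin n) : Prop :=
  (B q ∧ T.edge q p ∧ ((δ q).1 = true → q < p)) ∨ (¬ B q ∧ T.edge p q ∧ ((δ q).2 = true → q < p))

/-- The component of `x` in the tree without `w` may contain a largest vertex. -/
def Roomy (T : Permutree δ) (w x : Fin n) : Prop :=
  (T.edge w x → (δ w).1 = true → w < x) ∧ (T.edge x w → (δ w).2 = true → w < x)

/-- A new largest vertex may be joined to `q`, as far as the other vertices are concerned. -/
def Admissible (T : Permutree δ) (q : Fin n) : Prop :=
  ∀ w x, T.graph.Adj w x → Comp T.graph w x q → T.Roomy w x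

/-- A vertex, or the two ends of an edge, where a new largest vertex can be inserted. -/
structure IsSite (T : Permutree δ) (B Z : Fin n → Prop) : Prop where
  nonempty : Fin n → ∃ z, Z z
  toward : ∀ a b, Z a → Z b → a ≠ b → T.Toward B a b
  closed : ∀ a b, Z a → T.Toward B a b → Z b
  admissible : ∀ z, Z z → T.Admissible z

variable {T : Permutree δ} {B : Fin n → Prop} {q p r : Fin n}

theorem Toward.unique (h : T.Toward B q p) (h' : T.Toward B q r) : p = r := by
  rcases h with ⟨hB, h1, h2⟩ | ⟨hB, h1, h2⟩ <;> rcases h' with ⟨hB', h1', h2'⟩ | ⟨hB', h1', h2'⟩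
  · by_cases hq : (δ q).1 = true
    · exact T.parent_side_unique q hq _ _ h1 h1' (iff_of_false (h2 hq).asymm (h2' hq).asymm)
    · exact T.parent_unique q (Bool.eq_false_iff.2 hq) _ _ h1 h1'
  · exact absurd hB hB'
  · exact absurd hB' hB
  · by_cases hq : (δ q).2 = true
    · exact T.child_side_unique q hq _ _ h1 h1' (iff_of_false (h2 hq).asymm (h2' hq).asymm)
    · exact T.child_unique q (Bool.eq_false_iff.2 hq) _ _ h1 h1'

theorem Toward.adj (h : T.Toward B q p) : T.graph.Adj q p :=
  T.adj_iff.2 (h.imp (fun h => h.2.1) fun h => h.2.1)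

theorem Toward.roomy (h : T.Toward B q p) : T.Roomy q p := by
  rcases h with ⟨-, h1, h2⟩ | ⟨-, h1, h2⟩
  · exact ⟨fun _ => h2, fun h => absurd h1 (T.asymm _ _ h)⟩
  · exact ⟨fun h => absurd h1 (T.asymm _ _ h), fun _ => h2⟩

/-- For the edge from q to p the direction itself provides the room; deleting any other vertex
leaves p and q in the same component. -/
theorem Admissible.toward (hq : T.Admissible q) (h : T.Toward B q p) : T.Admissible p := by
  intro w x hwx hx
  by_cases hw : w = q
  · subst hw
    rw [← hx.eq_of_adj T.acyclic hwx h.adj]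
    exact h.roomy
  · exact hq w x hwx (hx.step h.adj.symm (Ne.symm hw))

/-- If no neighbor is indicated at q, then q alone is a site. If the indicated neighbor points back,
the edge is a site. Otherwise the search moves on. -/
theorem exists_isSite_or_toward (hq : T.Admissible q) :
    (∃ Z, T.IsSite B Z) ∨ ∃ p, T.Toward B q p ∧ ¬ T.Toward B p q := by
  by_cases h : ∃ p, T.Toward B q p
  · obtain ⟨p, hp⟩ := h
    by_cases hp' : T.Toward B p q
    · refine Or.inl ⟨fun z => z = q ∨ z = p, fun _ => ⟨q, Or.inl rfl⟩, ?_, ?_, ?_⟩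
      · rintro a b (rfl | rfl) (rfl | rfl) hab
        · exact absurd rfl hab
        · exact hp
        · exact hp'
        · exact absurd rfl hab
      · rintro a b (rfl | rfl) hab
        · exact Or.inr (hab.unique hp)
        · exact Or.inl (hab.unique hp')
      · rintro z (rfl | rfl)
        · exact hq
        · exact hq.toward hp
    · exact Or.inr ⟨p, hp, hp'⟩
  · push Not at h
    refine Or.inl ⟨fun z => z = q, fun _ => ⟨q, rfl⟩, ?_, ?_, ?_⟩
    · rintro a b rfl rfl hab
      exact absurd rfl hab
    · rintro a b rfl hab
      exact absurd hab (h b)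
    · rintro z rfl
      exact hq

/-- The search never turns back, so the component ahead of it gets strictly smaller. -/
theorem exists_isSite_of_toward (N : ℕ) : ∀ q p, T.Toward B q p → ¬ T.Toward B p q →
    T.Admissible p → {w | Comp T.graph q p w}.ncard ≤ N → ∃ Z, T.IsSite B Z := by
  induction N with
  | zero =>
    intro q p hqp _ _ hN
    have : p ∈ {w | Comp T.graph q p w} := Comp.refl hqp.adj.ne
    rw [Nat.le_zero, Set.ncard_eq_zero] at hN
    exact absurd (hN ▸ this) (Set.notMem_empty p)
  | succ N ih =>
    intro q p hqp hpq hp hN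
    rcases exists_isSite_or_toward (B := B) hp with h | ⟨r, hpr, hrp⟩
    · exact h
    refine ih p r hpr hrp (hp.toward hpr) (Nat.lt_succ_iff.1 (lt_of_lt_of_le ?_ hN))
    have hrq : r ≠ q := by
      rintro rfl
      exact hpq hpr
    have hq : ¬ Comp T.graph p r q := fun h =>
      hrq (h.eq_of_adj T.acyclic hpr.adj hqp.adj.symm).symm
    refine Set.ncard_lt_ncard ⟨fun w hw => ?_, fun h => ?_⟩
    · refine (Comp.induction (S := fun x => Comp T.graph q p x ∧ Comp T.graph p r x) hw
        ⟨(Comp.refl hqp.adj.ne).step hpr.adj hrq, Comp.refl hpr.adj.ne⟩ ?_).1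
      rintro x y ⟨h1, h2⟩ hxy hy
      have h3 := h2.step hxy hy
      refine ⟨h1.step hxy ?_, h3⟩
      rintro rfl
      exact hq h3
    · exact (h (Comp.refl hqp.adj.ne) : Comp T.graph p r p).ne rfl

/-- The search starts at the largest vertex, which is admissible because no component that contains
it lies to the left of another vertex. -/
theorem exists_isSite (T : Permutree δ) (B : Fin n → Prop) : ∃ Z, T.IsSite B Z := by
  rcases n with _ | n
  · exact ⟨fun _ => True, fun i => i.elim0, fun i => i.elim0, fun i => i.elim0, fun i => i.elim0⟩
  have hm : T.Admissible (Fin.last n) := by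
    intro w x _ hx
    refine ⟨fun h hw => ?_, fun h hw => ?_⟩
    · rcases T.parent_comp hw h with ⟨-, h⟩ | ⟨h, -⟩
      · exact absurd (h _ hx) (Fin.le_last w).not_gt
      · exact h
    · rcases T.child_comp hw h with ⟨-, h⟩ | ⟨h, -⟩
      · exact absurd (h _ hx) (Fin.le_last w).not_gt
      · exact h
  rcases exists_isSite_or_toward (B := B) hm with h | ⟨p, h1, h2⟩
  · exact h
  · exact exists_isSite_of_toward _ _ p h1 h2 (hm.toward h1) le_rfl

end Site

/-! ### The tree after the insertion -/

section Insert

variable {δ : Fin (n + 1) → Bool × Bool}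

/-- The edges after the insertion of a new largest vertex. -/
def insertEdge (T : Permutree (δ ∘ Fin.castSucc)) (B Z : Fin n → Prop) (x y : Fin (n + 1)) :
    Prop :=
  Fin.lastCases (motive := fun _ => Prop)
    (Fin.lastCases (motive := fun _ => Prop) False (fun j => Z j ∧ ¬ B j) y)
    (fun i => Fin.lastCases (motive := fun _ => Prop) (Z i ∧ B i)
      (fun j => T.edge i j ∧ ¬ (Z i ∧ Z j)) y) x

variable {T : Permutree (δ ∘ Fin.castSucc)} {B Z : Fin n → Prop}

theorem insertEdge_old {i j : Fin n} : T.insertEdge B Z i.castSucc j.castSucc ↔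
    T.edge i j ∧ ¬ (Z i ∧ Z j) := by
  simp [insertEdge]

theorem insertEdge_to_last {i : Fin n} : T.insertEdge B Z i.castSucc (Fin.last n) ↔
    Z i ∧ B i := by
  simp [insertEdge]

theorem insertEdge_from_last {j : Fin n} : T.insertEdge B Z (Fin.last n) j.castSucc ↔
    Z j ∧ ¬ B j := by
  simp [insertEdge]

theorem not_insertEdge_last : ¬ T.insertEdge B Z (Fin.last n) (Fin.last n) := by
  simp [insertEdge]

/-- The tree after the insertion of a new largest vertex. -/
abbrev insertGraph (T : Permutree (δ ∘ Fin.castSucc)) (B Z : Fin n → Prop) :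
    SimpleGraph (Fin (n + 1)) := SimpleGraph.fromRel (T.insertEdge B Z)

theorem insertGraph_old {i j : Fin n} : (T.insertGraph B Z).Adj i.castSucc j.castSucc ↔
    T.graph.Adj i j ∧ ¬ (Z i ∧ Z j) := by
  rw [SimpleGraph.fromRel_adj, insertEdge_old, insertEdge_old, T.adj_iff, and_comm (a := Z j),
    ← or_and_right]
  refine and_iff_right_of_imp fun h e => ?_
  rw [Fin.castSucc_inj] at e
  exact (T.adj_iff.2 h.1).ne e

theorem insertGraph_last {i : Fin n} : (T.insertGraph B Z).Adj i.castSucc (Fin.last n) ↔ Z i := by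
  rw [SimpleGraph.fromRel_adj, insertEdge_to_last, insertEdge_from_last, ← and_or_left,
    and_iff_left (em _)]
  exact and_iff_right (Fin.castSucc_lt_last i).ne

theorem insertGraph_reachable (hZ : T.IsSite B Z) (x : Fin (n + 1)) :
    (T.insertGraph B Z).Reachable x (Fin.last n) := by
  induction x using Fin.lastCases with
  | last => exact .refl _
  | cast i =>
    obtain ⟨z, hz⟩ := hZ.nonempty i
    obtain ⟨p⟩ := T.connected i z
    induction p with
    | nil => exact (insertGraph_last.2 hz).reachable
    | @cons i j z hij p ih =>
      refine SimpleGraph.Reachable.trans ?_ (ih hz)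
      by_cases h : Z i ∧ Z j
      · exact (insertGraph_last.2 h.1).reachable.trans (insertGraph_last.2 h.2).symm.reachable
      · exact (insertGraph_old.2 ⟨hij, h⟩).reachable

/-- The set of the old vertices in `C`, and the new vertex if `L` holds. -/
def insertSet (C : Fin n → Prop) (L : Prop) (x : Fin (n + 1)) : Prop :=
  Fin.lastCases (motive := fun _ => Prop) L C x

theorem insertSet_old {C : Fin n → Prop} {L : Prop} {i : Fin n} :
    insertSet C L i.castSucc ↔ C i := by
  simp [insertSet]

theorem insertSet_last {C : Fin n → Prop} {L : Prop} : insertSet C L (Fin.last n) ↔ L := by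
  simp [insertSet]

/-- The old part must be closed away from a, and it must be linked with the new vertex in both
directions: whoever contains a vertex of the site contains the new vertex, and conversely. -/
theorem insertSet_step {a : Fin n} {C : Fin n → Prop} {L : Prop}
    (hC : ∀ i j, C i → T.graph.Adj i j → j ≠ a → C j) (h1 : ∀ i, C i → Z i → L)
    (h2 : ∀ j, L → Z j → j ≠ a → C j) (x y : Fin (n + 1)) (hx : insertSet C L x)
    (hxy : (T.insertGraph B Z).Adj x y) (hy : y ≠ a.castSucc) : insertSet C L y := by
  induction x using Fin.lastCases with
  | last =>
    rw [insertSet_last] at hx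
    induction y using Fin.lastCases with
    | last => exact absurd rfl hxy.ne
    | cast j =>
      exact insertSet_old.2 (h2 j hx (insertGraph_last.1 hxy.symm) fun e => hy (e ▸ rfl))
  | cast i =>
    rw [insertSet_old] at hx
    induction y using Fin.lastCases with
    | last => exact insertSet_last.2 (h1 i hx (insertGraph_last.1 hxy))
    | cast j =>
      exact insertSet_old.2 (hC i j hx (insertGraph_old.1 hxy).1 fun e => hy (e ▸ rfl))

/-- The component of `b` without `a`, after the insertion. -/
abbrev oldSet (T : Permutree (δ ∘ Fin.castSucc)) (Z : Fin n → Prop) (a b : Fin n) :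
    Fin (n + 1) → Prop :=
  insertSet (Comp T.graph a b) (∃ z, Z z ∧ Comp T.graph a b z)

/-- The component of the new vertex without `a`. -/
abbrev newSet (T : Permutree (δ ∘ Fin.castSucc)) (Z : Fin n → Prop) (a : Fin n) :
    Fin (n + 1) → Prop :=
  insertSet (fun i => ∃ z, Z z ∧ z ≠ a ∧ Comp T.graph a z i) True

theorem oldSet_step (hZ : T.IsSite B Z) {a b : Fin n} (x y : Fin (n + 1))
    (hx : T.oldSet Z a b x) (hxy : (T.insertGraph B Z).Adj x y) (hy : y ≠ a.castSucc) :
    T.oldSet Z a b y := by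
  refine insertSet_step (fun i j hi hij hj => hi.step hij hj) (fun i hi hi' => ⟨i, hi', hi⟩) ?_
    x y hx hxy hy
  rintro j ⟨z, hz, hz'⟩ hj hja
  by_cases hzj : z = j
  · exact hzj ▸ hz'
  · exact hz'.step (hZ.toward z j hz hj hzj).adj hja

theorem newSet_step {a : Fin n} (x y : Fin (n + 1)) (hx : T.newSet Z a x)
    (hxy : (T.insertGraph B Z).Adj x y) (hy : y ≠ a.castSucc) : T.newSet Z a y := by
  refine insertSet_step ?_ (fun i _ _ => trivial)
    (fun j _ hj hja => ⟨j, hj, hja, Comp.refl (Ne.symm hja)⟩) x y hx hxy hy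
  rintro i j ⟨z, h1, h2, h3⟩ hij hj
  exact ⟨z, h1, h2, h3.step hij hj⟩

/-- Every edge is a bridge; `newSet` and `oldSet` describe what lies behind a new edge and behind an
old one. -/
theorem insertGraph_isAcyclic (hZ : T.IsSite B Z) : (T.insertGraph B Z).IsAcyclic := by
  rw [SimpleGraph.isAcyclic_iff_forall_adj_isBridge]
  have hlast : ∀ a : Fin n, Z a → (T.insertGraph B Z).IsBridge s(a.castSucc, Fin.last n) := by
    intro a ha
    refine isBridge_of_invariant (S := T.newSet Z a) (insertSet_last.2 trivial) ?_ newSet_step ?_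
    · rw [newSet, insertSet_old]
      rintro ⟨z, -, -, h⟩
      exact h.ne rfl
    · intro x hx hax
      induction x using Fin.lastCases with
      | last => rfl
      | cast i =>
        obtain ⟨z, h1, h2, h3⟩ := insertSet_old.1 hx
        obtain ⟨h4, h5⟩ := insertGraph_old.1 hax
        rw [h3.eq_of_adj T.acyclic (hZ.toward a z ha h1 h2.symm).adj h4] at h5
        exact absurd ⟨ha, h1⟩ h5
  intro v u hvu
  induction v using Fin.lastCases with
  | last =>
    induction u using Fin.lastCases with
    | last => exact absurd rfl hvu.ne
    | cast b =>
      rw [Sym2.eq_swap]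
      exact hlast b (insertGraph_last.1 hvu.symm)
  | cast a =>
    induction u using Fin.lastCases with
    | last => exact hlast a (insertGraph_last.1 hvu)
    | cast b =>
      obtain ⟨hab, hn⟩ := insertGraph_old.1 hvu
      refine isBridge_of_invariant (S := T.oldSet Z a b) (insertSet_old.2 (Comp.refl hab.ne)) ?_
        (oldSet_step hZ) ?_
      · rw [oldSet, insertSet_old]
        exact fun h => h.ne rfl
      · intro x hx hax
        induction x using Fin.lastCases with
        | last =>
          obtain ⟨z, hz, hz'⟩ := insertSet_last.1 hx
          have ha := insertGraph_last.1 hax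
          have := hz'.eq_of_adj T.acyclic hab (hZ.toward a z ha hz hz'.ne.symm).adj
          exact absurd ⟨ha, this ▸ hz⟩ hn
        | cast i =>
          rw [(insertSet_old.1 hx).eq_of_adj T.acyclic hab (insertGraph_old.1 hax).1]

/-- All vertices of the component of `u` without `v` are on the same side of `v`. -/
def OneSided {V : Type*} [LT V] (G : SimpleGraph V) (v u : V) : Prop :=
  (u < v ∧ ∀ w, ∀ p : G.Walk u w, v ∉ p.support → w < v) ∨
    (v < u ∧ ∀ w, ∀ p : G.Walk u w, v ∉ p.support → v < w)

theorem oneSided_last (b : Fin n) : OneSided (T.insertGraph B Z) (Fin.last n) b.castSucc :=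
  Or.inl ⟨Fin.castSucc_lt_last b, fun w p hp =>
    lt_of_le_of_ne (Fin.le_last w) (Comp.ne ⟨p, hp⟩)⟩

/-- The condition `h'` is where admissibility enters: a component that absorbs the largest vertex
must lie on the right of a. -/
theorem oneSided_old (hZ : T.IsSite B Z) {a b : Fin n} (hab : a ≠ b)
    (h : (b < a ∧ ∀ w, Comp T.graph a b w → w < a) ∨ (a < b ∧ ∀ w, Comp T.graph a b w → a < w))
    (h' : ∀ z, Z z → Comp T.graph a b z → a < b) :
    OneSided (T.insertGraph B Z) a.castSucc b.castSucc := by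
  have key : ∀ w, ∀ p : (T.insertGraph B Z).Walk b.castSucc w, a.castSucc ∉ p.support →
      T.oldSet Z a b w := fun w p hp =>
    Comp.induction (S := T.oldSet Z a b) ⟨p, hp⟩ (insertSet_old.2 (Comp.refl hab))
      (oldSet_step hZ)
  refine h.imp (fun h => ⟨Fin.castSucc_lt_castSucc_iff.2 h.1, fun w p hp => ?_⟩)
    fun h => ⟨Fin.castSucc_lt_castSucc_iff.2 h.1, fun w p hp => ?_⟩ <;>
    have hw := key w p hp <;> induction w using Fin.lastCases with
    | last =>
      first
      | exact Fin.castSucc_lt_last a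
      | obtain ⟨z, hz, hz'⟩ := insertSet_last.1 hw
        exact absurd (h' z hz hz') h.1.asymm
    | cast i => exact Fin.castSucc_lt_castSucc_iff.2 (h.2 i (insertSet_old.1 hw))

theorem oneSided_new {a : Fin n}
    (h : ∀ z, Z z → z ≠ a → ∀ w, Comp T.graph a z w → a < w) :
    OneSided (T.insertGraph B Z) a.castSucc (Fin.last n) := by
  refine Or.inr ⟨Fin.castSucc_lt_last a, fun w p hp => ?_⟩
  have hw := Comp.induction (S := T.newSet Z a) ⟨p, hp⟩ (insertSet_last.2 trivial) newSet_step
  induction w using Fin.lastCases with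
  | last => exact Fin.castSucc_lt_last a
  | cast i =>
    obtain ⟨z, h1, h2, h3⟩ := insertSet_old.1 hw
    exact Fin.castSucc_lt_castSucc_iff.2 (h z h1 h2 i h3)

/-- Of two vertices of a site, joined by an edge, the child stands before the new vertex and the
parent does not. -/
theorem IsSite.eq_of_lower (hZ : T.IsSite B Z) {a b : Fin n} (ha : Z a) (hb : Z b)
    (h : B a ↔ B b) : a = b := by
  by_contra hab
  rcases hZ.toward a b ha hb hab with ⟨h1, h2, -⟩ | ⟨h1, h2, -⟩ <;>
    rcases hZ.toward b a hb ha (Ne.symm hab) with ⟨h3, h4, -⟩ | ⟨h3, h4, -⟩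
  · exact T.asymm _ _ h2 h4
  · exact h3 (h.1 h1)
  · exact h1 (h.2 h3)
  · exact T.asymm _ _ h2 h4

/-- Insertion of a new largest vertex. -/
def insert (T : Permutree (δ ∘ Fin.castSucc)) (hZ : T.IsSite B Z)
    (hasymm : ∀ x y, T.insertEdge B Z x y → ¬ T.insertEdge B Z y x) : Permutree δ where
  edge := T.insertEdge B Z
  asymm := hasymm
  connected x y := (insertGraph_reachable hZ x).trans (insertGraph_reachable hZ y).symm
  acyclic := insertGraph_isAcyclic hZ
  parent_unique v hv u u' h h' := by
    induction v using Fin.lastCases with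
    | last =>
      induction u using Fin.lastCases with
      | last => exact absurd h not_insertEdge_last
      | cast b =>
        induction u' using Fin.lastCases with
        | last => exact absurd h' not_insertEdge_last
        | cast b' =>
          rw [insertEdge_from_last] at h h'
          rw [hZ.eq_of_lower h.1 h'.1 (iff_of_false h.2 h'.2)]
    | cast a =>
      -- If the new vertex is a parent of a, then an old parent of a is in the direction of the new
      -- vertex and so belongs to the site; but edges within the site have been removed.
      have key : ∀ b, Z a ∧ B a → T.edge a b ∧ ¬ (Z a ∧ Z b) → False := fun b h h' =>
        h'.2 ⟨h.1, hZ.closed a b h.1 (Or.inl ⟨h.2, h'.1, fun h => by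
          rw [Function.comp_apply, hv] at h
          cases h⟩)⟩
      induction u using Fin.lastCases with
      | last =>
        induction u' using Fin.lastCases with
        | last => rfl
        | cast b' => exact (key b' (insertEdge_to_last.1 h) (insertEdge_old.1 h')).elim
      | cast b =>
        induction u' using Fin.lastCases with
        | last => exact (key b (insertEdge_to_last.1 h') (insertEdge_old.1 h)).elim
        | cast b' =>
          rw [T.parent_unique a hv b b' (insertEdge_old.1 h).1 (insertEdge_old.1 h').1]
  child_unique v hv u u' h h' := by
    induction v using Fin.lastCases with
    | last =>
      induction u using Fin.lastCases with
      | last => exact absurd h not_insertEdge_last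
      | cast b =>
        induction u' using Fin.lastCases with
        | last => exact absurd h' not_insertEdge_last
        | cast b' =>
          rw [insertEdge_to_last] at h h'
          rw [hZ.eq_of_lower h.1 h'.1 (iff_of_true h.2 h'.2)]
    | cast a =>
      have key : ∀ b, Z a ∧ ¬ B a → T.edge b a ∧ ¬ (Z b ∧ Z a) → False := fun b h h' =>
        h'.2 ⟨hZ.closed a b h.1 (Or.inr ⟨h.2, h'.1, fun h => by
          rw [Function.comp_apply, hv] at h
          cases h⟩), h.1⟩
      induction u using Fin.lastCases with
      | last =>
        induction u' using Fin.lastCases with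
        | last => rfl
        | cast b' => exact (key b' (insertEdge_from_last.1 h) (insertEdge_old.1 h')).elim
      | cast b =>
        induction u' using Fin.lastCases with
        | last => exact (key b (insertEdge_from_last.1 h') (insertEdge_old.1 h)).elim
        | cast b' =>
          rw [T.child_unique a hv b b' (insertEdge_old.1 h).1 (insertEdge_old.1 h').1]
  parent_side v hv u h := by
    change OneSided (T.insertGraph B Z) v u
    induction v using Fin.lastCases with
    | last =>
      induction u using Fin.lastCases with
      | last => exact absurd h not_insertEdge_last
      | cast b => exact oneSided_last b
    | cast a =>
      induction u using Fin.lastCases with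
      | last =>
        obtain ⟨ha, hB⟩ := insertEdge_to_last.1 h
        refine oneSided_new fun z hz hza w hw => ?_
        rcases hZ.toward a z ha hz hza.symm with ⟨-, h1, h2⟩ | ⟨h1, -⟩
        · rcases T.parent_comp hv h1 with ⟨h3, -⟩ | ⟨-, h3⟩
          · exact absurd (h2 hv) h3.asymm
          · exact h3 w hw
        · exact absurd hB h1
      | cast b =>
        have hab := (insertEdge_old.1 h).1
        exact oneSided_old hZ (T.adj_of_edge hab).ne (T.parent_comp hv hab) fun z hz hz' =>
          (hZ.admissible z hz a b (T.adj_of_edge hab) hz').1 hab hv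
  child_side v hv u h := by
    change OneSided (T.insertGraph B Z) v u
    induction v using Fin.lastCases with
    | last =>
      induction u using Fin.lastCases with
      | last => exact absurd h not_insertEdge_last
      | cast b => exact oneSided_last b
    | cast a =>
      induction u using Fin.lastCases with
      | last =>
        obtain ⟨ha, hB⟩ := insertEdge_from_last.1 h
        refine oneSided_new fun z hz hza w hw => ?_
        rcases hZ.toward a z ha hz hza.symm with ⟨h1, -⟩ | ⟨-, h1, h2⟩
        · exact absurd h1 hB
        · rcases T.child_comp hv h1 with ⟨h3, -⟩ | ⟨-, h3⟩
          · exact absurd (h2 hv) h3.asymm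
          · exact h3 w hw
      | cast b =>
        have hab := (insertEdge_old.1 h).1
        have hadj := (T.adj_of_edge hab).symm
        exact oneSided_old hZ hadj.ne (T.child_comp hv hab) fun z hz hz' =>
          (hZ.admissible z hz a b hadj hz').2 hab hv
  parent_side_unique v hv u u' h h' hs := by
    induction v using Fin.lastCases with
    | last =>
      induction u using Fin.lastCases with
      | last => exact absurd h not_insertEdge_last
      | cast b =>
        induction u' using Fin.lastCases with
        | last => exact absurd h' not_insertEdge_last
        | cast b' =>
          rw [insertEdge_from_last] at h h'
          rw [hZ.eq_of_lower h.1 h'.1 (iff_of_false h.2 h'.2)]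
    | cast a =>
      have key : ∀ b, Z a ∧ B a → T.edge a b ∧ ¬ (Z a ∧ Z b) → ¬ b.castSucc < a.castSucc → False :=
        fun b h h' hn => h'.2 ⟨h.1, hZ.closed a b h.1 (Or.inl ⟨h.2, h'.1, fun _ =>
          lt_of_le_of_ne (not_lt.1 hn) (T.adj_of_edge h'.1).ne⟩)⟩
      have hlast := (Fin.castSucc_lt_last a).asymm
      induction u using Fin.lastCases with
      | last =>
        induction u' using Fin.lastCases with
        | last => rfl
        | cast b' =>
          exact (key b' (insertEdge_to_last.1 h) (insertEdge_old.1 h') (mt hs.2 hlast)).elim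
      | cast b =>
        induction u' using Fin.lastCases with
        | last => exact (key b (insertEdge_to_last.1 h') (insertEdge_old.1 h) (mt hs.1 hlast)).elim
        | cast b' =>
          rw [T.parent_side_unique a hv b b' (insertEdge_old.1 h).1 (insertEdge_old.1 h').1 hs]
  child_side_unique v hv u u' h h' hs := by
    induction v using Fin.lastCases with
    | last =>
      induction u using Fin.lastCases with
      | last => exact absurd h not_insertEdge_last
      | cast b =>
        induction u' using Fin.lastCases with
        | last => exact absurd h' not_insertEdge_last
        | cast b' =>
          rw [insertEdge_to_last] at h h'
          rw [hZ.eq_of_lower h.1 h'.1 (iff_of_true h.2 h'.2)]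
    | cast a =>
      have key : ∀ b, Z a ∧ ¬ B a → T.edge b a ∧ ¬ (Z b ∧ Z a) → ¬ b.castSucc < a.castSucc →
          False :=
        fun b h h' hn => h'.2 ⟨hZ.closed a b h.1 (Or.inr ⟨h.2, h'.1, fun _ =>
          lt_of_le_of_ne (not_lt.1 hn) (T.adj_of_edge h'.1).symm.ne⟩), h.1⟩
      have hlast := (Fin.castSucc_lt_last a).asymm
      induction u using Fin.lastCases with
      | last =>
        induction u' using Fin.lastCases with
        | last => rfl
        | cast b' =>
          exact (key b' (insertEdge_from_last.1 h) (insertEdge_old.1 h') (mt hs.2 hlast)).elim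
      | cast b =>
        induction u' using Fin.lastCases with
        | last =>
          exact (key b (insertEdge_from_last.1 h') (insertEdge_old.1 h) (mt hs.1 hlast)).elim
        | cast b' =>
          rw [T.child_side_unique a hv b b' (insertEdge_old.1 h).1 (insertEdge_old.1 h').1 hs]

end Insert

/-- The largest value is inserted into a permutree for the word of the other values, and `B` records
which of them stand before it. Every new edge then agrees with the order of σ. -/
theorem exists_of_perm (n : ℕ) : ∀ (δ : Fin n → Bool × Bool) (σ : Equiv.Perm (Fin n)),
    ∃ T : Permutree δ, T.IsLinearExtension σ := by
  induction n with
  | zero =>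
    intro δ σ
    exact ⟨⟨fun _ _ => False, fun i => i.elim0, fun i => i.elim0, fun i => i.elim0,
      fun i => i.elim0, fun i => i.elim0, fun i => i.elim0, fun i => i.elim0, fun i => i.elim0,
      fun i => i.elim0⟩, fun i => i.elim0⟩
  | succ n ih =>
    intro δ σ
    obtain ⟨T, hT⟩ := ih (δ ∘ Fin.castSucc) (stdVal σ Fin.castSuccOrderEmb)
    obtain ⟨Z, hZ⟩ := T.exists_isSite fun i => Bef σ i.castSucc (Fin.last n)
    have hlin : ∀ x y, T.insertEdge (fun i => Bef σ i.castSucc (Fin.last n)) Z x y →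
        Bef σ x y := by
      intro x y h
      induction x using Fin.lastCases with
      | last =>
        induction y using Fin.lastCases with
        | last => exact absurd h not_insertEdge_last
        | cast j => exact bef_of_not (Fin.castSucc_lt_last j).ne' (insertEdge_from_last.1 h).2
      | cast i =>
        induction y using Fin.lastCases with
        | last => exact (insertEdge_to_last.1 h).2
        | cast j => exact bef_stdVal.1 (hT i j (insertEdge_old.1 h).1)
    exact ⟨T.insert hZ fun x y h h' => (hlin x y h).asymm (hlin y x h'), hlin⟩

end Permutree

/-! ### The permutree algebra -/

section PermutreeAlgebra

variable {k : Type*} [Field k]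

theorem permutreeElement_eq {n : ℕ} {δ : Fin n → Bool × Bool} (T : Permutree δ)
    {σ : Equiv.Perm (Fin n)} (hσ : T.IsLinearExtension σ) :
    permutreeElement k T = FSum k (𝔛 := permutreeWords) δ fun τ =>
      eta (wordArcs (δ : permutreeWords.X n)) τ = eta (wordArcs (δ : permutreeWords.X n)) σ :=
  FSum_congr fun _ => T.isLinearExtension_iff_eta hσ

/-- The linear extensions of a permutree form one class. Conversely a nonempty fiber contains a
permutation, which is a linear extension of some permutree; an empty fiber contributes the zero
vector. -/
theorem permutreeAlgebra_eq :
    permutreeAlgebra k = diagramAlgebra k permutreeWords wordArcs := by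
  refine le_antisymm (Submodule.span_le.2 ?_) (Submodule.span_le.2 ?_)
  · rintro _ ⟨n, δ, T, rfl⟩
    obtain ⟨σ, hσ⟩ := T.exists_isLinearExtension
    rw [permutreeElement_eq T hσ]
    exact FSum_eta_mem (𝔛 := permutreeWords) (arcs := wordArcs) δ σ
  · rintro _ ⟨n, δ, D, -, -, rfl⟩
    by_cases h : ∃ σ, eta (wordArcs δ) σ = D
    · obtain ⟨σ, rfl⟩ := h
      obtain ⟨T, hT⟩ := Permutree.exists_of_perm n δ σ
      exact Submodule.subset_span ⟨n, δ, T, (permutreeElement_eq T hT).symm⟩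
    · push Not at h
      classical
      have : FSum k δ (fun σ => eta (wordArcs δ) σ = D) = 0 := by
        rw [FSum_def, Finset.filter_false_of_mem fun σ _ => h σ, Finset.sum_empty]
      rw [this]
      exact zero_mem _

theorem permutreeMap_permutreeElement {n : ℕ} {δ : Fin n → Bool × Bool} (T : Permutree δ) :
    ∃ D : Set RawArc, IsNoncrossingDiagram n D ∧ D ⊆ (wordIdeal δ).strict.carrier ∧
      permutreeMap k (permutreeElement k T) =
        FSum k (𝔛 := extIdeals) (wordIdeal δ) fun σ => eta (wordIdeal δ).strict σ = D := by
  obtain ⟨σ, hσ⟩ := T.exists_isLinearExtension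
  refine ⟨_, eta_isNoncrossing _ σ, eta_subset _ σ, ?_⟩
  rw [permutreeElement_eq T hσ]
  exact permutreeMap_FSum (n := n) δ _

theorem map_permutreeAlgebra_le : (permutreeAlgebra k).map (permutreeMap k) ≤ kDStar k := by
  rw [permutreeAlgebra, Submodule.map_span_le]
  rintro _ ⟨n, δ, T, rfl⟩
  obtain ⟨D, h1, h2, h3⟩ := permutreeMap_permutreeElement (k := k) T
  rw [h3]
  exact Submodule.subset_span ⟨n, wordIdeal δ, D, h1, h2, rfl⟩

end PermutreeAlgebra

end ArcHopf

/-! ### The theorem -/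

theorem mainTheorem8 (k : Type*) [Field k] :
    -- extended arc ideals form a decoration set, and taking strict arcs is conservative
    IsDecorationSet extIdeals ∧
    IsConservative extIdeals ExtArcIdeal.strict ∧
    -- the resulting Hopf algebra
    IsGradedHopf (decPermAlgebra k extIdeals) ∧
    IsHopfSubalgebra (decPermAlgebra k extIdeals) (kDStar k) ∧
    -- it involves exactly the classes of all lattice congruences of the weak order
    (∀ (n : ℕ) (r : Setoid (Equiv.Perm (Fin n))), IsLatticeCongruence r →
      ∃ K : ExtArcIdeal n, K.strict.carrier = uncontractedArcs r ∧
        (∀ σ τ, r σ τ ↔ eta K.strict σ = eta K.strict τ) ∧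
        ∀ σ, FSum k (𝔛 := extIdeals) K (fun τ => r σ τ) ∈ kDStar k) ∧
    (∀ (n : ℕ) (K : ExtArcIdeal n), IsLatticeCongruence (Setoid.ker (eta K.strict))) ∧
    -- the permutree algebra is a Hopf algebra
    IsGradedHopf (decPermAlgebra k permutreeWords) ∧
    IsHopfSubalgebra (decPermAlgebra k permutreeWords) (permutreeAlgebra k) ∧
    -- it embeds as a Hopf subalgebra
    Function.Injective (permutreeMap k) ∧
    IsHopfMorphism (decPermAlgebra k permutreeWords) (decPermAlgebra k extIdeals)
      (permutreeMap k) ∧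
    (permutreeAlgebra k).map (permutreeMap k) ≤ kDStar k ∧
    IsHopfSubalgebra (decPermAlgebra k extIdeals) ((permutreeAlgebra k).map (permutreeMap k)) ∧
    (∀ (n : ℕ) (δ : Fin n → Bool × Bool) (T : Permutree δ),
      ∃ D : Set RawArc, IsNoncrossingDiagram n D ∧ D ⊆ (wordIdeal δ).strict.carrier ∧
        permutreeMap k (permutreeElement k T) =
          FSum k (𝔛 := extIdeals) (wordIdeal δ) fun σ => eta (wordIdeal δ).strict σ = D) := by
  -- Being an algebra of class sums for a conservative function on words, the permutree algebra
  -- falls under the general statement.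
  have hsub := isHopfSubalgebra_diagramAlgebra (k := k) isConservative_permutreeWords
  rw [← permutreeAlgebra_eq] at hsub
  refine ⟨isUnitalDecorationSet_extIdeals.toIsDecorationSet, isConservative_extIdeals,
    isGradedHopf_decPermAlgebra isUnitalDecorationSet_extIdeals,
    isHopfSubalgebra_diagramAlgebra isConservative_extIdeals, fun n r hr => ?_,
    fun n K => isLatticeCongruence_eta K.strict,
    isGradedHopf_decPermAlgebra isUnitalDecorationSet_permutreeWords, hsub,
    permutreeMap_injective, isHopfMorphism_permutreeMap, map_permutreeAlgebra_le,
    isHopfMorphism_permutreeMap.map_isHopfSubalgebra hsub,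
    fun n δ T => permutreeMap_permutreeElement T⟩
  refine ⟨congruenceIdeal hr, congruenceIdeal_strict hr, fun σ τ => rel_iff_eta hr, fun σ => ?_⟩
  have h := FSum_mem_diagramAlgebra (k := k) (𝔛 := extIdeals) (arcs := ExtArcIdeal.strict)
    (congruenceIdeal hr) (P := fun τ => r σ τ) fun τ υ h h' =>
      Setoid.trans' r h' ((rel_iff_eta hr).2 h)
  exact h
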